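/- For integers $t \ge 0$ and $h \ge k \ge 1$ let $\mathcal{B}^k_{t,h}$ be the ordered tree, with edges labelled by bit strings in $\{0,1\}^*$, whose nodes are the prefixes of the sequences $\langle \beta_{h-1}, \dots, \beta_1\rangle$ of bit strings such that (1) exactly $k-1$ of the $\beta_i$ are non-empty; (2) the total number of bits in $\beta_{h-1},\dots,\beta_1$ is at most $(k-1)+t$; and, for every $i = 1,\dots,h-1$, (3) if fewer than $k-1$ of $\beta_{h-1},\dots,\beta_{i+1}$ are non-empty, but exactly $t$ non-leading bits occur in them, then $\beta_i = 0$; (4) if all of $\beta_i,\dots,\beta_1$ are non-empty, then each of them has $0$ as its first bit. (The first bit of a non-empty string is its leading bit; all other bits are non-leading.) Its leaves are exactly these sequences. Bit strings are linearly ordered by $0\beta < \varepsilon < 1\beta'$ and $b\beta < b\beta' \iff \beta < \beta'$, and sequences of bit strings are ordered lexicographically by $<_{\mathrm{lex}}$. For $1 \le p \le h$, the level-$p$ successor of a leaf $\langle\beta_{h-1},\dots,\beta_1\rangle$ is the $<_{\mathrm{lex}}$-smallest leaf $\langle\beta'_{h-1},\dots,\beta'_1\rangle$ with $\langle\beta_{h-1},\dots,\beta_p\rangle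 <_{\mathrm{lex}} \langle\beta'_{h-1},\dots,\beta'_p\rangle$, if there is such a leaf. (For $p=h$ both truncations are empty and there is none.) Represent a leaf by listing, for each bit of $\beta_{h-1},\dots,\beta_1$ in this order, the bit itself followed by the index $i$ of the string $\beta_i$ that it belongs to, written in binary with as many digits as $h$ has. **Lemma.** There is a constant $C$ such that for all $t \ge 0$ and $h \ge k \ge 1$ this representation is injective on the leaves of $\mathcal{B}^k_{t,h}$ and uses at most $C\,(k+t)\log h$ bits for each of them. Moreover, there are a constant $C$ and a single Turing machine with finitely many stacks which, for all $t \ge 0$, $h \ge k \ge 1$, $1 \le p \le h$ and every leaf $\ell$ of $\mathcal{B}^k_{t,h}$, given $h$, $k$, $t$, $p$ in binary and $\ell$ in the above representation, outputs the level-$p$ successor of $\ell$ in the same representation (or reports that there is none) within $C\,(k+t)\log h$ steps. Here $\log h$ stands for $\max\{1, \log_2 h\}$, which differs from $\log_2 h$ only for $h=1$. -/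

import Mathlib

/-- The linear order on bit strings with `0β < ε < 1β'`, `0β < 1β'`, and
`bβ < bβ'` if and only if `β < β'`. -/
def bitStringLT : List Bool → List Bool → Prop
  | [], [] => False
  | [], b :: _ => b = true
  | b :: _, [] => b = false
  | b :: β, b' :: β' => (b = false ∧ b' = true) ∨ (b = b' ∧ bitStringLT β β')

/-- The lexicographic order on sequences of bit strings. -/
def seqLT : List (List Bool) → List (List Bool) → Prop :=
  List.Lex bitStringLT

/-- The nodes of the labelled ordered tree generated by a set `L` of sequences:
the root `⟨⟩` and all prefixes of members of `L`. -/
def generatedTree {A : Type} (L : Set (List A)) : Set (List A) :=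
  {v | v = [] ∨ ∃ ℓ ∈ L, v <+: ℓ}

/-- The leaves of a labelled ordered tree given by its set of nodes: the nodes without children. -/
def treeLeaves {A : Type} (N : Set (List A)) : Set (List A) :=
  {v | v ∈ N ∧ ∀ a : A, v ++ [a] ∉ N}

/-- The number of non-empty bit strings in a sequence (equivalently, of its leading bits). -/
def numNonempty (v : List (List Bool)) : ℕ :=
  v.countP fun β => !β.isEmpty

/-- The number of bits used in a sequence of bit strings. -/
def numBits (v : List (List Bool)) : ℕ :=
  (v.map List.length).sum

/-- The number of non-leading bits used in a sequence of bit strings: each non-empty string `β`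
has `|β| - 1` of them, and the empty one has none. -/
def numNonleading (v : List (List Bool)) : ℕ :=
  (v.map fun β => β.length - 1).sum

/-- The sequences `⟨β_{h-1}, …, β_1⟩` that generate the tree `ℬ^k_{t,h}`. The list `ℓ` starts with
`β_{h-1}`, so `β_i` has list index `h - 1 - i`, the sequence `β_{h-1}, …, β_{i+1}` is
`ℓ.take (h - 1 - i)`, and the sequence `β_i, …, β_1` is `ℓ.drop (h - 1 - i)`. -/
structure IsBGenerator (t h k : ℕ) (ℓ : List (List Bool)) : Prop where
  length_eq : ℓ.length = h - 1
  nonempty_eq : numNonempty ℓ = k - 1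
  bits_le : numBits ℓ ≤ (k - 1) + t
  eq_zero : ∀ i, 1 ≤ i → i ≤ h - 1 →
    numNonempty (ℓ.take (h - 1 - i)) < k - 1 →
    numNonleading (ℓ.take (h - 1 - i)) = t →
    ℓ[h - 1 - i]? = some [false]
  leading_zero : ∀ i, 1 ≤ i → i ≤ h - 1 →
    (∀ β ∈ ℓ.drop (h - 1 - i), β ≠ []) →
    ∀ β ∈ ℓ.drop (h - 1 - i), β.head? = some false

/-- The `{0,1}*`-labelled ordered tree `ℬ^k_{t,h}` (for `h ≥ k ≥ 1`), as its set of nodes. -/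
def treeB (t h k : ℕ) : Set (List (List Bool)) :=
  generatedTree {ℓ | IsBGenerator t h k ℓ}

/-- The leaves `ℓ' = ⟨β'_{h-1}, …, β'_1⟩` of the tree `N` of height `h` such that
`⟨β_{h-1}, …, β_p⟩ < ⟨β'_{h-1}, …, β'_p⟩` lexicographically, where
`ℓ = ⟨β_{h-1}, …, β_1⟩` and `1 ≤ p ≤ h`. -/
def leavesAbove (N : Set (List (List Bool))) (h p : ℕ) (ℓ : List (List Bool)) :
    Set (List (List Bool)) :=
  {ℓ' | ℓ' ∈ treeLeaves N ∧ seqLT (ℓ.take (h - p)) (ℓ'.take (h - p))}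

/-- `IsLevelSuccessor N h p ℓ o` says that `o` is the level-`p` successor of the leaf `ℓ` of the
tree `N` of height `h`: the least leaf in `leavesAbove N h p ℓ`, or `none` if there are no such
leaves. -/
def IsLevelSuccessor (N : Set (List (List Bool))) (h p : ℕ) (ℓ : List (List Bool)) :
    Option (List (List Bool)) → Prop
  | none => leavesAbove N h p ℓ = ∅
  | some ℓ' => ℓ' ∈ leavesAbove N h p ℓ ∧ ∀ ℓ'' ∈ leavesAbove N h p ℓ, ℓ'' = ℓ' ∨ seqLT ℓ' ℓ''

/-- The number `n < 2 ^ w` written in binary with exactly `w` digits, least significant first. -/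
def fixedWidthBits (w n : ℕ) : List Bool :=
  (List.range w).map n.testBit

/-- The succinct representation of a sequence `⟨β_{h-1}, …, β_1⟩`: for every bit of
`β_{h-1}, …, β_1`, in this order, the bit itself, followed by the number `i` of the component `β_i`
that it belongs to, in binary, with as many digits as `h` has. -/
def leafCode (h : ℕ) (ℓ : List (List Bool)) : List Bool :=
  ℓ.zipIdx.flatMap fun x =>
    x.1.flatMap fun b => b :: fixedWidthBits (Nat.size h) (h - 1 - x.2)

/-- The input `h # k # t # p # ℓ` of the successor computation, over the alphabet
`{0, 1, #}` with `# = none`: the numbers in binary, the leaf `ℓ` in its succinct representation. -/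
def successorInput (h k t p : ℕ) (ℓ : List (List Bool)) : List (Option Bool) :=
  h.bits.map some ++ none :: (k.bits.map some ++ none :: (t.bits.map some ++ none ::
    (p.bits.map some ++ none :: (leafCode h ℓ).map some)))

/-- The output of the successor computation: the bit `0` if there is no successor, and otherwise the
bit `1` followed by the succinct representation of the successor. -/
def successorOutput (h : ℕ) : Option (List (List Bool)) → List Bool
  | none => [false]
  | some ℓ => true :: leafCode h ℓ

/-- The machine `M`, started on the input word `x`, halts after at most `m` steps with the word `y`
as its output. -/
def OutputsWithin {Γ₀ Γ₁ : Type} (M : Turing.TM2ComputableAux Γ₀ Γ₁) (x : List Γ₀) (y : List Γ₁)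
    (m : ℕ) : Prop :=
  Nonempty (Turing.TM2OutputsInTime M.tm (x.map M.inputAlphabet.symm)
    (some (y.map M.outputAlphabet.symm)) m)

/-- The quantity `(k + t) log h`, where `log h` is read as `1` for `h = 1`. -/
noncomputable def logBound (h k t : ℕ) : ℝ :=
  ((k : ℝ) + (t : ℝ)) * max 1 (Real.logb 2 (h : ℝ))

set_option linter.unusedSimpArgs false

/-! ### A small imperative language over stacks -/

/-! The conditions on a leaf can be checked string by string. If `r` strings among `β_m, …, β_1`
must still be non-empty and `s` non-leading bits are left, then `β_m` must be `ε` when `r = 0`;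
otherwise it has at most `s + 1` bits and begins with `0`, unless `r < m` and `s > 0` (`gen_iff`,
`isBGenerator_iff`). Every allowed choice can be completed, and for `r > 0` the least completion is
`0^{s+1}`, then `r - 1` strings `0`, then only `ε` (`leastSeq_least`). Hence the level-`p` successor
arises by taking the lowest index at least `p` whose string can be increased, replacing that string
by the next allowed one, keeping what lies above, and completing minimally below (`nextSeq_some`,
`nextSeq_none`).

This index can be read off from the non-empty strings. Let `u` be the number of unused non-leading
bits. "Raising" at an index means appending a `1` to the string there and filling up with zeros;
with a free non-leading bit and a non-empty string to place it is always allowed, since it keeps the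
first bit of a non-empty string. If `u > 0` and `β_i` is the lowest non-empty string, the successor
raises at `max i p`. If `u = 0`, the lowest non-empty strings that consist of a single bit cannot be
increased; let `β_i` be the lowest string after them. If `i < p`, raise at `p` with the bits that
become free. Otherwise the next string at `i` is `β_i` without its last `0` and all `1`s after it;
if there is no such `0`, or if deleting it leaves `ε` while there is no room below for one more
non-empty string, then raise at `i + 1`. Raising at `h` means that there is no successor, and
neither is there one if no string `β_i` is found. This is `topGroups_nextSeq_eq_algo`, via
`nextGroups_of_pos` and `nextGroups_zero`.

The machine keeps the non-empty strings on stacks, lowest index on top, with indices of `L =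
Nat.size h` digits and unary counters for the free bits. Each group or bit is handled a bounded
number of times at cost `O(L)`. The potential `gsize G + u + 2 * r` is unchanged when groups are
dropped and is `O(k + t)`, so the total time is `O((k + t) L)`. The programs are structured and
compiled to `Turing.TM2`, one machine step per block. A final clean-up, needed by the halting
convention, is linear because stacks cannot grow faster than time passes (`Exec.length_stk_le`).

Injectivity holds because all code blocks of a bit and its index have the same length and the number
of strings in a leaf is fixed; a leaf has at most `k - 1 + t` bits, each costing `L + 1` symbols. -/

/-- The symbols kept on the working stacks. -/
abbrev StackSym := Option Bool

/-- Elementary operations on a register `σ`, a family of stacks and an output stack. -/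
inductive Op (K σ : Type)
  | push : K → (σ → StackSym) → Op K σ
  | pop : K → (σ → Option StackSym → σ) → Op K σ
  | load : (σ → σ) → Op K σ
  | emit : (σ → Bool) → Op K σ

/-- Structured programs: blocks of elementary operations, composition, branching, loops. -/
inductive Prog (K σ : Type)
  | act : List (Op K σ) → Prog K σ
  | seq : Prog K σ → Prog K σ → Prog K σ
  | ite : (σ → Bool) → Prog K σ → Prog K σ → Prog K σ
  | loop : (σ → Bool) → Prog K σ → Prog K σ

infixr:60 " ;; " => Prog.seq

/-- A state of a program: register, working stacks, output stack. -/
structure PState (K σ : Type) where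
  reg : σ
  stk : K → List StackSym
  out : List Bool

section Semantics

variable {K σ : Type} [DecidableEq K]

/-- The effect of an elementary operation. -/
def Op.exec (c : PState K σ) : Op K σ → PState K σ
  | .push k f => ⟨c.reg, Function.update c.stk k (f c.reg :: c.stk k), c.out⟩
  | .pop k f => ⟨f c.reg (c.stk k).head?, Function.update c.stk k (c.stk k).tail, c.out⟩
  | .load f => ⟨f c.reg, c.stk, c.out⟩
  | .emit f => ⟨c.reg, c.stk, f c.reg :: c.out⟩

/-- Big-step semantics with step counts. -/
inductive Prog.Run : Prog K σ → PState K σ → ℕ → PState K σ → Prop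
  | act (l : List (Op K σ)) (c : PState K σ) : Run (.act l) c 1 (l.foldl Op.exec c)
  | seq {p q : Prog K σ} {c c' c'' : PState K σ} {m n : ℕ} :
      Run p c m c' → Run q c' n c'' → Run (.seq p q) c (m + n) c''
  | iteT {b : σ → Bool} {p q : Prog K σ} {c c' : PState K σ} {m : ℕ} :
      b c.reg = true → Run p c m c' → Run (.ite b p q) c (1 + m) c'
  | iteF {b : σ → Bool} {p q : Prog K σ} {c c' : PState K σ} {m : ℕ} :
      b c.reg = false → Run q c m c' → Run (.ite b p q) c (1 + m) c'
  | loopF {b : σ → Bool} {p : Prog K σ} {c : PState K σ} :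
      b c.reg = false → Run (.loop b p) c 1 c
  | loopT {b : σ → Bool} {p : Prog K σ} {c c' c'' : PState K σ} {m n : ℕ} :
      b c.reg = true → Run p c m c' → Run (.loop b p) c' n c'' →
        Run (.loop b p) c (1 + (m + n)) c''

/-- The program leads from `c` to `c'` in at most `n` steps. -/
def Exec (p : Prog K σ) (c : PState K σ) (n : ℕ) (c' : PState K σ) : Prop :=
  ∃ m, m ≤ n ∧ p.Run c m c'

variable {p q : Prog K σ} {c c' c'' : PState K σ} {m n : ℕ} {b : σ → Bool}

theorem Exec.mono (h : Exec p c m c') (hmn : m ≤ n) : Exec p c n c' :=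
  let ⟨k, hk, hr⟩ := h
  ⟨k, hk.trans hmn, hr⟩

theorem Exec.act {l : List (Op K σ)} (h : l.foldl Op.exec c = c') : Exec (.act l) c 1 c' :=
  ⟨1, le_rfl, h ▸ .act l c⟩

theorem Exec.seq (h₁ : Exec p c m c') (h₂ : Exec q c' n c'') : Exec (p ;; q) c (m + n) c'' :=
  let ⟨_, hk, hr⟩ := h₁
  let ⟨_, hk', hr'⟩ := h₂
  ⟨_, add_le_add hk hk', .seq hr hr'⟩

theorem Exec.act_seq {l : List (Op K σ)} (h : Exec q (l.foldl Op.exec c) n c') :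
    Exec (.act l ;; q) c (1 + n) c' :=
  (Exec.act rfl).seq h

theorem Exec.iteT (hb : b c.reg = true) (h : Exec p c m c') :
    Exec (.ite b p q) c (1 + m) c' :=
  let ⟨_, hk, hr⟩ := h
  ⟨_, add_le_add le_rfl hk, .iteT hb hr⟩

theorem Exec.iteF (hb : b c.reg = false) (h : Exec q c m c') :
    Exec (.ite b p q) c (1 + m) c' :=
  let ⟨_, hk, hr⟩ := h
  ⟨_, add_le_add le_rfl hk, .iteF hb hr⟩

theorem Exec.loopF (hb : b c.reg = false) : Exec (.loop b p) c 1 c :=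
  ⟨1, le_rfl, .loopF hb⟩

theorem Exec.loopT (hb : b c.reg = true) (h₁ : Exec p c m c')
    (h₂ : Exec (.loop b p) c' n c'') : Exec (.loop b p) c (1 + (m + n)) c'' :=
  let ⟨_, hk, hr⟩ := h₁
  let ⟨_, hk', hr'⟩ := h₂
  ⟨_, add_le_add le_rfl (add_le_add hk hk'), .loopT hb hr hr'⟩

end Semantics

/-! ### Compilation of structured programs to `TM2` machines -/

section Compilation

open Turing Turing.TM2

variable {K σ : Type}

/-- The labels of the machine code of a program. -/
@[reducible] def Prog.Lab : Prog K σ → Type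
  | .act _ => Unit
  | .seq p q => p.Lab ⊕ q.Lab
  | .ite _ p q => Option (p.Lab ⊕ q.Lab)
  | .loop _ p => Option p.Lab

/-- The labels of a program form a finite type. -/
instance Prog.fintypeLab : (p : Prog K σ) → Fintype p.Lab
  | .act _ => inferInstanceAs (Fintype Unit)
  | .seq p q =>
    letI := fintypeLab p
    letI := fintypeLab q
    inferInstanceAs (Fintype (p.Lab ⊕ q.Lab))
  | .ite _ p q =>
    letI := fintypeLab p
    letI := fintypeLab q
    inferInstanceAs (Fintype (Option (p.Lab ⊕ q.Lab)))
  | .loop _ p =>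
    letI := fintypeLab p
    inferInstanceAs (Fintype (Option p.Lab))

/-- The label at which a program starts. -/
def Prog.entry : (p : Prog K σ) → p.Lab
  | .act _ => ()
  | .seq p _ => Sum.inl p.entry
  | .ite _ _ _ => none
  | .loop _ _ => none

/-- The alphabets of the machine: `none` is the output stack. -/
@[reducible] def Alph (K : Type) : Option K → Type
  | none => Bool
  | some _ => StackSym

/-- The stacks of the machine. -/
def joinStacks (S : K → List StackSym) (o : List Bool) : (k : Option K) → List (Alph K k)
  | none => o
  | some k => S k

/-- The machine code of an elementary operation. -/
def Op.stmt {Λ : Type} (s : Stmt (Alph K) Λ σ) : Op K σ → Stmt (Alph K) Λ σ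
  | .push k f => .push (some k) f s
  | .pop k f => .pop (some k) f s
  | .load f => .load f s
  | .emit f => .push none f s

/-- The machine code of a program, embedded by `e` into a larger set of labels and continuing at
the label `x`. -/
def Prog.code {Λ : Type} : (p : Prog K σ) → (p.Lab → Λ) → Λ → p.Lab → Stmt (Alph K) Λ σ
  | .act l, _, x, _ => l.foldr (fun o s => o.stmt s) (.goto fun _ => x)
  | .seq p q, e, _, .inl l => p.code (e ∘ Sum.inl) (e (.inr q.entry)) l
  | .seq _ q, e, x, .inr l => q.code (e ∘ Sum.inr) x l
  | .ite b p q, e, _, none => .branch b (.goto fun _ => e (some (.inl p.entry)))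
      (.goto fun _ => e (some (.inr q.entry)))
  | .ite _ p _, e, x, some (.inl l) => p.code (e ∘ some ∘ Sum.inl) x l
  | .ite _ _ q, e, x, some (.inr l) => q.code (e ∘ some ∘ Sum.inr) x l
  | .loop b p, e, x, none => .branch b (.goto fun _ => e (some p.entry)) (.goto fun _ => x)
  | .loop _ p, e, _, some l => p.code (e ∘ some) (e none) l

/-- The code of a program as a machine program: the label `none` halts. -/
def Prog.machine (p : Prog K σ) : Option p.Lab → Stmt (Alph K) (Option p.Lab) σ
  | none => .halt
  | some l => p.code some none l

variable [DecidableEq K]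

theorem update_joinStacks_some (S : K → List StackSym) (o : List Bool) (k : K) (l : List StackSym) :
    Function.update (joinStacks S o) (some k) l = joinStacks (Function.update S k l) o := by
  funext k'
  rcases k' with _ | k'
  · simp [joinStacks]
  · by_cases h : k' = k
    · subst h; simp [joinStacks]
    · simp [joinStacks, h]

theorem update_joinStacks_none (S : K → List StackSym) (o l : List Bool) :
    Function.update (joinStacks S o) none l = joinStacks S l := by
  funext k'
  rcases k' with _ | k' <;> simp [joinStacks]

/-- The machine configuration of a program state. -/
def PState.cfg {Λ : Type} (c : PState K σ) (l : Option Λ) : Cfg (Alph K) Λ σ :=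
  ⟨l, c.reg, joinStacks c.stk c.out⟩

/-- A `TM2` step runs a whole statement up to its `goto`, so a block costs one step however long it
is. -/
theorem stepAux_ops {Λ : Type} (l : List (Op K σ)) (x : Λ) (c : PState K σ) :
    stepAux (l.foldr (fun o s => o.stmt s) (.goto fun _ => x)) c.reg (joinStacks c.stk c.out) =
      (l.foldl Op.exec c).cfg (some x) := by
  induction l generalizing c with
  | nil => rfl
  | cons o l ih =>
    rw [List.foldl_cons, ← ih]
    cases o <;> simp only [List.foldr_cons, Op.stmt, stepAux, Op.exec,
      update_joinStacks_some, update_joinStacks_none] <;> rfl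

/-- `n` steps of a machine. -/
def stepsTo {Λ : Type} (M : Λ → Stmt (Alph K) Λ σ) (n : ℕ) (a b : Cfg (Alph K) Λ σ) : Prop :=
  (flip bind (step M))^[n] (some a) = some b

theorem stepsTo.trans {Λ : Type} {M : Λ → Stmt (Alph K) Λ σ} {m n : ℕ}
    {a b c : Cfg (Alph K) Λ σ} (h₁ : stepsTo M m a b) (h₂ : stepsTo M n b c) :
    stepsTo M (m + n) a c := by
  unfold stepsTo at *
  rw [add_comm, Function.iterate_add_apply, h₁, h₂]

theorem stepsTo_one {Λ : Type} {M : Λ → Stmt (Alph K) Λ σ} {l : Λ} {c : PState K σ}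
    {b : Cfg (Alph K) Λ σ} (h : stepAux (M l) c.reg (joinStacks c.stk c.out) = b) :
    stepsTo M 1 (c.cfg (some l)) b := by
  subst h; rfl

/-- Induction on the run. The label embedding `e` and the exit label `x` are arbitrary, since a
subprogram sits inside a larger machine and continues wherever its context says; the body of a loop
continues at the label of the loop. -/
theorem Prog.Run.stepsTo {p : Prog K σ} {c c' : PState K σ} {n : ℕ} (h : p.Run c n c')
    {Λ : Type} (M : Λ → Stmt (Alph K) Λ σ) (e : p.Lab → Λ) (x : Λ)
    (hM : ∀ l, M (e l) = p.code e x l) :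
    _root_.stepsTo M n (c.cfg (some (e p.entry))) (c'.cfg (some x)) := by
  induction h generalizing x with
  | act l c => exact stepsTo_one (by rw [hM]; exact stepAux_ops l x c)
  | @seq p q c c' c'' m n _ _ ih₁ ih₂ =>
    exact (ih₁ (e ∘ Sum.inl) (e (.inr q.entry)) fun l => hM (.inl l)).trans
      (ih₂ (e ∘ Sum.inr) x fun l => hM (.inr l))
  | @iteT b p q c c' m hb _ ih =>
    refine stepsTo.trans ?_ (ih (e ∘ some ∘ Sum.inl) x fun l => hM (some (.inl l)))
    exact stepsTo_one ((congrArg (fun s => stepAux s _ _) (hM (Prog.entry _))).trans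
      (by simp [Prog.entry, Prog.code, hb, PState.cfg]))
  | @iteF b p q c c' m hb _ ih =>
    refine stepsTo.trans ?_ (ih (e ∘ some ∘ Sum.inr) x fun l => hM (some (.inr l)))
    exact stepsTo_one ((congrArg (fun s => stepAux s _ _) (hM (Prog.entry _))).trans
      (by simp [Prog.entry, Prog.code, hb, PState.cfg]))
  | @loopF b p c hb =>
    exact stepsTo_one ((congrArg (fun s => stepAux s _ _) (hM (Prog.entry _))).trans
      (by simp [Prog.entry, Prog.code, hb, PState.cfg]))
  | @loopT b p c c' c'' m n hb _ _ ih₁ ih₂ =>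
    refine stepsTo.trans ?_ ((ih₁ (e ∘ some) (e none) fun l => hM (some l)).trans
      (ih₂ e x hM))
    exact stepsTo_one ((congrArg (fun s => stepAux s _ _) (hM (Prog.entry _))).trans
      (by simp [Prog.entry, Prog.code, hb, PState.cfg]))

/-- The machine that runs the program `p`, with input stack `k₀`. -/
def Prog.toTM2 [Fintype K] [Fintype σ] (p : Prog K σ) (k₀ : K) (v : σ) :
    TM2ComputableAux (Option Bool) Bool where
  tm :=
    { K := Option K
      k₀ := some k₀
      k₁ := none
      Γ := Alph K
      Λ := Option p.Lab
      main := some p.entry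
      σ := σ
      initialState := v
      Γk₀Fin := inferInstanceAs (Fintype (Option Bool))
      m := p.machine }
  inputAlphabet := Equiv.refl (Option Bool)
  outputAlphabet := Equiv.refl Bool

/-- The halting configuration `haltList` has all stacks but the output empty and the register in its
initial state, which is why the program must end with `v` and empty stacks. The extra step executes
`halt`. -/
theorem Exec.outputsWithin [Fintype K] [Fintype σ] {p : Prog K σ} {k₀ : K} {v : σ} {n : ℕ}
    {x : List (Option Bool)} {y : List Bool}
    (h : Exec p ⟨v, Function.update (fun _ => []) k₀ x, []⟩ n ⟨v, fun _ => [], y⟩) :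
    OutputsWithin (p.toTM2 k₀ v) x y (n + 1) := by
  obtain ⟨m, hm, hr⟩ := h
  have h₁ := hr.stepsTo p.machine some none fun l => rfl
  have h₂ := h₁.trans (stepsTo_one (l := none) (b := ⟨none, v, joinStacks (fun _ => []) y⟩)
    (c := ⟨v, fun _ => [], y⟩) rfl)
  have hi : initList (p.toTM2 k₀ v).tm (x.map (p.toTM2 k₀ v).inputAlphabet.symm) =
      PState.cfg ⟨v, Function.update (fun _ => []) k₀ x, []⟩ (some (some p.entry)) := by
    simp only [initList, PState.cfg, Prog.toTM2]
    congr 1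
    funext k
    rcases k with _ | k
    · rfl
    · by_cases hk : k = k₀
      · subst hk
        simp [joinStacks]
        exact List.map_id x
      · simp [joinStacks, hk]
  have hf : haltList (p.toTM2 k₀ v).tm (y.map (p.toTM2 k₀ v).outputAlphabet.symm) =
      ⟨none, v, joinStacks (fun _ => []) y⟩ := by
    simp only [haltList, Prog.toTM2]
    congr 1
    funext k
    rcases k with _ | k
    · simp [joinStacks]
      exact List.map_id y
    · simp [joinStacks]
  refine ⟨⟨⟨m + 1, ?_⟩, by simpa using hm⟩⟩
  rw [Option.map_some, hi, hf]
  exact h₂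

end Compilation

/-! ### Fixed-width binary numbers -/

theorem fixedWidthBits_zero (n : ℕ) : fixedWidthBits 0 n = [] := rfl

theorem fixedWidthBits_succ (w n : ℕ) :
    fixedWidthBits (w + 1) n = n.testBit 0 :: fixedWidthBits w (n / 2) := by
  simp only [fixedWidthBits, List.range_succ_eq_map, List.map_cons, List.map_map]
  congr 1
  apply List.map_congr_left
  intro i _
  simp [Nat.testBit_succ]

theorem length_fixedWidthBits (w n : ℕ) : (fixedWidthBits w n).length = w := by
  simp [fixedWidthBits]

theorem fixedWidthBits_zero_right (w : ℕ) : fixedWidthBits w 0 = List.replicate w false := by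
  induction w with
  | zero => rfl
  | succ w ih => simp [fixedWidthBits_succ, ih, List.replicate_succ]

/-- Identifies the input format of `h` with the format of the indices, so that `h` and the indices
can be compared digit by digit. -/
theorem fixedWidthBits_size (n : ℕ) : fixedWidthBits (Nat.size n) n = n.bits := by
  induction n using Nat.binaryRec' with
  | zero => rfl
  | bit b n h ih =>
    rw [Nat.bits_append_bit _ _ h, Nat.size_bit, fixedWidthBits_succ, Nat.bit_div_two, ih]
    · simp
    · intro h0
      rw [Nat.bit_eq_zero_iff] at h0
      simp [h h0.1] at h0

theorem fixedWidthBits_add (w d n : ℕ) (h : n < 2 ^ w) :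
    fixedWidthBits (w + d) n = fixedWidthBits w n ++ List.replicate d false := by
  induction w generalizing n with
  | zero =>
    obtain rfl : n = 0 := by simpa using h
    simp [fixedWidthBits_zero_right]
  | succ w ih =>
    rw [show w + 1 + d = (w + d) + 1 by omega, fixedWidthBits_succ, fixedWidthBits_succ, ih]
    · rfl
    · rw [pow_succ] at h; omega

/-! ### Comparison, increment and decrement of binary numbers -/

/-- Equality and order of binary numbers, least significant digit first, where `e` and `l` tell
whether the digits read so far are equal or smaller; missing digits of the second number are read
as zeros. -/
def cmpBits : Bool → Bool → List Bool → List Bool → Bool × Bool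
  | e, l, [], _ => (e, l)
  | e, l, a :: A, B =>
    cmpBits (e && a == B.headD false) (if a == B.headD false then l else !a) A B.tail

/-- Pad or cut `B` to length `n`. -/
def padBits : ℕ → List Bool → List Bool
  | 0, _ => []
  | n + 1, B => B.headD false :: padBits n B.tail

theorem padBits_eq (n d : ℕ) (B : List Bool) (h : B.length + d = n) :
    padBits n B = B ++ List.replicate d false := by
  induction n generalizing B d with
  | zero => simp at h; simp [padBits, h]
  | succ n ih =>
    cases B with
    | nil =>
      obtain rfl : d = n + 1 := by simpa using h
      simp [padBits, ih n [] (by simp), List.replicate_succ]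
    | cons b B => simp [padBits, ih d B (by simp at h; omega)]

theorem padBits_self (B : List Bool) : padBits B.length B = B := by
  simpa using padBits_eq B.length 0 B rfl

theorem padBits_fixedWidthBits (w n : ℕ) : padBits w (fixedWidthBits w n) = fixedWidthBits w n := by
  have h := padBits_self (fixedWidthBits w n)
  rwa [length_fixedWidthBits] at h

/-- The least significant digit comes first, so a later unequal digit overrides the verdict so far;
the incoming `l` survives only if all digits agree. -/
theorem cmpBits_fixedWidthBits (e l : Bool) (w m n : ℕ) (hm : m < 2 ^ w) (hn : n < 2 ^ w) :
    cmpBits e l (fixedWidthBits w m) (fixedWidthBits w n) =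
      (e && decide (m = n), if m = n then l else decide (m < n)) := by
  induction w generalizing e l m n with
  | zero =>
    obtain rfl : m = 0 := by simpa using hm
    obtain rfl : n = 0 := by simpa using hn
    simp [fixedWidthBits_zero, cmpBits]
  | succ w ih =>
    rw [pow_succ] at hm hn
    rw [fixedWidthBits_succ, fixedWidthBits_succ, cmpBits, List.tail_cons,
      ih _ _ _ _ (by omega) (by omega)]
    simp only [List.headD_cons, Nat.testBit_zero]
    rcases Nat.mod_two_eq_zero_or_one m with h1 | h1 <;>
      rcases Nat.mod_two_eq_zero_or_one n with h2 | h2 <;>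
      by_cases h3 : m / 2 = n / 2 <;> by_cases h4 : m = n <;> simp [h1, h2, h3, h4] <;> omega

/-- Increment (`m = false`) or decrement (`m = true`) of a binary number if `c` holds. -/
def stepBits (m : Bool) : Bool → List Bool → List Bool
  | _, [] => []
  | c, a :: A => (a ^^ c) :: stepBits m ((a ^^ m) && c) A

theorem length_stepBits (m c : Bool) (A : List Bool) : (stepBits m c A).length = A.length := by
  induction A generalizing c with
  | nil => rfl
  | cons a A ih => simp [stepBits, ih]

theorem stepBits_false (m : Bool) (A : List Bool) : stepBits m false A = A := by
  induction A with
  | nil => rfl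
  | cons a A ih => simp [stepBits, ih]

/-- The carry passes exactly through the digits `1` and stops at the first `0`. No bound on `n` is
needed, as both sides drop the overflow. -/
theorem stepBits_inc (w n : ℕ) :
    stepBits false true (fixedWidthBits w n) = fixedWidthBits w (n + 1) := by
  induction w generalizing n with
  | zero => rfl
  | succ w ih =>
    rw [fixedWidthBits_succ, fixedWidthBits_succ, stepBits]
    rcases Nat.mod_two_eq_zero_or_one n with h | h
    · have h1 : (n + 1) / 2 = n / 2 := by omega
      simp [Nat.testBit_zero, h, h1, stepBits_false, Nat.add_mod]
    · have h1 : (n + 1) / 2 = n / 2 + 1 := by omega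
      simp [Nat.testBit_zero, h, h1, ih, Nat.add_mod]

theorem stepBits_dec (w n : ℕ) :
    stepBits true true (fixedWidthBits w (n + 1)) = fixedWidthBits w n := by
  induction w generalizing n with
  | zero => rfl
  | succ w ih =>
    rw [fixedWidthBits_succ, fixedWidthBits_succ, stepBits]
    rcases Nat.mod_two_eq_zero_or_one n with h | h
    · have h1 : (n + 1) / 2 = n / 2 := by omega
      simp [Nat.testBit_zero, h, h1, stepBits_false, Nat.add_mod]
    · have h1 : (n + 1) / 2 = n / 2 + 1 := by omega
      simp [Nat.testBit_zero, h, h1, ih, Nat.add_mod]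

/-- The value of a binary number, least significant digit first. -/
def bitsVal : List Bool → ℕ
  | [] => 0
  | b :: B => b.toNat + 2 * bitsVal B

theorem bitsVal_bits (n : ℕ) : bitsVal n.bits = n := by
  induction n using Nat.binaryRec' with
  | zero => rfl
  | bit b n h ih =>
    rw [Nat.bits_append_bit _ _ h, bitsVal, ih, Nat.bit_val]
    omega

/-! ### The program -/

/-- The working stacks. -/
inductive Stk
  | i | h | p | x | y | z | w | u | r | b | t
  deriving DecidableEq

instance : Fintype Stk :=
  ⟨{.i, .h, .p, .x, .y, .z, .w, .u, .r, .b, .t}, fun k => by cases k <;> decide⟩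

/-- The register. -/
structure Reg where
  a : Option StackSym
  b : Option StackSym
  c : Bool
  eq : Bool
  lt : Bool
  deriving DecidableEq, Fintype

/-- The stacks, listed in the order of their names in `Stk`. -/
def st (i h p x y z w u r b t : List StackSym) : Stk → List StackSym
  | .i => i
  | .h => h
  | .p => p
  | .x => x
  | .y => y
  | .z => z
  | .w => w
  | .u => u
  | .r => r
  | .b => b
  | .t => t

section StackLemmas

variable (i h p x y z w u r b t l : List StackSym)

theorem st_apply :
    st i h p x y z w u r b t .i = i ∧
    st i h p x y z w u r b t .h = h ∧
    st i h p x y z w u r b t .p = p ∧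
    st i h p x y z w u r b t .x = x ∧
    st i h p x y z w u r b t .y = y ∧
    st i h p x y z w u r b t .z = z ∧
    st i h p x y z w u r b t .w = w ∧
    st i h p x y z w u r b t .u = u ∧
    st i h p x y z w u r b t .r = r ∧
    st i h p x y z w u r b t .b = b ∧
    st i h p x y z w u r b t .t = t := by
  simp [st]

theorem update_st :
    Function.update (st i h p x y z w u r b t) .i l = st l h p x y z w u r b t ∧
    Function.update (st i h p x y z w u r b t) .h l = st i l p x y z w u r b t ∧
    Function.update (st i h p x y z w u r b t) .p l = st i h l x y z w u r b t ∧
    Function.update (st i h p x y z w u r b t) .x l = st i h p l y z w u r b t ∧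
    Function.update (st i h p x y z w u r b t) .y l = st i h p x l z w u r b t ∧
    Function.update (st i h p x y z w u r b t) .z l = st i h p x y l w u r b t ∧
    Function.update (st i h p x y z w u r b t) .w l = st i h p x y z l u r b t ∧
    Function.update (st i h p x y z w u r b t) .u l = st i h p x y z w l r b t ∧
    Function.update (st i h p x y z w u r b t) .r l = st i h p x y z w u l b t ∧
    Function.update (st i h p x y z w u r b t) .b l = st i h p x y z w u r l t ∧
    Function.update (st i h p x y z w u r b t) .t l = st i h p x y z w u r b l := by
  refine ⟨?_, ?_, ?_, ?_, ?_, ?_, ?_, ?_, ?_, ?_, ?_⟩ <;> funext k <;> cases k <;> rfl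

end StackLemmas

/-- Whether the popped symbol is a digit. -/
def isDigit : Option StackSym → Bool
  | some (some _) => true
  | _ => false

/-- The popped digit. -/
def digit : Option StackSym → Bool
  | some (some d) => d
  | _ => false

@[simp] theorem isDigit_digit (d : Bool) : isDigit (some (some d)) = true := rfl
@[simp] theorem isDigit_sep : isDigit (some none) = false := rfl
@[simp] theorem isDigit_none : isDigit none = false := rfl
@[simp] theorem digit_digit (d : Bool) : digit (some (some d)) = d := rfl
@[simp] theorem digit_none : digit none = false := rfl

/-- Pop into the register `a`. -/
abbrev popA (k : Stk) : Op Stk Reg := .pop k fun v o => { v with a := o }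

/-- Pop into the register `b`. -/
abbrev popB (k : Stk) : Op Stk Reg := .pop k fun v o => { v with b := o }

/-- Push the register `a`. -/
abbrev pushA (k : Stk) : Op Stk Reg := .push k fun v => v.a.getD none

/-- Push the register `b`. -/
abbrev pushB (k : Stk) : Op Stk Reg := .push k fun v => v.b.getD none

/-- Push a fixed symbol. -/
abbrev pushS (k : Stk) (s : StackSym) : Op Stk Reg := .push k fun _ => s

/-- Do nothing. -/
abbrev skipP : Prog Stk Reg := .act []

/-- Repeat while the last popped symbol is a digit. -/
abbrev forDigits (p : Prog Stk Reg) : Prog Stk Reg := .loop (fun v => isDigit v.a) p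

/-- Branch on whether the last pop succeeded. -/
abbrev ifSome (p q : Prog Stk Reg) : Prog Stk Reg := .ite (fun v => v.a.isSome) p q

/-- Move the digits from the top of `s` to `d`, and drop the separator below them. -/
def mv (s d : Stk) : Prog Stk Reg := .act [popA s] ;; forDigits (.act [pushA d, popA s])

/-- Move the digits from the top of `s` to both `d` and `d'`, and drop the separator below them. -/
def mv2 (s d d' : Stk) : Prog Stk Reg :=
  .act [popA s] ;; forDigits (.act [pushA d, pushA d', popA s])

/-- Drop the digits from the top of `s` and the separator below them. -/
def dropP (s : Stk) : Prog Stk Reg := .act [popA s] ;; forDigits (.act [popA s])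

/-- Compare the numbers on `x` and `p`. -/
def cmpP : Prog Stk Reg :=
  .act [.load fun v => { v with eq := true, lt := false }, popA .x, popB .p] ;;
  forDigits (.act [.load fun v => { v with
      eq := v.eq && digit v.a == digit v.b
      lt := if digit v.a == digit v.b then v.lt else !digit v.a },
    pushA .y, .push .z (fun v => some (digit v.b)), popA .x, popB .p]) ;;
  mv .y .x ;; mv .z .p

/-- Increment (`m = false`) or decrement (`m = true`) the number on `x`. -/
def stepP (m : Bool) : Prog Stk Reg :=
  .act [.load fun v => { v with c := true }, popA .x] ;;
  forDigits (.act [.push .y (fun v => some (digit v.a ^^ v.c)),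
    .load fun v => { v with c := (digit v.a ^^ m) && v.c }, popA .x]) ;;
  mv .y .x ;; .act [.load fun v => { v with c := false }]

/-- Copy `h` to the empty stack `x`. -/
def copyH : Prog Stk Reg := mv .h .y ;; mv2 .y .h .x

/-- Copy the top number of `t` to the empty stack `x`. -/
def copyTop : Prog Stk Reg := mv .t .y ;; .act [pushS .t none] ;; mv2 .y .t .x

/-- Move the number on `x` to `p`. -/
def setP : Prog Stk Reg := dropP .p ;; mv .x .y ;; mv .y .p

/-- Push the number on `x` as the index of a new group. -/
def pushIndex : Prog Stk Reg := .act [pushS .t none] ;; mv .x .y ;; mv2 .y .x .t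

/-- Open a new group `0` below the index on `x`. -/
def newGroup : Prog Stk Reg := stepP true ;; .act [pushS .b none, pushS .b (some false)] ;; pushIndex

/-- Pad the top group with as many zeros as `u` has symbols. -/
def padZeros : Prog Stk Reg := .act [popA .u] ;; forDigits (.act [pushS .b (some false), popA .u])

/-- Add as many groups `0` as `r` has symbols. -/
def singlesP : Prog Stk Reg := .act [popA .r] ;; forDigits (newGroup ;; .act [popA .r])

/-- Write the number on `x`, most significant digit on top, to the output. -/
def emitIndex : Prog Stk Reg :=
  .act [popA .x] ;; forDigits (.act [.emit fun v => digit v.a, pushA .y, popA .x]) ;; mv .y .x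

/-- Write all groups to the output. -/
def outputP : Prog Stk Reg :=
  dropP .x ;; .act [popA .t] ;;
  forDigits (.act [pushA .t] ;; mv .t .x ;; .act [popA .b] ;;
    forDigits (.act [.load fun v => { v with c := digit v.a }] ;; emitIndex ;;
      .act [.emit fun v => v.c, popA .b]) ;;
    dropP .x ;; .act [popA .t]) ;;
  .act [.emit fun _ => true]

/-- Drop the top group. -/
def dropGroup : Prog Stk Reg :=
  dropP .t ;; .act [pushS .r (some true), popA .b, popA .b] ;;
  forDigits (.act [pushS .u (some true), popA .b])

/-- Drop the groups below the index on `p`. -/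
def dropLowP : Prog Stk Reg :=
  .act [.load fun v => { v with c := true }] ;;
  .loop (fun v => v.c) (dropP .x ;; .act [popA .t] ;;
    ifSome
      (.act [pushA .t] ;; copyTop ;; cmpP ;;
        .ite (fun v => v.lt) (dropGroup ;; .act [.load fun v => { v with c := true }])
          (.act [.load fun v => { v with c := false }]))
      (.act [.load fun v => { v with c := false, eq := false }]))

/-- Raise the string at the index on `p`, and output the result. -/
def raiseP : Prog Stk Reg :=
  dropLowP ;;
  .ite (fun v => v.eq) (.act [pushS .b (some true), popA .u])
    (.act [pushS .b none, pushS .b (some true), popA .r, pushS .t none] ;;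
      mv .p .y ;; mv2 .y .p .t) ;;
  dropP .x ;; mv .p .y ;; mv .y .x ;; padZeros ;; singlesP ;; outputP

/-- Raise the string at the index on `p`, if that is not `h`. -/
def checkedP : Prog Stk Reg :=
  dropP .x ;; copyH ;; cmpP ;; .ite (fun v => v.eq) (.act [.emit fun _ => false]) raiseP

/-- Raise the string at the index that follows the one on `x`. -/
def nextUp : Prog Stk Reg := stepP false ;; setP ;; checkedP

/-- Continue minimally below the index on `x`, and output the result. -/
def lowerP : Prog Stk Reg :=
  .act [popA .r] ;; ifSome (newGroup ;; padZeros ;; singlesP) skipP ;; outputP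

/-- Test whether the number of symbols on `r` is the top index. -/
def testP : Prog Stk Reg :=
  dropP .p ;; .act [popA .r] ;; forDigits (.act [pushA .w] ;; stepP true ;; .act [popA .r]) ;;
  mv .w .r ;; cmpP ;; dropP .x ;; copyTop

/-- The case in which all bits from the top group on are in use. -/
def stripP : Prog Stk Reg :=
  .act [popA .b] ;;
  .loop (fun v => v.a == some (some true)) (.act [pushS .u (some true), popA .b]) ;;
  .ite (fun v => v.a == some none)
    (.act [popA .u, pushS .r (some true)] ;; dropP .t ;; nextUp)
    (.act [pushS .u (some true), popA .b] ;;
      .ite (fun v => v.a == some none)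
        (.act [popA .u, pushS .r (some true)] ;; testP ;;
          .ite (fun v => v.eq) (dropP .t ;; nextUp) (dropP .t ;; lowerP))
        (.act [pushA .b] ;; lowerP))

/-- Compute the successor from a nonempty sequence of groups. -/
def succP : Prog Stk Reg :=
  copyTop ;; cmpP ;; .ite (fun v => v.lt) checkedP
    (.act [popA .u] ;; ifSome (.act [pushA .u] ;; setP ;; checkedP) stripP)

/-- Drop the trailing groups that consist of a single bit. -/
def dropSinglesP : Prog Stk Reg :=
  .act [popA .b, popB .b] ;;
  .loop (fun v => v.a.isSome && v.b == some none)
    (.act [pushS .r (some true)] ;; dropP .t ;; .act [popA .b, popB .b]) ;;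
  .ite (fun v => v.b.isSome) (.act [pushB .b]) skipP

/-- Compute the successor from a sequence of groups. -/
def bodyP : Prog Stk Reg :=
  .act [popA .u] ;; ifSome (.act [pushA .u, popA .b]) dropSinglesP ;;
  ifSome (.act [pushA .b] ;; succP) (.act [.emit fun _ => false])

/-- Add the binary number on the input to the unary number on `u`. -/
def countP : Prog Stk Reg :=
  .act [pushS .w (some true), popA .i] ;;
  forDigits (.act [.load fun v => { v with c := digit v.a }] ;; mv .w .z ;; .act [popA .z] ;;
    forDigits (.act [pushA .w, pushA .w] ;; .ite (fun v => v.c) (.act [pushA .u]) skipP ;;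
      .act [popA .z]) ;;
    .act [popA .i]) ;;
  dropP .w

/-- Read the leaf, and remove a symbol from `u` for every bit of it. -/
def parseP : Prog Stk Reg :=
  .act [popA .i] ;;
  forDigits (.act [.load fun v => { v with c := digit v.a, eq := true }, popA .u, popA .h] ;;
    forDigits (.act [popB .i, .pop .x (fun v o => { v with eq := v.eq && o == v.b }), pushB .y,
      pushA .z, popA .h]) ;;
    mv .z .h ;;
    .ite (fun v => v.eq) (mv .y .x)
      (.act [pushS .b none, pushS .t none] ;; mv2 .y .x .t) ;;
    .act [.push .b (fun v => some v.c), popA .i]) ;;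
  dropP .x

/-- Read the input. -/
def readP : Prog Stk Reg :=
  mv .i .y ;; mv .y .h ;; countP ;; .act [popA .u] ;; countP ;; mv .i .y ;; mv .y .p ;;
  copyH ;; cmpP ;; dropP .x ;; parseP

/-- The state of the register at the beginning and the end. -/
def Reg.init : Reg := ⟨none, none, false, false, false⟩

/-- Remove everything from a stack. -/
def clearP (k : Stk) : Prog Stk Reg := .act [popA k] ;; .loop (fun v => v.a.isSome) (.act [popA k])

/-- Remove everything from all stacks. -/
def cleanupP : Prog Stk Reg :=
  clearP .i ;; clearP .h ;; clearP .p ;; clearP .x ;; clearP .y ;; clearP .z ;; clearP .w ;; clearP .u ;;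
  clearP .r ;; clearP .b ;; clearP .t ;; .act [.load fun _ => Reg.init]

/-- The program that computes level-`p` successors. -/
def successorP : Prog Stk Reg := readP ;; bodyP ;; cleanupP

/-! ### Specifications of the elementary routines -/

/-- Digits as stack symbols. -/
def dg (D : List Bool) : List StackSym := D.map some

@[simp] theorem dg_nil : dg [] = [] := rfl
@[simp] theorem dg_cons (d : Bool) (D : List Bool) : dg (d :: D) = some d :: dg D := rfl
@[simp] theorem dg_append (D D' : List Bool) : dg (D ++ D') = dg D ++ dg D' := List.map_append

/-- The rewrite rules for symbolic execution of blocks. Together with `update_st` and `st_apply`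
they bring every state back to the form `st …`. -/
theorem exec_simps :
    (∀ c : PState Stk Reg, List.foldl Op.exec c [] = c) ∧
    (∀ (c : PState Stk Reg) (o : Op Stk Reg) (l : List (Op Stk Reg)),
      List.foldl Op.exec c (o :: l) = List.foldl Op.exec (Op.exec c o) l) ∧
    (∀ (v : Reg) (S : Stk → List StackSym) (o : List Bool) (k : Stk) (f : Reg → StackSym),
      Op.exec ⟨v, S, o⟩ (.push k f) = ⟨v, Function.update S k (f v :: S k), o⟩) ∧
    (∀ (v : Reg) (S : Stk → List StackSym) (o : List Bool) (k : Stk)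
      (f : Reg → Option StackSym → Reg), Op.exec ⟨v, S, o⟩ (.pop k f) =
        ⟨f v (S k).head?, Function.update S k (S k).tail, o⟩) ∧
    (∀ (v : Reg) (S : Stk → List StackSym) (o : List Bool) (f : Reg → Reg),
      Op.exec ⟨v, S, o⟩ (.load f) = ⟨f v, S, o⟩) ∧
    (∀ (v : Reg) (S : Stk → List StackSym) (o : List Bool) (f : Reg → Bool),
      Op.exec ⟨v, S, o⟩ (.emit f) = ⟨v, S, f v :: o⟩) ∧
    (∀ (s : StackSym) (l : List StackSym), (s :: l).head? = some s) ∧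
    (∀ (s : StackSym) (l : List StackSym), (s :: l).tail = l) ∧
    (∀ (s : StackSym) (l l' : List StackSym), s :: l ++ l' = s :: (l ++ l')) ∧
    (([] : List StackSym).head? = none) ∧
    (([] : List StackSym).tail = []) ∧
    (∀ l : List StackSym, [] ++ l = l) ∧
    (∀ l : List StackSym, l ++ [] = l) ∧
    (∀ l : List Bool, l.reverse.reverse = l) ∧
    (∀ s s' : StackSym, (some s).getD s' = s) ∧
    (∀ d : Bool, digit (some (some d)) = d) ∧
    (dg [] = []) ∧
    (∀ (d : Bool) (D : List Bool), dg (d :: D) = some d :: dg D) := by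
  simp [Op.exec]

theorem Exec.to {P : Prog Stk Reg} {c c' d : PState Stk Reg} {m n : ℕ} (h : Exec P c m c')
    (hd : c' = d) (hmn : m ≤ n) : Exec P c n d :=
  hd ▸ h.mono hmn

/-- The loop looks one symbol ahead: its invariant is that the register `a` holds the head of what
remains to be moved while the stack `s` holds the tail. The loop lemmas for the other routines use
the same scheme. Moving reverses the digits. -/
theorem mv_exec {s d : Stk} (hsd : s ≠ d) (v : Reg) (S : Stk → List StackSym) (o : List Bool)
    (D : List Bool) (rest : List StackSym) (hS : S s = dg D ++ rest)
    (hr : isDigit rest.head? = false) :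
    Exec (mv s d) ⟨v, S, o⟩ (2 * D.length + 2) ⟨{ v with a := rest.head? },
      Function.update (Function.update S s rest.tail) d (dg D.reverse ++ S d), o⟩ := by
  have key : ∀ (D : List Bool) (v : Reg) (S : Stk → List StackSym),
      v.a = (dg D ++ rest).head? → S s = (dg D ++ rest).tail →
      Exec (forDigits (.act [pushA d, popA s])) ⟨v, S, o⟩ (2 * D.length + 1)
        ⟨{ v with a := rest.head? },
          Function.update (Function.update S s rest.tail) d (dg D.reverse ++ S d), o⟩ := by
    intro D
    induction D with
    | nil =>
      intro v S hv hS
      refine (Exec.loopF (by simpa [hv] using hr)).to ?_ (by simp)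
      rcases v with ⟨a, b, c, e, l⟩
      obtain rfl : a = rest.head? := hv
      simp only [PState.mk.injEq, true_and, and_true]
      simp at hS
      simp [← hS]
    | cons x D ih =>
      intro v S hv hS
      refine (Exec.loopT (by simp [hv]) (Exec.act rfl) (ih _ _ ?_ ?_)).to ?_ ?_
      · simp [Op.exec, hsd, hS]
      · simp [Op.exec, hsd, hS]
      · simp only [List.foldl_cons, List.foldl_nil, Op.exec, PState.mk.injEq, true_and, and_true]
        funext k
        by_cases h1 : k = d
        · subst h1; simp [hv, hsd, hsd.symm]
        · by_cases h2 : k = s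
          · subst h2; simp [h1]
          · simp [h1, h2]
      · simp only [List.length_cons]; omega
  refine ((Exec.act rfl).seq (key D _ _ ?_ ?_)).to ?_ ?_
  · simp [Op.exec, hS]
  · simp [Op.exec, hS]
  · simp [Op.exec, hsd.symm]
  · omega

theorem mv2_exec {s d d' : Stk} (hsd : s ≠ d) (hsd' : s ≠ d') (hdd : d ≠ d') (v : Reg)
    (S : Stk → List StackSym) (o : List Bool)
    (D : List Bool) (rest : List StackSym) (hS : S s = dg D ++ rest)
    (hr : isDigit rest.head? = false) :
    Exec (mv2 s d d') ⟨v, S, o⟩ (2 * D.length + 2) ⟨{ v with a := rest.head? },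
      Function.update (Function.update (Function.update S s rest.tail) d (dg D.reverse ++ S d)) d'
        (dg D.reverse ++ S d'), o⟩ := by
  have key : ∀ (D : List Bool) (v : Reg) (S : Stk → List StackSym),
      v.a = (dg D ++ rest).head? → S s = (dg D ++ rest).tail →
      Exec (forDigits (.act [pushA d, pushA d', popA s])) ⟨v, S, o⟩ (2 * D.length + 1)
        ⟨{ v with a := rest.head? },
          Function.update (Function.update (Function.update S s rest.tail) d
            (dg D.reverse ++ S d)) d' (dg D.reverse ++ S d'), o⟩ := by
    intro D
    induction D with
    | nil =>
      intro v S hv hS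
      refine (Exec.loopF (by simpa [hv] using hr)).to ?_ (by simp)
      rcases v with ⟨a, b, c, e, l⟩
      obtain rfl : a = rest.head? := hv
      simp only [PState.mk.injEq, true_and, and_true]
      simp at hS
      simp [← hS]
    | cons x D ih =>
      intro v S hv hS
      refine (Exec.loopT (by simp [hv]) (Exec.act rfl) (ih _ _ ?_ ?_)).to ?_ ?_
      · simp [Op.exec, hsd, hsd', hS]
      · simp [Op.exec, hsd, hsd', hS]
      · simp only [List.foldl_cons, List.foldl_nil, Op.exec, PState.mk.injEq, true_and, and_true]
        funext k
        by_cases h1 : k = d'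
        · subst h1; simp [hv, hsd', hsd'.symm, hdd, hdd.symm]
        · by_cases h2 : k = d
          · subst h2; simp [hv, hsd, hsd.symm, hdd]
          · by_cases h3 : k = s
            · subst h3; simp [h1, h2]
            · simp [h1, h2, h3]
      · simp only [List.length_cons]; omega
  refine ((Exec.act rfl).seq (key D _ _ ?_ ?_)).to ?_ ?_
  · simp [Op.exec, hS]
  · simp [Op.exec, hS]
  · simp [Op.exec, hsd.symm, hsd'.symm]
  · omega

theorem dropP_exec (s : Stk) (v : Reg) (S : Stk → List StackSym) (o : List Bool)
    (D : List Bool) (rest : List StackSym) (hS : S s = dg D ++ rest)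
    (hr : isDigit rest.head? = false) :
    Exec (dropP s) ⟨v, S, o⟩ (2 * D.length + 2) ⟨{ v with a := rest.head? },
      Function.update S s rest.tail, o⟩ := by
  have key : ∀ (D : List Bool) (v : Reg) (S : Stk → List StackSym),
      v.a = (dg D ++ rest).head? → S s = (dg D ++ rest).tail →
      Exec (forDigits (.act [popA s])) ⟨v, S, o⟩ (2 * D.length + 1)
        ⟨{ v with a := rest.head? }, Function.update S s rest.tail, o⟩ := by
    intro D
    induction D with
    | nil =>
      intro v S hv hS
      refine (Exec.loopF (by simpa [hv] using hr)).to ?_ (by simp)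
      rcases v with ⟨a, b, c, e, l⟩
      obtain rfl : a = rest.head? := hv
      simp at hS
      simp [← hS]
    | cons x D ih =>
      intro v S hv hS
      refine (Exec.loopT (by simp [hv]) (Exec.act rfl) (ih _ _ ?_ ?_)).to ?_ ?_
      · simp [Op.exec, hS]
      · simp [Op.exec, hS]
      · simp [Op.exec]
      · simp only [List.length_cons]; omega
  refine ((Exec.act rfl).seq (key D _ _ ?_ ?_)).to ?_ ?_
  · simp [Op.exec, hS]
  · simp [Op.exec, hS]
  · simp [Op.exec]
  · omega

theorem clearP_exec (k : Stk) (v : Reg) (S : Stk → List StackSym) (o : List Bool) :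
    Exec (clearP k) ⟨v, S, o⟩ (2 * (S k).length + 2) ⟨{ v with a := none },
      Function.update S k [], o⟩ := by
  have key : ∀ (D : List StackSym) (v : Reg) (S : Stk → List StackSym),
      v.a = D.head? → S k = D.tail →
      Exec (.loop (fun v => v.a.isSome) (.act [popA k])) ⟨v, S, o⟩ (2 * D.length + 1)
        ⟨{ v with a := none }, Function.update S k [], o⟩ := by
    intro D
    induction D with
    | nil =>
      intro v S hv hS
      refine (Exec.loopF (by simp [hv])).to ?_ (by simp)
      rcases v with ⟨a, b, c, e, l⟩
      obtain rfl : a = none := hv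
      simp at hS
      simp [← hS]
    | cons x D ih =>
      intro v S hv hS
      refine (Exec.loopT (by simp [hv]) (Exec.act rfl) (ih _ _ ?_ ?_)).to ?_ ?_
      · simp [Op.exec, hS]
      · simp [Op.exec, hS]
      · simp [Op.exec]
      · simp only [List.length_cons]; omega
  refine ((Exec.act rfl).seq (key (S k) _ _ ?_ ?_)).to ?_ ?_
  · simp [Op.exec]
  · simp [Op.exec]
  · simp [Op.exec]
  · omega

/-- Eleven stacks are cleared in at most `2 * n + 2` steps each, and one more step resets the
register. -/
theorem cleanupP_exec (v : Reg) (S : Stk → List StackSym) (o : List Bool) (n : ℕ)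
    (hn : ∀ k, (S k).length ≤ n) :
    Exec cleanupP ⟨v, S, o⟩ (22 * n + 23) ⟨Reg.init, fun _ => [], o⟩ := by
  have h1 : ∀ (k : Stk) (v : Reg) (S : Stk → List StackSym), (∀ k, (S k).length ≤ n) →
      Exec (clearP k) ⟨v, S, o⟩ (2 * n + 2)
        ⟨{ v with a := none }, Function.update S k [], o⟩ := fun k v S hS =>
    (clearP_exec k v S o).mono (by have := hS k; omega)
  have h2 : ∀ (k : Stk) (S : Stk → List StackSym), (∀ k, (S k).length ≤ n) →
      ∀ k', (Function.update S k [] k').length ≤ n := by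
    intro k S hS k'
    by_cases h : k' = k
    · subst h; simp
    · simp [h, hS]
  unfold cleanupP
  refine Exec.to (.seq (h1 _ _ _ ?_) <| .seq (h1 _ _ _ ?_) <| .seq (h1 _ _ _ ?_) <|
    .seq (h1 _ _ _ ?_) <| .seq (h1 _ _ _ ?_) <| .seq (h1 _ _ _ ?_) <| .seq (h1 _ _ _ ?_) <|
    .seq (h1 _ _ _ ?_) <| .seq (h1 _ _ _ ?_) <| .seq (h1 _ _ _ ?_) <| .seq (h1 _ _ _ ?_) <|
    .act rfl) ?_ ?_
  on_goal 12 =>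
    simp only [List.foldl_cons, List.foldl_nil, Op.exec, PState.mk.injEq, true_and, and_true]
    funext k
    cases k <;> simp [Function.update]
  on_goal 12 => omega
  all_goals repeat first | exact hn | apply h2

theorem Exec.cast {P : Prog Stk Reg} {c c' d d' : PState Stk Reg} {m n : ℕ} (h : Exec P c m d)
    (hc : c' = c) (hd : d = d') (hmn : m ≤ n) : Exec P c' n d' :=
  hc ▸ hd ▸ h.mono hmn

theorem length_padBits (n : ℕ) (B : List Bool) : (padBits n B).length = n := by
  induction n generalizing B with
  | zero => rfl
  | succ n ih => simp [padBits, ih]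

section Routines

variable (i h p x y z w u r b t : List StackSym) (o : List Bool) (va vb : Option StackSym)
  (vc ve vl : Bool)

theorem cmpP_loop (A B : List Bool) (hB : B.length ≤ A.length) (y z : List StackSym)
    (ve vl : Bool) :
    Exec (forDigits (.act [.load fun v => { v with
          eq := v.eq && digit v.a == digit v.b
          lt := if digit v.a == digit v.b then v.lt else !digit v.a },
        pushA .y, .push .z (fun v => some (digit v.b)), popA .x, popB .p]))
      ⟨⟨(dg A).head?, (dg B).head?, vc, ve, vl⟩,
        st i h (dg B).tail (dg A).tail y z w u r b t, o⟩
      (2 * A.length + 1)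
      ⟨⟨none, none, vc, (cmpBits ve vl A B).1, (cmpBits ve vl A B).2⟩,
        st i h [] [] (dg A.reverse ++ y) (dg (padBits A.length B).reverse ++ z) w u r b t, o⟩ := by
  induction A generalizing B y z ve vl with
  | nil =>
    obtain rfl : B = [] := by simpa using hB
    exact Exec.loopF rfl
  | cons d A ih =>
    apply Exec.mono
    · apply Exec.loopT rfl (Exec.act rfl)
      apply Exec.cast
      · exact ih B.tail (by simp at hB ⊢; omega) (some d :: y) (some (B.headD false) :: z)
          (ve && d == B.headD false) (if d == B.headD false then vl else !d)
      · cases B <;> simp only [exec_simps, update_st, st_apply, dg_cons] <;> rfl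
      · simp [cmpBits, padBits]
      · exact le_rfl
    · simp only [List.length_cons]; omega

/-- Missing digits of the number on `p` are read as zeros and written back as such; `readP` uses
this side effect to bring the input `p` to full width. -/
theorem cmpP_exec (A B : List Bool) (hB : B.length ≤ A.length) :
    Exec cmpP ⟨⟨va, vb, vc, ve, vl⟩, st i h (dg B) (dg A) [] [] w u r b t, o⟩
      (6 * A.length + 6)
      ⟨⟨none, none, vc, (cmpBits true false A B).1, (cmpBits true false A B).2⟩,
        st i h (dg (padBits A.length B)) (dg A) [] [] w u r b t, o⟩ := by
  unfold cmpP
  apply Exec.mono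
  · apply Exec.act_seq
    simp only [exec_simps, update_st, st_apply]
    apply Exec.seq
    · exact cmpP_loop i h w u r b t o vc A B hB [] [] true false
    apply Exec.seq
    · exact mv_exec (by decide) _ _ _ A.reverse [] (by simp [st_apply]) rfl
    simp only [exec_simps, update_st, st_apply]
    apply Exec.to
    · exact mv_exec (by decide) _ _ _ (padBits A.length B).reverse [] (by simp [st_apply]) rfl
    · simp only [exec_simps, update_st, st_apply]
    · exact le_rfl
  · simp [length_padBits]; omega

theorem stepP_loop (m : Bool) (A : List Bool) (y : List StackSym) (vc : Bool) :
    ∃ c, Exec (forDigits (.act [.push .y (fun v => some (digit v.a ^^ v.c)),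
        .load fun v => { v with c := (digit v.a ^^ m) && v.c }, popA .x]))
      ⟨⟨(dg A).head?, vb, vc, ve, vl⟩, st i h p (dg A).tail y z w u r b t, o⟩
      (2 * A.length + 1)
      ⟨⟨none, vb, c, ve, vl⟩,
        st i h p [] (dg (stepBits m vc A).reverse ++ y) z w u r b t, o⟩ := by
  induction A generalizing y vc with
  | nil => exact ⟨vc, Exec.loopF rfl⟩
  | cons d A ih =>
    obtain ⟨c, hc⟩ := ih (some (d ^^ vc) :: y) ((d ^^ m) && vc)
    refine ⟨c, ?_⟩
    apply Exec.mono
    · apply Exec.loopT rfl (Exec.act rfl)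
      apply Exec.cast hc
      · simp only [exec_simps, update_st, st_apply]
      · simp [stepBits]
      · exact le_rfl
    · simp only [List.length_cons]; omega

theorem stepP_exec (m : Bool) (A : List Bool) :
    Exec (stepP m) ⟨⟨va, vb, vc, ve, vl⟩, st i h p (dg A) [] z w u r b t, o⟩
      (4 * A.length + 5)
      ⟨⟨none, vb, false, ve, vl⟩, st i h p (dg (stepBits m true A)) [] z w u r b t, o⟩ := by
  obtain ⟨c, hc⟩ := stepP_loop i h p z w u r b t o vb ve vl m A [] true
  unfold stepP
  apply Exec.mono
  · apply Exec.act_seq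
    simp only [exec_simps, update_st, st_apply]
    apply Exec.seq hc
    apply Exec.seq
    · exact mv_exec (by decide) _ _ _ (stepBits m true A).reverse [] (by simp [st_apply]) rfl
    simp only [exec_simps, update_st, st_apply]
    exact Exec.act rfl
  · simp [length_stepBits]; omega

theorem copyH_exec (v : Reg) (D : List Bool) :
    Exec copyH ⟨v, st i (dg D) p [] [] z w u r b t, o⟩ (4 * D.length + 4)
      ⟨{ v with a := none }, st i (dg D) p (dg D) [] z w u r b t, o⟩ := by
  unfold copyH
  apply Exec.mono
  · apply Exec.seq
    · exact mv_exec (by decide) _ _ _ D [] (by simp [st_apply]) rfl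
    simp only [exec_simps, update_st, st_apply]
    apply Exec.to
    · exact mv2_exec (by decide) (by decide) (by decide) _ _ _ D.reverse []
        (by simp [st_apply]) rfl
    · simp only [exec_simps, update_st, st_apply]
    · exact le_rfl
  · simp; omega

theorem copyTop_exec (v : Reg) (D : List Bool) :
    Exec copyTop ⟨v, st i h p [] [] z w u r b (dg D ++ none :: t), o⟩ (4 * D.length + 5)
      ⟨{ v with a := none }, st i h p (dg D) [] z w u r b (dg D ++ none :: t), o⟩ := by
  unfold copyTop
  apply Exec.mono
  · apply Exec.seq
    · exact mv_exec (by decide) _ _ _ D (none :: t) (by simp [st_apply]) rfl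
    simp only [exec_simps, update_st, st_apply]
    apply Exec.act_seq
    simp only [exec_simps, update_st, st_apply]
    apply Exec.to
    · exact mv2_exec (by decide) (by decide) (by decide) _ _ _ D.reverse []
        (by simp [st_apply]) rfl
    · simp only [exec_simps, update_st, st_apply]
    · exact le_rfl
  · simp; omega

theorem setP_exec (v : Reg) (P D : List Bool) :
    Exec setP ⟨v, st i h (dg P) (dg D) [] z w u r b t, o⟩ (2 * P.length + 4 * D.length + 6)
      ⟨{ v with a := none }, st i h (dg D) [] [] z w u r b t, o⟩ := by
  unfold setP
  apply Exec.mono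
  · apply Exec.seq
    · exact dropP_exec _ _ _ _ P [] (by simp [st_apply]) rfl
    simp only [exec_simps, update_st, st_apply]
    apply Exec.seq
    · exact mv_exec (by decide) _ _ _ D [] (by simp [st_apply]) rfl
    simp only [exec_simps, update_st, st_apply]
    apply Exec.to
    · exact mv_exec (by decide) _ _ _ D.reverse [] (by simp [st_apply]) rfl
    · simp only [exec_simps, update_st, st_apply]
    · exact le_rfl
  · simp; omega

theorem pushIndex_exec (v : Reg) (D : List Bool) :
    Exec pushIndex ⟨v, st i h p (dg D) [] z w u r b t, o⟩ (4 * D.length + 5)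
      ⟨{ v with a := none }, st i h p (dg D) [] z w u r b (dg D ++ none :: t), o⟩ := by
  unfold pushIndex
  apply Exec.mono
  · apply Exec.act_seq
    simp only [exec_simps, update_st, st_apply]
    apply Exec.seq
    · exact mv_exec (by decide) _ _ _ D [] (by simp [st_apply]) rfl
    simp only [exec_simps, update_st, st_apply]
    apply Exec.to
    · exact mv2_exec (by decide) (by decide) (by decide) _ _ _ D.reverse []
        (by simp [st_apply]) rfl
    · simp only [exec_simps, update_st, st_apply]
    · exact le_rfl
  · simp; omega

theorem newGroup_exec (v : Reg) (D : List Bool) :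
    Exec newGroup ⟨v, st i h p (dg D) [] z w u r b t, o⟩ (8 * D.length + 11)
      ⟨{ v with a := none, c := false }, st i h p (dg (stepBits true true D)) [] z w u r
        (some false :: none :: b) (dg (stepBits true true D) ++ none :: t), o⟩ := by
  unfold newGroup
  apply Exec.mono
  · apply Exec.seq
    · exact stepP_exec (A := D) ..
    apply Exec.act_seq
    simp only [exec_simps, update_st, st_apply]
    exact pushIndex_exec ..
  · simp [length_stepBits]; omega

theorem emitIndex_exec (v : Reg) (D : List Bool) :
    Exec emitIndex ⟨v, st i h p (dg D) [] z w u r b t, o⟩ (4 * D.length + 4)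
      ⟨{ v with a := none }, st i h p (dg D) [] z w u r b t, D.reverse ++ o⟩ := by
  have key : ∀ (D : List Bool) (v : Reg) (y : List StackSym) (o : List Bool), v.a = (dg D).head? →
      Exec (forDigits (.act [.emit fun v => digit v.a, pushA .y, popA .x]))
        ⟨v, st i h p (dg D).tail y z w u r b t, o⟩ (2 * D.length + 1)
        ⟨{ v with a := none }, st i h p [] (dg D.reverse ++ y) z w u r b t, D.reverse ++ o⟩ := by
    intro D
    induction D with
    | nil =>
      rintro ⟨a, b, c, e, l⟩ y o rfl
      exact Exec.loopF rfl
    | cons d D ih =>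
      rintro ⟨a, b, c, e, l⟩ y o rfl
      apply Exec.mono
      · apply Exec.loopT rfl (Exec.act rfl)
        simp only [exec_simps, update_st, st_apply]
        apply Exec.to
        · exact ih _ _ _ rfl
        · simp
        · exact le_rfl
      · simp only [List.length_cons]; omega
  unfold emitIndex
  apply Exec.mono
  · apply Exec.act_seq
    simp only [exec_simps, update_st, st_apply]
    apply Exec.seq
    · exact key D _ _ _ rfl
    apply Exec.to
    · exact mv_exec (by decide) _ _ _ D.reverse [] (by simp [st_apply]) rfl
    · simp only [exec_simps, update_st, st_apply]
    · exact le_rfl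
  · simp; omega

/-- A number in unary. -/
def un (n : ℕ) : List StackSym := dg (List.replicate n true)

theorem un_zero : un 0 = [] := rfl

theorem un_succ (n : ℕ) : un (n + 1) = some true :: un n := rfl

theorem un_tail (n : ℕ) : (un n).tail = un (n - 1) := by
  cases n <;> rfl

theorem padZeros_exec (v : Reg) (n : ℕ) :
    Exec padZeros ⟨v, st i h p x y z w (un n) r b t, o⟩ (2 * n + 2)
      ⟨{ v with a := none }, st i h p x y z w [] r (dg (List.replicate n false) ++ b) t, o⟩ := by
  have key : ∀ (n : ℕ) (v : Reg) (b : List StackSym), v.a = (un n).head? →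
      Exec (forDigits (.act [pushS .b (some false), popA .u]))
        ⟨v, st i h p x y z w (un n).tail r b t, o⟩ (2 * n + 1)
        ⟨{ v with a := none }, st i h p x y z w [] r (dg (List.replicate n false) ++ b) t, o⟩ := by
    intro n
    induction n with
    | zero =>
      rintro ⟨a, b, c, e, l⟩ b rfl
      exact Exec.loopF rfl
    | succ n ih =>
      rintro ⟨a, b, c, e, l⟩ b rfl
      apply Exec.mono
      · apply Exec.loopT rfl (Exec.act rfl)
        simp only [exec_simps, update_st, st_apply, un_succ]
        apply Exec.to
        · exact ih _ _ rfl
        · rw [List.replicate_succ']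
          simp
        · exact le_rfl
      · omega
  unfold padZeros
  apply Exec.mono
  · apply Exec.act_seq
    simp only [exec_simps, update_st, st_apply]
    exact key n _ _ rfl
  · omega

end Routines

/-! ### Sequences of groups

A sequence of bit strings is kept as the list of its non-empty members, each with its index and its
bits in reverse order; the member with the least index comes first. -/

/-- The index of a non-empty string, and its bits in reverse order. -/
abbrev Grp := ℕ × List Bool

/-- The strings of the groups on the stack `b`. -/
def repB : List Grp → List StackSym
  | [] => []
  | (_, δ) :: G => dg δ ++ none :: repB G

/-- The indices of the groups on the stack `t`. -/
def repT (L : ℕ) : List Grp → List StackSym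
  | [] => []
  | (i, _) :: G => dg (fixedWidthBits L i) ++ none :: repT L G

/-- The stacks for the groups `G`, with `u` free non-leading bits and `r` free leading bits. -/
def stG (L : ℕ) (H P X : List Bool) (u r : ℕ) (G : List Grp) : Stk → List StackSym :=
  st [] (dg H) (dg P) (dg X) [] [] [] (un u) (un r) (repB G) (repT L G)

/-- The number of bits and strings of the groups. -/
def gsize : List Grp → ℕ
  | [] => 0
  | (_, δ) :: G => δ.length + 1 + gsize G

/-- The groups have increasing indices above `r` and below `N`, and non-empty strings. -/
def GroupsWF (N : ℕ) : ℕ → List Grp → Prop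
  | _, [] => True
  | r, (i, δ) :: G => r < i ∧ i < N ∧ δ ≠ [] ∧ GroupsWF N i G

theorem GroupsWF.mono {N r r' : ℕ} {G : List Grp} (h : GroupsWF N r G) (hr : r' ≤ r) :
    GroupsWF N r' G := by
  cases G with
  | nil => trivial
  | cons g G => exact ⟨hr.trans_lt h.1, h.2⟩

/-- Add `r` groups `0` below the index `i`. -/
def singles : ℕ → ℕ → List Grp → List Grp
  | 0, _, G => G
  | r + 1, i, G => singles r (i - 1) ((i - 1, [false]) :: G)

theorem gsize_singles (r i : ℕ) (G : List Grp) : gsize (singles r i G) = gsize G + 2 * r := by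
  induction r generalizing i G with
  | zero => rfl
  | succ r ih => rw [singles, ih]; simp [gsize]; omega

/-- Drop the groups with indices below `p`, and collect the bits that become free. -/
def dropLow (p : ℕ) : List Grp → ℕ → ℕ → List Grp × ℕ × ℕ
  | [], u, r => ([], u, r)
  | (i, δ) :: G, u, r =>
    if i < p then dropLow p G (u + (δ.length - 1)) (r + 1) else ((i, δ) :: G, u, r)

/-- Append a bit `1` to the string with index `p`, and continue minimally. -/
def insertOne (p : ℕ) : List Grp → ℕ → ℕ → List Grp
  | [], u, r => singles (r - 1) p [(p, List.replicate u false ++ [true])]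
  | (i, δ) :: G, u, r =>
    if i = p then singles r p ((p, List.replicate (u - 1) false ++ true :: δ) :: G)
    else singles (r - 1) p ((p, List.replicate u false ++ [true]) :: (i, δ) :: G)

/-- Append a bit `1` to the string with index `p` of the given groups, and continue minimally. -/
def raiseAt (p : ℕ) (G : List Grp) (u r : ℕ) : List Grp :=
  insertOne p (dropLow p G u r).1 (dropLow p G u r).2.1 (dropLow p G u r).2.2

/-- The output for the groups, in front of `o`. -/
def outBits (L i : ℕ) : List Bool → List Bool → List Bool
  | [], o => o
  | b :: δ, o => outBits L i δ (b :: (fixedWidthBits L i ++ o))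

/-- The output for the groups, in front of `o`. -/
def outG (L : ℕ) : List Grp → List Bool → List Bool
  | [], o => o
  | (i, δ) :: G, o => outG L G (outBits L i δ o)

/-- The program ends with the given stacks and output. -/
def Ends (P : Prog Stk Reg) (c : PState Stk Reg) (n : ℕ) (S : Stk → List StackSym)
    (o : List Bool) : Prop :=
  ∃ v, Exec P c n ⟨v, S, o⟩

theorem Exec.ends {P : Prog Stk Reg} {c : PState Stk Reg} {n : ℕ} {v : Reg}
    {S : Stk → List StackSym} {o : List Bool} (h : Exec P c n ⟨v, S, o⟩) : Ends P c n S o :=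
  ⟨v, h⟩

theorem Ends.mono {P : Prog Stk Reg} {c : PState Stk Reg} {m n : ℕ}
    {S : Stk → List StackSym} {o : List Bool} (h : Ends P c m S o) (hmn : m ≤ n) :
    Ends P c n S o :=
  let ⟨v, hv⟩ := h
  ⟨v, hv.mono hmn⟩

theorem Ends.then {p q : Prog Stk Reg} {c : PState Stk Reg} {m n : ℕ}
    {S S' : Stk → List StackSym} {o o' : List Bool} (h₁ : Ends p c m S o)
    (h₂ : ∀ v, Ends q ⟨v, S, o⟩ n S' o') : Ends (p ;; q) c (m + n) S' o' :=
  let ⟨v, hv⟩ := h₁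
  let ⟨v', hv'⟩ := h₂ v
  ⟨v', hv.seq hv'⟩

/-! ### Machine routines on groups -/

section GroupRoutines

variable (L : ℕ) (H P X : List Bool) (u r : ℕ) (G : List Grp) (o : List Bool)

theorem singlesP_exec (i : ℕ) (hr : r ≤ i) (v : Reg) :
    Ends singlesP ⟨v, stG L H P (fixedWidthBits L i) u r G, o⟩ (r * (8 * L + 13) + 2)
      (stG L H P (fixedWidthBits L (i - r)) u 0 (singles r i G)) o := by
  have key : ∀ (r i : ℕ) (G : List Grp) (v : Reg), r ≤ i → v.a = (un r).head? →
      Ends (forDigits (newGroup ;; .act [popA .r]))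
        ⟨v, st [] (dg H) (dg P) (dg (fixedWidthBits L i)) [] [] [] (un u) (un r).tail (repB G)
          (repT L G), o⟩ (r * (8 * L + 13) + 1)
        (stG L H P (fixedWidthBits L (i - r)) u 0 (singles r i G)) o := by
    intro r
    induction r with
    | zero =>
      rintro i G ⟨a, b, c, e, l⟩ - rfl
      exact ⟨_, Exec.to (Exec.loopF rfl) rfl (by omega)⟩
    | succ r ih =>
      rintro i G ⟨a, b, c, e, l⟩ hr rfl
      obtain ⟨i, rfl⟩ : ∃ j, i = j + 1 := ⟨i - 1, by omega⟩
      obtain ⟨v', hv'⟩ := ih i ((i, [false]) :: G) ⟨(un r).head?, b, false, e, l⟩ (by omega) rfl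
      refine ⟨v', ?_⟩
      apply Exec.mono
      · apply Exec.loopT rfl
        · apply Exec.seq
          · exact newGroup_exec (D := fixedWidthBits L (i + 1)) ..
          exact Exec.act rfl
        simp only [exec_simps, update_st, st_apply, un_succ, stepBits_dec]
        simpa [singles, repB, repT] using hv'
      · simp [length_fixedWidthBits]; ring_nf; omega
  unfold singlesP stG
  obtain ⟨a, b, c, e, l⟩ := v
  obtain ⟨v', hv'⟩ := key r i G ⟨(un r).head?, b, c, e, l⟩ hr rfl
  refine ⟨v', ?_⟩
  apply Exec.mono
  · apply Exec.act_seq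
    simp only [exec_simps, update_st, st_apply]
    exact hv'
  · omega

theorem emitGroup_exec (i : ℕ) (δ : List Bool) (v : Reg) (b t : List StackSym)
    (hv : v.a = (dg δ ++ none :: b).head?) :
    Ends (forDigits (.act [.load fun v => { v with c := digit v.a }] ;; emitIndex ;;
      .act [.emit fun v => v.c, popA .b]))
      ⟨v, st [] (dg H) (dg P) (dg (fixedWidthBits L i).reverse) [] [] [] (un u) (un r)
        (dg δ ++ none :: b).tail t, o⟩
      (δ.length * (4 * L + 7) + 1)
      (st [] (dg H) (dg P) (dg (fixedWidthBits L i).reverse) [] [] [] (un u) (un r) b t)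
      (outBits L i δ o) := by
  induction δ generalizing v o with
  | nil =>
    exact ⟨v, Exec.to (Exec.loopF (by simp [hv])) rfl (by simp)⟩
  | cons d δ ih =>
    obtain ⟨a, vb, c, e, l⟩ := v
    obtain rfl : a = some (some d) := hv
    obtain ⟨v', hv'⟩ := ih (d :: (fixedWidthBits L i ++ o))
      ⟨(dg δ ++ none :: b).head?, vb, d, e, l⟩ rfl
    refine ⟨v', ?_⟩
    apply Exec.mono
    · apply Exec.loopT rfl
      · apply Exec.act_seq
        simp only [exec_simps, update_st, st_apply]
        apply Exec.seq
        · exact emitIndex_exec (D := (fixedWidthBits L i).reverse) ..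
        exact Exec.act rfl
      simp only [exec_simps, update_st, st_apply]
      exact hv'
    · simp [length_fixedWidthBits]; ring_nf; omega

theorem head_repT {L : ℕ} (hL : 0 < L) (i : ℕ) (δ : List Bool) (G : List Grp) :
    ∃ d s, repT L ((i, δ) :: G) = some d :: s := by
  obtain ⟨L, rfl⟩ : ∃ l, L = l + 1 := ⟨L - 1, by omega⟩
  exact ⟨_, _, by rw [repT, fixedWidthBits_succ]; rfl⟩

/-- The output word is read from the top of its stack, so it has to be written from its end. The
groups lie on the stacks in just this order: lowest index first, last bit first. For each bit the
index is emitted from its most significant digit on, and then the bit itself on top. -/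
theorem outputP_exec (hL : 0 < L) (hX : X.length ≤ L) (v : Reg) :
    Ends outputP ⟨v, stG L H P X u r G, o⟩ (gsize G * (4 * L + 11) + 2 * L + 5)
      (stG L H P [] u r []) (true :: outG L G o) := by
  have key : ∀ (G : List Grp) (o : List Bool) (v : Reg), v.a = (repT L G).head? →
      Ends (forDigits (.act [pushA .t] ;; mv .t .x ;; .act [popA .b] ;;
          forDigits (.act [.load fun v => { v with c := digit v.a }] ;; emitIndex ;;
            .act [.emit fun v => v.c, popA .b]) ;;
          dropP .x ;; .act [popA .t]))
        ⟨v, st [] (dg H) (dg P) [] [] [] [] (un u) (un r) (repB G)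
          (repT L G).tail, o⟩ (gsize G * (4 * L + 11) + 1)
        (stG L H P [] u r []) (outG L G o) := by
    intro G
    induction G with
    | nil =>
      rintro o ⟨a, b, c, e, l⟩ rfl
      exact ⟨_, Exec.to (Exec.loopF rfl) rfl (by simp [gsize])⟩
    | cons g G ih =>
      obtain ⟨i, δ⟩ := g
      rintro o ⟨a, vb, c, e, l⟩ rfl
      obtain ⟨d, s, hs⟩ := head_repT hL i δ G
      obtain ⟨v', hv'⟩ := emitGroup_exec L H P u r o i δ
        ⟨(dg δ ++ none :: repB G).head?, vb, c, e, l⟩ (repB G) (repT L G) rfl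
      obtain ⟨v'', hv''⟩ := ih (outBits L i δ o) { v' with a := (repT L G).head? } rfl
      refine ⟨v'', ?_⟩
      apply Exec.mono
      · apply Exec.loopT (by simp [hs])
        · apply Exec.act_seq
          simp only [exec_simps, update_st, st_apply, hs]
          apply Exec.seq
          · exact mv_exec (by decide) _ _ _ (fixedWidthBits L i) (none :: repT L G)
              (by simp [st_apply, ← hs, repT]) rfl
          simp only [exec_simps, update_st, st_apply]
          apply Exec.act_seq
          simp only [exec_simps, update_st, st_apply, repB]
          apply Exec.seq
          · exact hv'
          apply Exec.seq
          · exact dropP_exec _ _ _ _ (fixedWidthBits L i).reverse [] (by simp [st_apply]) rfl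
          simp only [exec_simps, update_st, st_apply]
          exact Exec.act rfl
        simp only [exec_simps, update_st, st_apply]
        exact hv''
      · simp [length_fixedWidthBits, gsize]; ring_nf; omega
  unfold outputP stG
  obtain ⟨a, b, c, e, l⟩ := v
  obtain ⟨v', hv'⟩ := key G o ⟨(repT L G).head?, b, c, e, l⟩ rfl
  refine ⟨v', ?_⟩
  apply Exec.mono
  · apply Exec.seq
    · exact dropP_exec _ _ _ _ X [] (by simp [st_apply]) rfl
    simp only [exec_simps, update_st, st_apply]
    apply Exec.act_seq
    simp only [exec_simps, update_st, st_apply]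
    apply Exec.seq hv'
    exact Exec.act rfl
  · omega

/-- The first symbol popped from the group is not counted on `u`: one bit of each group is accounted
for as the leading bit, on `r`. Hence `hδ` and the length minus one. -/
theorem dropGroup_exec (i : ℕ) (δ : List Bool) (hδ : δ ≠ []) (v : Reg) :
    Ends dropGroup ⟨v, stG L H P X u r ((i, δ) :: G), o⟩ (2 * L + 2 * δ.length + 4)
      (stG L H P X (u + (δ.length - 1)) (r + 1) G) o := by
  have key : ∀ (δ : List Bool) (v : Reg) (u : ℕ), v.a = (dg δ ++ none :: repB G).head? →
      Ends (forDigits (.act [pushS .u (some true), popA .b]))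
        ⟨v, st [] (dg H) (dg P) (dg X) [] [] [] (un u) (un (r + 1)) (dg δ ++ none :: repB G).tail
          (repT L G), o⟩ (2 * δ.length + 1)
        (stG L H P X (u + δ.length) (r + 1) G) o := by
    intro δ
    induction δ with
    | nil =>
      rintro ⟨a, b, c, e, l⟩ u rfl
      exact ⟨_, Exec.loopF rfl⟩
    | cons d δ ih =>
      rintro ⟨a, b, c, e, l⟩ u rfl
      obtain ⟨v', hv'⟩ := ih ⟨(dg δ ++ none :: repB G).head?, b, c, e, l⟩ (u + 1) rfl
      refine ⟨v', ?_⟩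
      apply Exec.mono
      · apply Exec.loopT rfl (Exec.act rfl)
        simp only [exec_simps, update_st, st_apply]
        rw [List.length_cons, show u + (δ.length + 1) = u + 1 + δ.length by omega]
        exact hv'
      · simp only [List.length_cons]; omega
  obtain ⟨d, δ, rfl⟩ := List.exists_cons_of_ne_nil hδ
  obtain ⟨a, b, c, e, l⟩ := v
  obtain ⟨v', hv'⟩ := key δ ⟨(dg δ ++ none :: repB G).head?, b, c, e, l⟩ u rfl
  refine ⟨v', ?_⟩
  unfold dropGroup stG
  apply Exec.mono
  · apply Exec.seq
    · exact dropP_exec _ _ _ _ (fixedWidthBits L i) (none :: repT L G)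
        (by simp [st_apply, repT]) rfl
    simp only [exec_simps, update_st, st_apply]
    apply Exec.act_seq
    simp only [exec_simps, update_st, st_apply, repB]
    exact hv'
  · simp [length_fixedWidthBits]; omega

end GroupRoutines

theorem cmpP_num (i h z w u r b t : List StackSym) (o : List Bool) (v : Reg) {L m p : ℕ}
    (hm : m < 2 ^ L) (hp : p < 2 ^ L) (hz : z = []) :
    Exec cmpP ⟨v, st i h (dg (fixedWidthBits L p)) (dg (fixedWidthBits L m)) [] z w u r b t, o⟩
      (6 * L + 6)
      ⟨⟨none, none, v.c, decide (m = p), decide (m < p)⟩,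
        st i h (dg (fixedWidthBits L p)) (dg (fixedWidthBits L m)) [] z w u r b t, o⟩ := by
  subst hz
  apply Exec.to
  · exact cmpP_exec (A := fixedWidthBits L m) (B := fixedWidthBits L p)
      (hB := by simp [length_fixedWidthBits]) ..
  · rw [cmpBits_fixedWidthBits _ _ _ _ _ hm hp, length_fixedWidthBits, padBits_fixedWidthBits]
    by_cases h1 : m = p <;> simp [h1]
  · simp [length_fixedWidthBits]

/-- The program ends with the given output. -/
def Outs (P : Prog Stk Reg) (c : PState Stk Reg) (n : ℕ) (o : List Bool) : Prop :=
  ∃ S, Ends P c n S o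

theorem Ends.outs {P : Prog Stk Reg} {c : PState Stk Reg} {n : ℕ} {S : Stk → List StackSym}
    {o : List Bool} (h : Ends P c n S o) : Outs P c n o :=
  ⟨S, h⟩

theorem Outs.mono {P : Prog Stk Reg} {c : PState Stk Reg} {m n : ℕ} {o : List Bool}
    (h : Outs P c m o) (hmn : m ≤ n) : Outs P c n o :=
  let ⟨S, hS⟩ := h
  ⟨S, hS.mono hmn⟩

theorem Ends.andThen {p q : Prog Stk Reg} {c : PState Stk Reg} {m n : ℕ}
    {S : Stk → List StackSym} {o o' : List Bool} (h₁ : Ends p c m S o)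
    (h₂ : ∀ v, Outs q ⟨v, S, o⟩ n o') : Outs (p ;; q) c (m + n) o' :=
  let ⟨v, hv⟩ := h₁
  let ⟨S', v', hv'⟩ := h₂ v
  ⟨S', v', hv.seq hv'⟩

theorem Exec.andThen {p q : Prog Stk Reg} {c c' : PState Stk Reg} {m n : ℕ} {o : List Bool}
    (h₁ : Exec p c m c') (h₂ : Outs q c' n o) : Outs (p ;; q) c (m + n) o :=
  let ⟨S', v', hv'⟩ := h₂
  ⟨S', v', h₁.seq hv'⟩

theorem Outs.act_seq {q : Prog Stk Reg} {c : PState Stk Reg} {n : ℕ} {o : List Bool}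
    {l : List (Op Stk Reg)} (h : Outs q (l.foldl Op.exec c) n o) :
    Outs (.act l ;; q) c (1 + n) o :=
  (Exec.act rfl).andThen h

theorem Outs.iteT {p q : Prog Stk Reg} {c : PState Stk Reg} {n : ℕ} {o : List Bool}
    {b : Reg → Bool} (hb : b c.reg = true) (h : Outs p c n o) : Outs (.ite b p q) c (1 + n) o :=
  let ⟨S', v', hv'⟩ := h
  ⟨S', v', hv'.iteT hb⟩

theorem Outs.iteF {p q : Prog Stk Reg} {c : PState Stk Reg} {n : ℕ} {o : List Bool}
    {b : Reg → Bool} (hb : b c.reg = false) (h : Outs q c n o) : Outs (.ite b p q) c (1 + n) o :=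
  let ⟨S', v', hv'⟩ := h
  ⟨S', v', hv'.iteF hb⟩

/-! ### Raising the string at a given index -/

/-- Whether the top index is `p`. -/
def topIs (p : ℕ) : List Grp → Bool
  | [] => false
  | (i, _) :: _ => decide (i = p)

theorem insertOne_of_topIs_eq_false {p : ℕ} {G : List Grp} (h : topIs p G = false) (u r : ℕ) :
    insertOne p G u r = singles (r - 1) p ((p, List.replicate u false ++ [true]) :: G) := by
  rcases G with _ | ⟨⟨i, δ⟩, G⟩
  · rfl
  · rw [topIs, decide_eq_false_iff_not] at h
    simp [insertOne, h]

/-- A group of `n` bits counts `n + 1` in `gsize`, and dropping it frees `n - 1` non-leading bits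
and one leading bit, the latter counted twice. This invariant quantity bounds the running times
below. -/
theorem dropLow_measure (p : ℕ) {N : ℕ} (G : List Grp) (u r r₀ : ℕ) (hG : GroupsWF N r₀ G) :
    gsize (dropLow p G u r).1 + (dropLow p G u r).2.1 + 2 * (dropLow p G u r).2.2 =
      gsize G + u + 2 * r := by
  induction G generalizing u r r₀ with
  | nil => rfl
  | cons g G ih =>
    obtain ⟨i, δ⟩ := g
    obtain ⟨-, -, hδ, hG⟩ := hG
    have := List.length_pos_iff.2 hδ
    rw [dropLow]
    split_ifs
    · rw [ih _ _ i hG, gsize]; omega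
    · rfl

/-- The indices increase strictly and start above `r`, so each dropped group, which adds one to `r`,
also moves the lower bound for the remaining indices by at least one. Hence the free leading bits
fit below `p` as new groups. -/
theorem dropLow_lt (p : ℕ) {N : ℕ} (G : List Grp) (u r : ℕ) (hG : GroupsWF N r G) (hr : r < p) :
    (dropLow p G u r).2.2 < p := by
  induction G generalizing u r with
  | nil => exact hr
  | cons g G ih =>
    obtain ⟨i, δ⟩ := g
    obtain ⟨h1, -, -, hG⟩ := hG
    rw [dropLow]
    split_ifs with h
    · exact ih _ _ (hG.mono h1) (by omega)
    · exact hr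

theorem raise_time (m L : ℕ) :
    (m + 1) * (16 * L + 40) + ((m + 3) * (4 * L + 11) + m * (8 * L + 13) + (2 * m + 8 * L + 30)) +
      (4 * L + 10) ≤ 150 * ((m + 1) * (L + 1)) := by
  nlinarith [Nat.zero_le (m * L)]

section GroupRoutines

variable {L h p N : ℕ} (hL : 0 < L) (hp : p < 2 ^ L) (hN : N ≤ 2 ^ L) (H : List Bool)
  (o : List Bool)

-- The flag `eq` is left by the last comparison, which stopped the loop; with no groups left it is
-- set to false explicitly. `raiseP` then knows whether a string with index `p` is already present.
include hL hp hN in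
theorem dropLowP_exec (X : List Bool) (hX : X.length ≤ L) (u r : ℕ) (G : List Grp) {r₀ : ℕ}
    (hG : GroupsWF N r₀ G) (v : Reg) :
    ∃ v' X', List.length X' ≤ L ∧ v'.eq = topIs p (dropLow p G u r).1 ∧
      Exec dropLowP ⟨v, stG L H (fixedWidthBits L p) X u r G, o⟩
        ((gsize G + 1) * (16 * L + 40))
        ⟨v', stG L H (fixedWidthBits L p) X' (dropLow p G u r).2.1 (dropLow p G u r).2.2
          (dropLow p G u r).1, o⟩ := by
  suffices key : ∀ (G : List Grp) (r₀ : ℕ) (X : List Bool) (u r : ℕ) (v : Reg),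
      GroupsWF N r₀ G → X.length ≤ L → v.c = true →
      ∃ v' X', List.length X' ≤ L ∧ v'.eq = topIs p (dropLow p G u r).1 ∧
      Exec (.loop (fun v => v.c) (dropP .x ;; .act [popA .t] ;;
        ifSome
          (.act [pushA .t] ;; copyTop ;; cmpP ;;
            .ite (fun v => v.lt) (dropGroup ;; .act [.load fun v => { v with c := true }])
              (.act [.load fun v => { v with c := false }]))
          (.act [.load fun v => { v with c := false, eq := false }])))
        ⟨v, stG L H (fixedWidthBits L p) X u r G, o⟩
        ((gsize G + 1) * (16 * L + 39))
        ⟨v', stG L H (fixedWidthBits L p) X' (dropLow p G u r).2.1 (dropLow p G u r).2.2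
          (dropLow p G u r).1, o⟩ by
    obtain ⟨v', X', h1, h2, h3⟩ := key G r₀ X u r { v with c := true } hG hX rfl
    refine ⟨v', X', h1, h2, ?_⟩
    unfold dropLowP
    apply Exec.mono
    · apply Exec.act_seq h3
    · ring_nf; omega
  clear hX hG v u r X G r₀
  intro G
  induction G with
  | nil =>
    rintro r₀ X u r ⟨a, b, c, e, l⟩ - hX rfl
    refine ⟨⟨none, b, false, false, l⟩, [], by simp, rfl, ?_⟩
    unfold stG
    apply Exec.mono
    · apply Exec.loopT rfl
      · apply Exec.seq
        · exact dropP_exec _ _ _ _ X [] (by simp [st_apply]) rfl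
        apply Exec.act_seq
        simp only [exec_simps, update_st, st_apply, repT]
        exact Exec.iteF rfl (Exec.act rfl)
      simp only [exec_simps, update_st, st_apply, repB]
      exact Exec.loopF rfl
    · simp [gsize]; omega
  | cons g G ih =>
    obtain ⟨i, δ⟩ := g
    rintro r₀ X u r ⟨a, b, c, e, l⟩ hG hX rfl
    obtain ⟨h1, h2, h3, h4⟩ := hG
    obtain ⟨d, s, hs⟩ := head_repT hL i δ G
    have hiL : i < 2 ^ L := h2.trans_le hN
    have hs' : some d :: s = dg (fixedWidthBits L i) ++ none :: repT L G := hs.symm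
    by_cases hip : i < p
    · obtain ⟨⟨a', b', c', e', l'⟩, hv'⟩ := dropGroup_exec L H (fixedWidthBits L p)
        (fixedWidthBits L i) u r G o i δ h3 ⟨none, none, true, decide (i = p), decide (i < p)⟩
      obtain ⟨v'', X', h5, h6, h7⟩ := ih i (fixedWidthBits L i) (u + (δ.length - 1)) (r + 1)
        ⟨a', b', true, e', l'⟩ h4 (by simp [length_fixedWidthBits]) rfl
      refine ⟨v'', X', h5, by simpa [dropLow, hip] using h6, ?_⟩
      apply Exec.mono
      · apply Exec.loopT rfl
        · apply Exec.seq
          · exact dropP_exec _ _ _ _ X [] (by simp [st_apply, stG]) rfl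
          apply Exec.act_seq
          unfold stG
          simp only [exec_simps, update_st, st_apply, hs]
          apply Exec.iteT rfl
          apply Exec.act_seq
          simp only [exec_simps, update_st, st_apply, hs']
          apply Exec.seq (copyTop_exec ..)
          apply Exec.seq (cmpP_num _ _ _ _ _ _ _ _ _ _ hiL hp rfl)
          apply Exec.iteT (by simpa using hip)
          apply Exec.seq hv'
          exact Exec.act rfl
        simp only [exec_simps, update_st, st_apply]
        simpa [dropLow, hip] using h7
      · simp [gsize, length_fixedWidthBits]; ring_nf; omega
    · refine ⟨⟨none, none, false, decide (i = p), decide (i < p)⟩, fixedWidthBits L i,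
        by simp [length_fixedWidthBits], by simp [dropLow, hip, topIs], ?_⟩
      apply Exec.mono
      · apply Exec.loopT rfl
        · apply Exec.seq
          · exact dropP_exec _ _ _ _ X [] (by simp [st_apply, stG]) rfl
          apply Exec.act_seq
          unfold stG
          simp only [exec_simps, update_st, st_apply, hs]
          apply Exec.iteT rfl
          apply Exec.act_seq
          simp only [exec_simps, update_st, st_apply, hs']
          apply Exec.seq (copyTop_exec ..)
          apply Exec.seq (cmpP_num _ _ _ _ _ _ _ _ _ _ hiL hp rfl)
          apply Exec.iteF (by simpa using hip)
          exact Exec.act rfl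
        simp only [exec_simps, update_st, st_apply]
        apply Exec.to
        · exact Exec.loopF rfl
        · simp [dropLow, hip, repT, stG]
        · exact le_rfl
      · simp [gsize, length_fixedWidthBits]; ring_nf; omega

include hL hp hN in
theorem raiseP_exec (X : List Bool) (hX : X.length ≤ L) (u r : ℕ) (G : List Grp)
    (hG : GroupsWF N r G) (hr : r < p) (v : Reg) :
    Outs raiseP ⟨v, stG L H (fixedWidthBits L p) X u r G, o⟩
      (150 * ((gsize G + u + 2 * r + 1) * (L + 1))) (true :: outG L (raiseAt p G u r) o) := by
  obtain ⟨⟨a, b, c, e, l⟩, X', hX', he, hd⟩ := dropLowP_exec hL hp hN H o X hX u r G hG v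
  have hm := dropLow_measure p G u r r hG
  have hlt := dropLow_lt p G u r hG hr
  unfold raiseAt
  generalize dropLow p G u r = s at *
  obtain ⟨G', u', r'⟩ := s
  simp only at hm hlt he hd ⊢
  set μ := gsize G + u + 2 * r with hμ
  have e1 : (gsize G + 1) * (16 * L + 40) ≤ (μ + 1) * (16 * L + 40) :=
    Nat.mul_le_mul_right _ (by omega)
  have e2 : r' * (8 * L + 13) ≤ μ * (8 * L + 13) := Nat.mul_le_mul_right _ (by omega)
  -- Both branches leave the group with index `p` on top with its new `1`; what remains is to pad it
  -- with zeros, add the single zeros below, and write the output.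
  have tail : ∀ (a b : Option StackSym) (c e l : Bool) (u'' r'' : ℕ) (δ : List Bool)
      (G'' : List Grp), r'' ≤ p → r'' ≤ μ →
      gsize G'' + 1 + (u'' + δ.length) + 2 * r'' ≤ μ + 3 →
      Outs (dropP .x ;; mv .p .y ;; mv .y .x ;; padZeros ;; singlesP ;; outputP)
        ⟨⟨a, b, c, e, l⟩, stG L H (fixedWidthBits L p) X' u'' r'' ((p, δ) :: G''), o⟩
        ((μ + 3) * (4 * L + 11) + μ * (8 * L + 13) + (2 * μ + 8 * L + 30))
        (true :: outG L (singles r'' p ((p, List.replicate u'' false ++ δ) :: G'')) o) := by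
    intro a b c e l u'' r'' δ G'' h1 h2 h3
    have e3 : gsize (singles r'' p ((p, List.replicate u'' false ++ δ) :: G'')) * (4 * L + 11) ≤
        (μ + 3) * (4 * L + 11) := by
      refine Nat.mul_le_mul_right _ ?_
      rw [gsize_singles]
      simp [gsize]; omega
    have e4 : r'' * (8 * L + 13) ≤ μ * (8 * L + 13) := Nat.mul_le_mul_right _ h2
    unfold stG
    apply Outs.mono
    · apply Exec.andThen
      · exact dropP_exec _ _ _ _ X' [] (by simp [st_apply]) rfl
      simp only [exec_simps, update_st, st_apply]
      apply Exec.andThen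
      · exact mv_exec (by decide) _ _ _ (fixedWidthBits L p) [] (by simp [st_apply]) rfl
      simp only [exec_simps, update_st, st_apply]
      apply Exec.andThen
      · exact mv_exec (by decide) _ _ _ (fixedWidthBits L p).reverse [] (by simp [st_apply]) rfl
      simp only [exec_simps, update_st, st_apply]
      apply Exec.andThen
      · exact padZeros_exec ..
      apply Ends.andThen
      · have := singlesP_exec L H [] 0 r'' ((p, List.replicate u'' false ++ δ) :: G'') o p h1
        simp only [stG, repB, repT, dg_append, List.append_assoc, dg_nil, un_zero] at this
        exact this _
      intro v
      exact (outputP_exec L H [] (fixedWidthBits L (p - r'')) 0 0 _ o hL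
        (by simp [length_fixedWidthBits]) v).outs
    · simp [length_fixedWidthBits]; omega
  clear_value μ
  unfold raiseP
  by_cases ht : topIs p G' = true
  · rcases G' with _ | ⟨⟨i, δ⟩, G'⟩
    · simp [topIs] at ht
    obtain rfl : i = p := by simpa [topIs] using ht
    simp only [insertOne, if_true]
    apply Outs.mono
    · apply Exec.andThen hd
      apply Exec.andThen
      · apply Exec.iteT (by simpa [ht] using he)
        exact Exec.act rfl
      unfold stG
      simp only [exec_simps, update_st, st_apply, un_tail]
      exact tail _ _ _ _ _ (u' - 1) r' (true :: δ) G' (by omega) (by omega)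
        (by simp [gsize] at hm ⊢; omega)
    · have := raise_time μ L
      omega
  · rw [insertOne_of_topIs_eq_false (by simpa using ht)]
    apply Outs.mono
    · apply Exec.andThen hd
      apply Exec.andThen
      · apply Exec.iteF (by simpa [ht] using he)
        apply Exec.act_seq
        unfold stG
        simp only [exec_simps, update_st, st_apply, un_tail]
        apply Exec.seq
        · exact mv_exec (by decide) _ _ _ (fixedWidthBits L p) [] (by simp [st_apply]) rfl
        simp only [exec_simps, update_st, st_apply]
        exact mv2_exec (by decide) (by decide) (by decide) _ _ _ (fixedWidthBits L p).reverse []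
          (by simp [st_apply]) rfl
      simp only [exec_simps, update_st, st_apply]
      exact tail _ _ _ _ _ u' (r' - 1) [true] G' (by omega) (by omega)
        (by simp at hm ⊢; omega)
    · simp only [length_fixedWidthBits, List.length_reverse]
      have := raise_time μ L
      omega

end GroupRoutines

/-! ### The successor algorithm on groups -/

/-- Raise the string with index `p`, unless `p` is the height `h`. -/
def checked (h p : ℕ) (G : List Grp) (u r : ℕ) : Option (List Grp) :=
  if h = p then none else some (raiseAt p G u r)

/-- Continue minimally below the index `i`. -/
def lower (u r i : ℕ) (G : List Grp) : List Grp :=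
  if r = 0 then G else singles (r - 1) (i - 1) ((i - 1, List.replicate u false ++ [false]) :: G)

/-- The number of leading `1`s. -/
def trues : List Bool → ℕ
  | true :: δ => trues δ + 1
  | _ => 0

/-- The list without its leading `1`s. -/
def afterTrues : List Bool → List Bool
  | true :: δ => afterTrues δ
  | δ => δ

theorem trues_add_length_afterTrues (δ : List Bool) :
    trues δ + (afterTrues δ).length = δ.length := by
  induction δ with
  | nil => rfl
  | cons d δ ih => cases d <;> simp [trues, afterTrues]; try omega

theorem head_afterTrues {δ γ : List Bool} {d : Bool} (h : afterTrues δ = d :: γ) : d = false := by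
  induction δ with
  | nil => simp [afterTrues] at h
  | cons d' δ ih =>
    cases d'
    · simp only [afterTrues, List.cons.injEq] at h
      exact h.1.symm
    · exact ih (by simpa [afterTrues] using h)

/-- Raise the groups `(i, δ) :: G` at the index `i` by removing bits if possible, and otherwise at
the index `i + 1`. -/
def strip (h i : ℕ) (δ : List Bool) (G : List Grp) (r : ℕ) : Option (List Grp) :=
  match afterTrues δ with
  | [] => checked h (i + 1) G (trues δ - 1) (r + 1)
  | [_] =>
    if r + 1 = i then checked h (i + 1) G (trues δ) (r + 1)
    else some (lower (trues δ) (r + 1) i G)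
  | _ :: γ => some (lower (trues δ + 1) r i ((i, γ) :: G))

/-- Drop the top groups that consist of a single bit. -/
def dropSingles : List Grp → ℕ → List Grp × ℕ
  | [], r => ([], r)
  | (i, δ) :: G, r => if δ.length = 1 then dropSingles G (r + 1) else ((i, δ) :: G, r)

/-- The successor of a non-empty sequence of groups. -/
def succGroups (h p i : ℕ) (δ : List Bool) (G : List Grp) (u r : ℕ) : Option (List Grp) :=
  if i < p then checked h p ((i, δ) :: G) u r
  else if u = 0 then strip h i δ G r
  else checked h i ((i, δ) :: G) u r

/-- The successor of a sequence of groups for which all strings below are empty. -/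
def succTop (h p : ℕ) (u r : ℕ) : List Grp → Option (List Grp)
  | [] => none
  | (i, δ) :: G => succGroups h p i δ G u r

/-- The level-`p` successor of a sequence of groups with `u` free non-leading bits. -/
def algo (h p u : ℕ) (G : List Grp) : Option (List Grp) :=
  if u = 0 then succTop h p 0 (dropSingles G 0).2 (dropSingles G 0).1 else succTop h p u 0 G

/-- The output for the result of the algorithm. -/
def resultOut (L : ℕ) : Option (List Grp) → List Bool
  | none => [false]
  | some G => true :: outG L G []

theorem cmpBits_nil (e l : Bool) (w m : ℕ) :
    cmpBits e l (fixedWidthBits w m) [] = cmpBits e l (fixedWidthBits w m) (fixedWidthBits w 0) := by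
  induction w generalizing e l m with
  | zero => rfl
  | succ w ih =>
    rw [fixedWidthBits_succ, fixedWidthBits_succ]
    simp [cmpBits, ih]

section GroupRoutines

variable {L h : ℕ} (hL : 0 < L) (hh : h < 2 ^ L)

theorem mul_bound (m L : ℕ) : m + L + 1 ≤ (m + 1) * (L + 1) := by
  nlinarith [Nat.zero_le (m * L)]

include hL hh in
theorem checkedP_exec {p : ℕ} (hp : p < 2 ^ L) (X : List Bool) (hX : X.length ≤ L) (u r : ℕ)
    (G : List Grp) (hG : GroupsWF h r G) (hr : r < p) (v : Reg) :
    Outs checkedP ⟨v, stG L (fixedWidthBits L h) (fixedWidthBits L p) X u r G, []⟩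
      (170 * ((gsize G + u + 2 * r + 1) * (L + 1))) (resultOut L (checked h p G u r)) := by
  have hb := mul_bound (gsize G + u + 2 * r) L
  unfold checkedP checked
  apply Outs.mono
  · unfold stG
    apply Exec.andThen
    · exact dropP_exec _ _ _ _ X [] (by simp [st_apply]) rfl
    simp only [exec_simps, update_st, st_apply]
    apply Exec.andThen
    · exact copyH_exec ..
    apply Exec.andThen
    · exact cmpP_num _ _ _ _ _ _ _ _ _ _ hh hp rfl
    have : Outs raiseP ⟨⟨none, none, v.c, decide (h = p), decide (h < p)⟩,
        stG L (fixedWidthBits L h) (fixedWidthBits L p) (fixedWidthBits L h) u r G, []⟩ _ _ :=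
      raiseP_exec hL hp hh.le _ _ (fixedWidthBits L h) (by simp [length_fixedWidthBits]) u r G
        hG hr _
    by_cases hhp : h = p
    · rw [if_pos hhp]
      apply Outs.iteT (by simpa using hhp)
      exact (Exec.mono (Exec.act rfl)
        (show 1 ≤ 150 * ((gsize G + u + 2 * r + 1) * (L + 1)) by omega)).ends.outs
    · rw [if_neg hhp]
      apply Outs.iteF (by simpa using hhp)
      exact this
  · simp only [length_fixedWidthBits]
    omega

include hL hh in
theorem nextUp_exec {i : ℕ} (hi : i < h) (P : List Bool) (hP : P.length ≤ L) (u r : ℕ)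
    (G : List Grp) (hG : GroupsWF h r G) (hr : r < i + 1) (v : Reg) :
    Outs nextUp ⟨v, stG L (fixedWidthBits L h) P (fixedWidthBits L i) u r G, []⟩
      (200 * ((gsize G + u + 2 * r + 1) * (L + 1))) (resultOut L (checked h (i + 1) G u r)) := by
  have hb := mul_bound (gsize G + u + 2 * r) L
  unfold nextUp
  apply Outs.mono
  · unfold stG
    apply Exec.andThen
    · exact stepP_exec (A := fixedWidthBits L i) ..
    simp only [exec_simps, update_st, st_apply, stepBits_inc]
    apply Exec.andThen
    · exact setP_exec ..
    exact checkedP_exec hL hh (lt_of_le_of_lt hi hh) [] (by simp) u r G hG hr _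
  · simp only [length_fixedWidthBits]
    omega

include hL in
theorem lowerP_exec (H P : List Bool) {i : ℕ} (u r : ℕ) (hr : r ≤ i) (G : List Grp) (v : Reg) :
    Outs lowerP ⟨v, stG L H P (fixedWidthBits L i) u r G, []⟩
      (100 * ((gsize G + u + 2 * r + 1) * (L + 1))) (resultOut L (some (lower u r i G))) := by
  set m := gsize G + u + 2 * r with hm
  have hb : m * (4 * L + 11) + m * (8 * L + 13) + 60 * (m + L + 1) ≤
      100 * ((m + 1) * (L + 1)) := by
    nlinarith [Nat.zero_le (m * L)]
  clear_value m
  have hs : gsize (lower u r i G) * (4 * L + 11) ≤ m * (4 * L + 11) := by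
    refine Nat.mul_le_mul_right _ ?_
    unfold lower
    split_ifs
    · omega
    · rw [gsize_singles]
      simp [gsize]; omega
  have ht : (r - 1) * (8 * L + 13) ≤ m * (8 * L + 13) := Nat.mul_le_mul_right _ (by omega)
  unfold lowerP
  rcases r with _ | r
  · apply Outs.mono
    · apply Outs.act_seq
      unfold stG
      simp only [exec_simps, update_st, st_apply, un_zero]
      apply Exec.andThen
      · exact Exec.iteF rfl (Exec.act rfl)
      simp only [exec_simps]
      exact (outputP_exec L H P (fixedWidthBits L i) u 0 G [] hL
        (by simp [length_fixedWidthBits]) _).outs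
    · simp only [lower, if_true] at hs
      omega
  · obtain ⟨i, rfl⟩ : ∃ j, i = j + 1 := ⟨i - 1, by omega⟩
    have h1 := singlesP_exec L H P 0 r ((i, List.replicate u false ++ [false]) :: G) [] i
      (by omega)
    simp only [stG, repB, repT, dg_append, List.append_assoc, un_zero, exec_simps] at h1
    apply Outs.mono
    · apply Outs.act_seq
      unfold stG
      simp only [exec_simps, update_st, st_apply, un_succ]
      apply Ends.andThen
      · obtain ⟨v', hv'⟩ := h1 { v with a := none, c := false }
        apply Exec.ends (v := v')
        apply Exec.iteT rfl
        apply Exec.seq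
        · exact newGroup_exec (D := fixedWidthBits L (i + 1)) ..
        apply Exec.seq
        · exact padZeros_exec ..
        rw [stepBits_dec]
        exact hv'
      intro v'
      exact (outputP_exec L H P (fixedWidthBits L (i - r)) 0 0 _ [] hL
        (by simp [length_fixedWidthBits]) _).outs
    · simp only [lower, Nat.add_eq_zero_iff, one_ne_zero, and_false, if_false,
        Nat.add_sub_cancel] at hs ht
      simp only [length_fixedWidthBits]
      omega

/-- The counter `r` is unary and the index binary, so `r` is subtracted from the index by repeated
decrements and the result is compared with zero: the stack `p` is emptied first, and an empty second
number reads as zeros. The hypothesis `r ≤ i` keeps the decrements from wrapping around. The stack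
`w` saves `r`. -/
theorem testP_exec {i : ℕ} (hi : i < 2 ^ L) (h P : List Bool) (hP : P.length ≤ L) {r : ℕ}
    (hr : r ≤ i) (u b t : List StackSym) (o : List Bool) (v : Reg) :
    ∃ v', v'.eq = decide (r = i) ∧
      Exec testP ⟨v, st [] (dg h) (dg P) (dg (fixedWidthBits L i)) [] [] [] u (un r) b
        (dg (fixedWidthBits L i) ++ none :: t), o⟩ ((r + 2) * (4 * L + 10) + 20 * L + 20)
        ⟨v', st [] (dg h) (dg (fixedWidthBits L 0)) (dg (fixedWidthBits L i)) [] [] [] u (un r) b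
          (dg (fixedWidthBits L i) ++ none :: t), o⟩ := by
  have key : ∀ (r m n : ℕ) (v : Reg), r ≤ m → v.a = (un r).head? →
      Ends (forDigits (.act [pushA .w] ;; stepP true ;; .act [popA .r]))
        ⟨v, st [] (dg h) [] (dg (fixedWidthBits L m)) [] [] (un n) u (un r).tail b
          (dg (fixedWidthBits L i) ++ none :: t), o⟩ (r * (4 * L + 8) + 1)
        (st [] (dg h) [] (dg (fixedWidthBits L (m - r))) [] [] (un (n + r)) u [] b
          (dg (fixedWidthBits L i) ++ none :: t)) o := by
    intro r
    induction r with
    | zero =>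
      rintro m n ⟨a, b, c, e, l⟩ - rfl
      exact ⟨_, Exec.to (Exec.loopF rfl) rfl (by omega)⟩
    | succ r ih =>
      rintro m n ⟨a, b, c, e, l⟩ hr rfl
      obtain ⟨m, rfl⟩ : ∃ j, m = j + 1 := ⟨m - 1, by omega⟩
      obtain ⟨v', hv'⟩ := ih m (n + 1) ⟨(un r).head?, b, false, e, l⟩ (by omega) rfl
      refine ⟨v', ?_⟩
      apply Exec.mono
      · apply Exec.loopT rfl
        · apply Exec.act_seq
          simp only [exec_simps, update_st, st_apply, un_succ]
          apply Exec.seq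
          · exact stepP_exec (A := fixedWidthBits L (m + 1)) ..
          exact Exec.act rfl
        simp only [exec_simps, update_st, st_apply, un_succ, stepBits_dec]
        rw [show m + 1 - (r + 1) = m - r by omega, show n + (r + 1) = n + 1 + r by omega]
        exact hv'
      · simp only [length_fixedWidthBits]; ring_nf; omega
  obtain ⟨v', hv'⟩ := key r i 0 { v with a := (un r).head? } hr rfl
  refine ⟨⟨none, none, v'.c, (cmpBits true false (fixedWidthBits L (i - r)) []).1,
    (cmpBits true false (fixedWidthBits L (i - r)) []).2⟩, ?_, ?_⟩
  rotate_left
  · unfold testP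
    apply Exec.mono
    · apply Exec.seq
      · exact dropP_exec _ _ _ _ P [] (by simp [st_apply]) rfl
      simp only [exec_simps, update_st, st_apply]
      apply Exec.act_seq
      simp only [exec_simps, update_st, st_apply]
      apply Exec.seq
      · exact hv'
      apply Exec.seq
      · exact mv_exec (by decide) _ _ _ (List.replicate r true) [] (by simp [st_apply, un]) rfl
      simp only [exec_simps, update_st, st_apply, List.reverse_replicate]
      apply Exec.seq
      · exact cmpP_exec (A := fixedWidthBits L (i - r)) (B := []) (hB := by simp) ..
      rw [length_fixedWidthBits, show padBits L [] = fixedWidthBits L 0 by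
        rw [padBits_eq L L [] (by simp), fixedWidthBits_zero_right]; rfl]
      apply Exec.seq
      · exact dropP_exec _ _ _ _ (fixedWidthBits L (i - r)) [] (by simp [st_apply]) rfl
      simp only [exec_simps, update_st, st_apply]
      exact copyTop_exec ..
    · simp only [length_fixedWidthBits, List.length_replicate]
      ring_nf; omega
  · rw [cmpBits_nil, cmpBits_fixedWidthBits _ _ _ _ _ (by omega) (by positivity)]
    simp only [Bool.true_and, decide_eq_decide]
    omega

-- On the stack the last bit of a string comes first, so its trailing `1`s are the leading ones of
-- `δ`, and they can be popped into `u` directly. What is found below them distinguishes the three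
-- cases of `strip`.
include hL hh in
theorem stripP_exec {i : ℕ} (P : List Bool) (hP : P.length ≤ L) (r : ℕ) (δ : List Bool)
    (G : List Grp) (hG : GroupsWF h r ((i, δ) :: G)) (v : Reg) :
    Outs stripP ⟨v, stG L (fixedWidthBits L h) P (fixedWidthBits L i) 0 r ((i, δ) :: G), []⟩
      (300 * ((gsize ((i, δ) :: G) + 2 * r + 1) * (L + 1)))
      (resultOut L (strip h i δ G r)) := by
  obtain ⟨hri, hih, hδ, hG⟩ := hG
  have hiL : i < 2 ^ L := hih.trans hh
  have key : ∀ (δ : List Bool) (u : ℕ) (v : Reg), v.a = (dg δ ++ none :: repB G).head? →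
      Exec (.loop (fun v => v.a == some (some true)) (.act [pushS .u (some true), popA .b]))
        ⟨v, st [] (dg (fixedWidthBits L h)) (dg P) (dg (fixedWidthBits L i)) [] [] [] (un u) (un r)
          (dg δ ++ none :: repB G).tail (repT L ((i, δ) :: G)), []⟩ (2 * δ.length + 1)
        ⟨{ v with a := (dg (afterTrues δ) ++ none :: repB G).head? },
          st [] (dg (fixedWidthBits L h)) (dg P) (dg (fixedWidthBits L i)) [] [] []
          (un (u + trues δ)) (un r)
          (dg (afterTrues δ) ++ none :: repB G).tail (repT L ((i, δ) :: G)), []⟩ := by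
    intro δ
    induction δ with
    | nil =>
      rintro u ⟨a, b, c, e, l⟩ rfl
      exact Exec.to (Exec.loopF rfl) rfl (by omega)
    | cons d δ ih =>
      rintro u ⟨a, b, c, e, l⟩ rfl
      cases d
      · exact Exec.to (Exec.loopF rfl) rfl (by omega)
      · apply Exec.mono
        · apply Exec.loopT rfl (Exec.act rfl)
          simp only [exec_simps, update_st, st_apply]
          have := ih (u + 1) ⟨(dg δ ++ none :: repB G).head?, b, c, e, l⟩ rfl
          rw [show u + 1 + trues δ = u + trues (true :: δ) by simp [trues]; omega] at this
          exact this
        · simp only [List.length_cons]; omega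
  have hlen := trues_add_length_afterTrues δ
  have hδ' := List.length_pos_iff.2 hδ
  have hm : gsize ((i, δ) :: G) = δ.length + 1 + gsize G := rfl
  have hb := mul_bound (gsize ((i, δ) :: G) + 2 * r) L
  have hdrop : ∀ (v : Reg) (u r' : ℕ) (P : List Bool), Exec (dropP .t) ⟨v, st []
      (dg (fixedWidthBits L h)) (dg P) (dg (fixedWidthBits L i)) [] [] [] (un u) (un r') (repB G)
        (dg (fixedWidthBits L i) ++ none :: repT L G), []⟩ (2 * L + 2)
      ⟨{ v with a := some none }, stG L (fixedWidthBits L h) P (fixedWidthBits L i) u r' G, []⟩ := by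
    intro v u r' P
    apply Exec.to
    · exact dropP_exec _ _ _ _ (fixedWidthBits L i) (none :: repT L G) (by simp [st_apply]) rfl
    · simp only [exec_simps, update_st, st_apply, stG]
    · simp [length_fixedWidthBits]
  unfold stripP
  apply Outs.mono
  · apply Outs.act_seq
    unfold stG
    simp only [exec_simps, update_st, st_apply]
    apply Exec.andThen (key δ 0 _ rfl)
    simp only [exec_simps, Nat.zero_add, repT]
    have goal : ∀ n, n = 298 * ((gsize ((i, δ) :: G) + 2 * r + 1) * (L + 1)) →
        Outs (.ite (fun v => v.a == some none)
          (.act [popA .u, pushS .r (some true)] ;; dropP .t ;; nextUp)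
          (.act [pushS .u (some true), popA .b] ;;
            .ite (fun v => v.a == some none)
              (.act [popA .u, pushS .r (some true)] ;; testP ;;
                .ite (fun v => v.eq) (dropP .t ;; nextUp) (dropP .t ;; lowerP))
              (.act [pushA .b] ;; lowerP)))
        ⟨{ v with a := (dg (afterTrues δ) ++ none :: repB G).head? },
          st [] (dg (fixedWidthBits L h)) (dg P) (dg (fixedWidthBits L i)) [] [] []
          (un (trues δ)) (un r) (dg (afterTrues δ) ++ none :: repB G).tail
          (dg (fixedWidthBits L i) ++ none :: repT L G), []⟩ n
        (resultOut L (strip h i δ G r)) := by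
      rintro n rfl
      unfold strip
      rcases hγ : afterTrues δ with _ | ⟨d, _ | ⟨d', γ⟩⟩
      · rw [hγ] at hlen
        simp only [List.length_nil] at hlen
        apply Outs.mono
        · apply Outs.iteT rfl
          apply Outs.act_seq
          simp only [exec_simps, update_st, st_apply, un_tail]
          apply Exec.andThen (hdrop _ _ (r + 1) _)
          exact nextUp_exec hL hh hih P hP _ _ _ (hG.mono hri) (by omega) _
        -- The potential is conserved when the group is given up, so the bound of `nextUp_exec` is
        -- already in the right form.
        · rw [show gsize G + (trues δ - 1) + 2 * (r + 1) = gsize ((i, δ) :: G) + 2 * r by omega]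
          omega
      · rw [hγ] at hlen
        obtain rfl := head_afterTrues hγ
        simp only [List.length_cons, List.length_nil] at hlen
        have hr' : (r + 1 + 2) * (4 * L + 10) ≤ 30 *
            ((gsize ((i, δ) :: G) + 2 * r + 1) * (L + 1)) := by
          have h1 : (r + 1 + 2) * (4 * L + 10) ≤ (3 * (gsize ((i, δ) :: G) + 2 * r + 1)) *
            (10 * (L + 1)) := Nat.mul_le_mul (by omega) (by omega)
          linarith
        apply Outs.mono
        · apply Outs.iteF rfl
          apply Outs.act_seq
          simp only [exec_simps, update_st, st_apply]
          apply Outs.iteT rfl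
          apply Outs.act_seq
          simp only [exec_simps, update_st, st_apply]
          obtain ⟨v', hv', ht⟩ := testP_exec hiL (fixedWidthBits L h) P hP (r := r + 1) hri
            (un (trues δ)) (repB G) (repT L G) [] { v with a := some (some true) }
          apply Exec.andThen (c' := ⟨v', _, _⟩)
          · exact ht
          have goal : Outs (.ite (fun v => v.eq) (dropP .t ;; nextUp) (dropP .t ;; lowerP))
              ⟨v', st [] (dg (fixedWidthBits L h)) (dg (fixedWidthBits L 0))
                (dg (fixedWidthBits L i)) [] [] [] (un (trues δ)) (un (r + 1)) (repB G)
                (dg (fixedWidthBits L i) ++ none :: repT L G), []⟩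
              (210 * ((gsize ((i, δ) :: G) + 2 * r + 1) * (L + 1)))
              (resultOut L (if r + 1 = i then checked h (i + 1) G (trues δ) (r + 1)
                else some (lower (trues δ) (r + 1) i G))) := by
            by_cases hri' : r + 1 = i
            · rw [if_pos hri']
              apply Outs.mono
              · apply Outs.iteT (by simpa [hri'] using hv')
                apply Exec.andThen (hdrop _ _ (r + 1) _)
                exact nextUp_exec hL hh hih _ (by simp [length_fixedWidthBits]) _ _ _
                  (hG.mono hri) (by omega) _
              · rw [show gsize G + trues δ + 2 * (r + 1) = gsize ((i, δ) :: G) + 2 * r by omega]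
                omega
            · rw [if_neg hri']
              apply Outs.mono
              · apply Outs.iteF (by simpa [hri'] using hv')
                apply Exec.andThen (hdrop _ _ (r + 1) _)
                exact lowerP_exec hL _ _ _ _ hri _ _
              · rw [show gsize G + trues δ + 2 * (r + 1) = gsize ((i, δ) :: G) + 2 * r by omega]
                omega
          exact goal
        · omega
      · rw [hγ] at hlen
        obtain rfl := head_afterTrues hγ
        simp only [List.length_cons] at hlen
        apply Outs.mono
        · apply Outs.iteF rfl
          apply Outs.act_seq
          simp only [exec_simps, update_st, st_apply]
          apply Outs.iteF rfl
          apply Outs.act_seq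
          simp only [exec_simps, update_st, st_apply]
          exact lowerP_exec hL (fixedWidthBits L h) P (trues δ + 1) r hri.le
            ((i, d' :: γ) :: G) _
        · rw [show gsize ((i, d' :: γ) :: G) + (trues δ + 1) + 2 * r =
            gsize ((i, δ) :: G) + 2 * r by simp only [gsize, List.length_cons]; omega]
          omega
    exact goal _ rfl
  · omega

end GroupRoutines

theorem dropSingles_measure (G : List Grp) (r : ℕ) :
    gsize (dropSingles G r).1 + 2 * (dropSingles G r).2 = gsize G + 2 * r := by
  induction G generalizing r with
  | nil => rfl
  | cons g G ih =>
    obtain ⟨i, δ⟩ := g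
    rw [dropSingles]
    split_ifs with h
    · rw [ih, gsize, h]; omega
    · rfl

theorem dropSingles_wf {N : ℕ} (G : List Grp) (r : ℕ) (hG : GroupsWF N r G) :
    GroupsWF N (dropSingles G r).2 (dropSingles G r).1 := by
  induction G generalizing r with
  | nil => trivial
  | cons g G ih =>
    obtain ⟨i, δ⟩ := g
    rw [dropSingles]
    split_ifs
    · exact ih _ (hG.2.2.2.mono hG.1)
    · exact hG

section GroupRoutines

variable {L h : ℕ} (hL : 0 < L) (hh : h < 2 ^ L)

include hL hh in
theorem succP_exec {p i : ℕ} (hp : p < 2 ^ L) (u r : ℕ) (δ : List Bool)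
    (G : List Grp) (hG : GroupsWF h r ((i, δ) :: G)) (v : Reg) :
    Outs succP ⟨v, stG L (fixedWidthBits L h) (fixedWidthBits L p) [] u r ((i, δ) :: G), []⟩
      (330 * ((gsize ((i, δ) :: G) + u + 2 * r + 1) * (L + 1)))
      (resultOut L (succGroups h p i δ G u r)) := by
  have hiL : i < 2 ^ L := hG.2.1.trans hh
  have hb := mul_bound (gsize ((i, δ) :: G) + u + 2 * r) L
  unfold succP succGroups
  apply Outs.mono
  · unfold stG
    simp only [repT]
    apply Exec.andThen (copyTop_exec ..)
    apply Exec.andThen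
    · exact cmpP_num _ _ _ _ _ _ _ _ _ _ hiL hp rfl
    have goal : Outs (.ite (fun v => v.lt) checkedP
        (.act [popA .u] ;; ifSome (.act [pushA .u] ;; setP ;; checkedP) stripP))
      ⟨⟨none, none, v.c, decide (i = p), decide (i < p)⟩, stG L (fixedWidthBits L h)
        (fixedWidthBits L p) (fixedWidthBits L i) u r ((i, δ) :: G), []⟩
      (305 * ((gsize ((i, δ) :: G) + u + 2 * r + 1) * (L + 1)))
      (resultOut L (if i < p then checked h p ((i, δ) :: G) u r
        else if u = 0 then strip h i δ G r
        else checked h i ((i, δ) :: G) u r)) := by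
      by_cases hip : i < p
      · rw [if_pos hip]
        apply Outs.mono
        · apply Outs.iteT (by simpa using hip)
          exact checkedP_exec hL hh hp _ (by simp [length_fixedWidthBits]) _ _ _ hG
            (hG.1.trans hip) _
        · omega
      · rw [if_neg hip]
        rcases u with _ | u
        · rw [if_pos rfl]
          apply Outs.mono
          · apply Outs.iteF (by simpa using hip)
            apply Outs.act_seq
            unfold stG
            simp only [exec_simps, update_st, st_apply, un_zero]
            apply Outs.iteF rfl
            exact stripP_exec hL hh _ (by simp [length_fixedWidthBits]) _ _ _ hG _
          · simp only [Nat.add_zero] at hb ⊢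
            omega
        · rw [if_neg (Nat.succ_ne_zero u)]
          apply Outs.mono
          · apply Outs.iteF (by simpa using hip)
            apply Outs.act_seq
            unfold stG
            simp only [exec_simps, update_st, st_apply, un_succ]
            apply Outs.iteT rfl
            apply Outs.act_seq
            simp only [exec_simps, update_st, st_apply]
            apply Exec.andThen (setP_exec ..)
            exact checkedP_exec hL hh hiL [] (by simp) (u + 1) r ((i, δ) :: G) hG hG.1 _
          · simp only [length_fixedWidthBits]
            omega
    exact goal
  · simp only [length_fixedWidthBits]
    omega

theorem head_dg_append (δ : List Bool) (hδ : δ ≠ []) (l : List StackSym) :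
    ∃ d, dg δ ++ l = some d :: (dg δ.tail ++ l) := by
  obtain ⟨d, δ, rfl⟩ := List.exists_cons_of_ne_nil hδ
  exact ⟨d, rfl⟩

/-- Two symbols of lookahead, in the registers `a` and `b`, are needed: the top group is a single
bit exactly if the second symbol is the separator. On exit `b` is pushed back, while `a` stays in
the register. -/
theorem dropSinglesP_exec (N : ℕ) (H P : List Bool) (r : ℕ) (G : List Grp)
    (hG : GroupsWF N r G) (o : List Bool) (v : Reg) :
    ∃ v', v'.a = (repB (dropSingles G r).1).head? ∧
      Exec dropSinglesP ⟨v, stG L H P [] 0 r G, o⟩ ((gsize G + 1) * (2 * L + 8))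
        ⟨v', st [] (dg H) (dg P) [] [] [] [] [] (un (dropSingles G r).2)
          (repB (dropSingles G r).1).tail (repT L (dropSingles G r).1), o⟩ := by
  have key : ∀ (G : List Grp) (r : ℕ) (v : Reg), GroupsWF N r G → v.a = (repB G).head? →
      v.b = (repB G).tail.head? →
      ∃ v', v'.a = (repB (dropSingles G r).1).head? ∧
        v'.b = (repB (dropSingles G r).1).tail.head? ∧
      Exec (.loop (fun v => v.a.isSome && v.b == some none)
          (.act [pushS .r (some true)] ;; dropP .t ;; .act [popA .b, popB .b]))
        ⟨v, st [] (dg H) (dg P) [] [] [] [] [] (un r) (repB G).tail.tail (repT L G), o⟩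
        (gsize G * (2 * L + 8) + 1)
        ⟨v', st [] (dg H) (dg P) [] [] [] [] [] (un (dropSingles G r).2)
          (repB (dropSingles G r).1).tail.tail (repT L (dropSingles G r).1), o⟩ := by
    intro G
    induction G with
    | nil =>
      rintro r ⟨a, b, c, e, l⟩ - rfl rfl
      exact ⟨_, rfl, rfl, Exec.to (Exec.loopF rfl) rfl (by omega)⟩
    | cons g G ih =>
      obtain ⟨i, δ⟩ := g
      rintro r ⟨a, b, c, e, l⟩ ⟨hi, -, hδ, hG⟩ rfl rfl
      rw [dropSingles]
      obtain ⟨d, δ, rfl⟩ := List.exists_cons_of_ne_nil hδ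
      rcases δ with _ | ⟨d', δ⟩
      · rw [if_pos (show [d].length = 1 from rfl)]
        obtain ⟨v', h1, h2, h3⟩ := ih (r + 1) ⟨(repB G).head?, (repB G).tail.head?, c, e, l⟩
          (hG.mono hi) rfl rfl
        refine ⟨v', h1, h2, ?_⟩
        apply Exec.mono
        · apply Exec.loopT rfl
          · apply Exec.act_seq
            simp only [exec_simps, update_st, st_apply, repB, repT]
            apply Exec.seq
            · exact dropP_exec _ _ _ _ (fixedWidthBits L i) (none :: repT L G)
                (by simp [st_apply]) rfl
            simp only [exec_simps, update_st, st_apply]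
            exact Exec.act rfl
          simp only [exec_simps, update_st, st_apply]
          exact h3
        · simp [gsize, length_fixedWidthBits]; ring_nf; omega
      · rw [if_neg (by simp)]
        exact ⟨_, rfl, rfl, Exec.to (Exec.loopF rfl) rfl (by omega)⟩
  obtain ⟨⟨a', b', c', e', l'⟩, h1, h2, h3⟩ := key G r
    { v with a := (repB G).head?, b := (repB G).tail.head? } hG rfl rfl
  simp only at h1 h2
  subst h1 h2
  refine ⟨⟨(repB (dropSingles G r).1).head?, (repB (dropSingles G r).1).tail.head?, c', e', l'⟩,
    rfl, ?_⟩
  unfold dropSinglesP stG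
  generalize dropSingles G r = s at *
  apply Exec.mono
  · apply Exec.act_seq
    simp only [exec_simps, update_st, st_apply]
    apply Exec.seq h3
    rcases hs : (repB s.1).tail with _ | ⟨x, l⟩
    · apply Exec.iteF rfl
      exact Exec.act rfl
    · apply Exec.iteT rfl
      apply Exec.act
      simp only [exec_simps, update_st, st_apply]
  · ring_nf; omega

-- The first pop from `u` decides between the two cases of `algo`; both lead to the common tail
-- `htail`, which needs only that the top symbol of the stack `b` has been popped into the register.
include hL hh in
theorem bodyP_exec {p : ℕ} (hp : p < 2 ^ L) (u : ℕ) (G : List Grp) (hG : GroupsWF h 0 G)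
    (v : Reg) :
    Outs bodyP ⟨v, stG L (fixedWidthBits L h) (fixedWidthBits L p) [] u 0 G, []⟩
      (350 * ((gsize G + u + 1) * (L + 1))) (resultOut L (algo h p u G)) := by
  have hb := mul_bound (gsize G + u) L
  have htail : ∀ (G : List Grp) (u r : ℕ) (v : Reg), GroupsWF h r G → v.a = (repB G).head? →
      Outs (ifSome (.act [pushA .b] ;; succP) (.act [.emit fun _ => false]))
        ⟨v, st [] (dg (fixedWidthBits L h)) (dg (fixedWidthBits L p)) [] [] [] [] (un u) (un r)
          (repB G).tail (repT L G), []⟩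
        (332 * ((gsize G + u + 2 * r + 1) * (L + 1))) (resultOut L (succTop h p u r G)) := by
    rintro (_ | ⟨⟨i, δ⟩, G⟩) u r ⟨a, b, c, e, l⟩ hG rfl
    · have hb := mul_bound (gsize [] + u + 2 * r) L
      apply Outs.mono
      · apply Outs.iteF rfl
        exact (Exec.act rfl).ends.outs
      · omega
    · have hb := mul_bound (gsize ((i, δ) :: G) + u + 2 * r) L
      obtain ⟨d, hd⟩ := head_dg_append δ hG.2.2.1 (none :: repB G)
      apply Outs.mono
      · apply Outs.iteT (by simp [repB, hd])
        apply Outs.act_seq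
        simp only [exec_simps, update_st, st_apply, repB, hd]
        rw [← hd]
        exact succP_exec hL hh hp u r δ G hG _
      · omega
  unfold bodyP algo
  rcases u with _ | u
  · rw [if_pos rfl]
    obtain ⟨v', h1, h2⟩ := dropSinglesP_exec (L := L) h (fixedWidthBits L h) (fixedWidthBits L p)
      0 G hG [] { v with a := none }
    have hm := dropSingles_measure G 0
    apply Outs.mono
    · apply Outs.act_seq
      unfold stG at h2 ⊢
      simp only [exec_simps, update_st, st_apply, un_zero] at h2 ⊢
      apply Exec.andThen
      · apply Exec.iteF rfl h2
      exact htail _ 0 _ _ (dropSingles_wf G 0 hG) h1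
    · simp only [Nat.add_zero, Nat.mul_zero] at hm hb ⊢
      rw [hm]
      have : (gsize G + 1) * (2 * L + 8) ≤ (gsize G + 1) * (8 * (L + 1)) :=
        Nat.mul_le_mul_left _ (by omega)
      have : (gsize G + 1) * (8 * (L + 1)) = 8 * ((gsize G + 1) * (L + 1)) := by ring
      omega
  · rw [if_neg (Nat.succ_ne_zero u)]
    apply Outs.mono
    · apply Outs.act_seq
      unfold stG
      simp only [exec_simps, update_st, st_apply, un_succ]
      apply Exec.andThen
      · apply Exec.iteT rfl
        exact Exec.act rfl
      simp only [exec_simps, update_st, st_apply]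
      exact htail G (u + 1) 0 _ hG rfl
    · simp only [Nat.mul_zero, Nat.add_zero]
      omega

end GroupRoutines

/-! ### Reading the input -/

theorem fixedWidthBits_injective {L i j : ℕ} (hi : i < 2 ^ L) (hj : j < 2 ^ L)
    (h : fixedWidthBits L i = fixedWidthBits L j) : i = j := by
  have h1 := cmpBits_fixedWidthBits true false L i j hi hj
  rw [← h, cmpBits_fixedWidthBits true false L i i hi hi] at h1
  simpa using congrArg Prod.fst h1

/-- Add a bit with its index to the groups. -/
def addTok (G : List Grp) (x : ℕ × Bool) : List Grp :=
  match G with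
  | [] => [(x.1, [x.2])]
  | (i, δ) :: G => if i = x.1 then (i, x.2 :: δ) :: G else (x.1, [x.2]) :: (i, δ) :: G

/-- The input for a sequence of bits with their indices. -/
def tokCode (L : ℕ) (T : List (ℕ × Bool)) : List Bool :=
  T.flatMap fun x => x.2 :: fixedWidthBits L x.1

/-- The digits of the top index. -/
def topDigits (L : ℕ) : List Grp → List Bool
  | [] => []
  | (i, _) :: _ => fixedWidthBits L i

theorem length_topDigits (L : ℕ) (G : List Grp) : (topDigits L G).length ≤ L := by
  rcases G with _ | ⟨⟨i, δ⟩, G⟩ <;> simp [topDigits, length_fixedWidthBits]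

section Reading

variable (i h p x y z w u r b t : List StackSym) (o : List Bool)

theorem countP_inner (c : Bool) (n m k : ℕ) (v : Reg) (hv : v.a = (un n).head?) (hc : v.c = c) :
    Ends (forDigits (.act [pushA .w, pushA .w] ;; .ite (fun v => v.c) (.act [pushA .u]) skipP ;;
        .act [popA .z]))
      ⟨v, st i h p x y (un n).tail (un m) (un k) r b t, o⟩ (5 * n + 1)
      (st i h p x y [] (un (m + 2 * n)) (un (k + c.toNat * n)) r b t) o := by
  induction n generalizing m k v with
  | zero =>
    obtain ⟨a, vb, c, e, l⟩ := v
    obtain rfl : a = none := hv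
    exact ⟨_, Exec.to (Exec.loopF rfl) rfl (by omega)⟩
  | succ n ih =>
    obtain ⟨a, vb, c', e, l⟩ := v
    obtain rfl : a = some (some true) := hv
    obtain rfl : c' = c := hc
    obtain ⟨v', hv'⟩ := ih (m + 2) (k + c'.toNat) ⟨(un n).head?, vb, c', e, l⟩ rfl rfl
    refine ⟨v', ?_⟩
    apply Exec.mono
    · apply Exec.loopT rfl
      · apply Exec.act_seq
        simp only [exec_simps, update_st, st_apply, un_succ]
        apply Exec.seq (c' := ⟨⟨some (some true), vb, c', e, l⟩,
          st i h p x y (un n) (un (m + 2)) (un (k + c'.toNat)) r b t, o⟩) (m := 2)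
        · cases c'
          · exact Exec.iteF rfl (Exec.act rfl)
          · refine Exec.iteT (m := 1) rfl (Exec.act ?_)
            simp only [exec_simps, update_st, st_apply]
            rfl
        exact Exec.act rfl
      simp only [exec_simps, update_st, st_apply]
      rw [show m + 2 * (n + 1) = m + 2 + 2 * n by ring,
        show k + c'.toNat * (n + 1) = k + c'.toNat + c'.toNat * n by ring]
      exact hv'
    · omega

/-- The stack `w` holds the current power of two in unary and is doubled for each digit. The cost is
linear in the value `m`, which matters because `t` is not bounded in terms of `h`. -/
theorem countP_exec (m k : ℕ) (v : Reg) :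
    Ends countP ⟨v, st (dg m.bits ++ none :: i) h p x y [] [] (un k) r b t, o⟩ (32 * m + 30)
      (st i h p x y [] [] (un (k + m)) r b t) o := by
  have key : ∀ (B : List Bool) (n k : ℕ) (v : Reg), 1 ≤ n → v.a = (dg B ++ none :: i).head? →
      Ends (forDigits (.act [.load fun v => { v with c := digit v.a }] ;; mv .w .z ;;
          .act [popA .z] ;;
          forDigits (.act [pushA .w, pushA .w] ;; .ite (fun v => v.c) (.act [pushA .u]) skipP ;;
            .act [popA .z]) ;;
          .act [popA .i]))
        ⟨v, st (dg B ++ none :: i).tail h p x y [] (un n) (un k) r b t, o⟩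
        -- The pass with `n` symbols on `w` costs at most `14 * n` steps, and the passes form a
        -- geometric series with sum `n * 2 ^ B.length - n`.
        (14 * (n * 2 ^ B.length - n) + 1)
        (st i h p x y [] (un (n * 2 ^ B.length)) (un (k + n * bitsVal B)) r b t) o := by
    intro B
    induction B with
    | nil =>
      rintro n k ⟨a, b, c, e, l⟩ hn rfl
      refine ⟨⟨some none, b, c, e, l⟩, Exec.to (Exec.loopF rfl) ?_ (by omega)⟩
      simp [bitsVal]
    | cons d B ih =>
      rintro n k ⟨a, vb, c, e, l⟩ hn rfl
      obtain ⟨v', hv'⟩ := countP_inner (dg B ++ none :: i) h p x y r b t o d n 0 k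
        ⟨(un n).head?, vb, d, e, l⟩ rfl rfl
      obtain ⟨v'', hv''⟩ := ih (0 + 2 * n) (k + d.toNat * n)
        { v' with a := (dg B ++ none :: i).head? } (by omega) rfl
      refine ⟨v'', ?_⟩
      apply Exec.mono
      · apply Exec.loopT rfl
        · apply Exec.act_seq
          simp only [exec_simps, update_st, st_apply]
          apply Exec.seq
          · exact mv_exec (by decide) _ _ _ (List.replicate n true) [] (by simp [st_apply, un]) rfl
          simp only [exec_simps, update_st, st_apply, List.reverse_replicate]
          apply Exec.act_seq
          simp only [exec_simps, update_st, st_apply]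
          apply Exec.seq hv'
          exact Exec.act rfl
        simp only [exec_simps, update_st, st_apply]
        rw [show n * 2 ^ (d :: B).length = (0 + 2 * n) * 2 ^ B.length by
            rw [List.length_cons, pow_succ]; ring,
          show k + n * bitsVal (d :: B) = k + d.toNat * n + (0 + 2 * n) * bitsVal B by
            rw [bitsVal]; ring]
        exact hv''
      · have h1 : n * 2 ^ (d :: B).length = (0 + 2 * n) * 2 ^ B.length := by
          rw [List.length_cons, pow_succ]; ring
        have h2 : (0 + 2 * n) * 1 ≤ (0 + 2 * n) * 2 ^ B.length :=
          Nat.mul_le_mul_left _ Nat.one_le_two_pow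
        rw [h1, List.length_replicate]
        omega
  obtain ⟨v', hv'⟩ := key m.bits 1 k { v with a := (dg m.bits ++ none :: i).head? } le_rfl rfl
  -- A number without superfluous digits is at least half the final power of two.
  have hm : 2 ^ m.bits.length ≤ 2 * m + 1 := by
    rcases Nat.eq_zero_or_pos m with rfl | h0
    · simp
    · rw [Nat.size_eq_bits_len]
      have h1 : m.size - 1 < m.size := by
        have := Nat.size_pos.2 h0
        omega
      have h2 := Nat.lt_size.1 h1
      have h3 : 2 ^ m.size = 2 * 2 ^ (m.size - 1) := by
        rw [← pow_succ']
        congr 1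
        have := Nat.size_pos.2 h0
        omega
      omega
  have hw : un (1 * 2 ^ m.bits.length) = dg (List.replicate (2 ^ m.bits.length) true) ++ [] := by
    simp [un]
  refine ⟨{ v' with a := none }, ?_⟩
  unfold countP
  apply Exec.mono
  · apply Exec.act_seq
    simp only [exec_simps, update_st, st_apply]
    apply Exec.seq hv'
    apply Exec.to
    · exact dropP_exec _ _ _ _ (List.replicate (2 ^ m.bits.length) true) []
        (by simpa only [st_apply] using hw) rfl
    · simp only [exec_simps, update_st, st_apply, bitsVal_bits, one_mul]
    · exact le_rfl
  · simp only [List.length_replicate]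
    omega

/-- The digits `D` of `h` serve as a clock that tells when an index has been read completely. At the
same time the index is compared with the previous one, `O`, which may be shorter because it is empty
at the beginning. -/
theorem parseP_inner (N D O : List Bool) (hD : D.length = N.length) (hO : O.length ≤ N.length)
    (rest y z : List StackSym) (v : Reg) (hv : v.a = (dg D).head?) :
    ∃ vb, Exec (forDigits (.act [popB .i, .pop .x (fun v o => { v with eq := v.eq && o == v.b }),
        pushB .y, pushA .z, popA .h]))
      ⟨v, st (dg N ++ rest) (dg D).tail p (dg O) y z w u r b t, o⟩ (2 * N.length + 1)
      ⟨⟨none, vb, v.c, v.eq && decide (O = N), v.lt⟩,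
        st rest [] p [] (dg N.reverse ++ y) (dg D.reverse ++ z) w u r b t, o⟩ := by
  induction N generalizing D O y z v with
  | nil =>
    obtain ⟨a, vb, c, e, l⟩ := v
    obtain rfl : D = [] := by simpa using hD
    obtain rfl : O = [] := by simpa using hO
    obtain rfl : a = none := hv
    exact ⟨vb, Exec.to (Exec.loopF rfl) (by simp) (by simp)⟩
  | cons n N ih =>
    obtain ⟨a, vb, c, e, l⟩ := v
    obtain ⟨d, D, rfl⟩ := List.exists_cons_of_length_eq_add_one hD
    obtain rfl : a = some (some d) := hv
    obtain ⟨vb', hvb'⟩ := ih D O.tail (by simpa using hD) (by simp at hO ⊢; omega)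
      (some n :: y) (some d :: z)
      ⟨(dg D).head?, some (some n), c, e && (dg O).head? == some (some n), l⟩ rfl
    refine ⟨vb', ?_⟩
    apply Exec.mono
    · apply Exec.loopT rfl (Exec.act rfl)
      simp only [exec_simps, update_st, st_apply]
      rw [show (dg O).tail = dg O.tail by cases O <;> rfl]
      apply Exec.to hvb'
      · congr 1
        · congr 1
          rw [Bool.and_assoc]
          congr 1
          cases O with
          | nil => simp
          | cons o O =>
            simp only [dg_cons, exec_simps, List.cons.injEq, Bool.decide_and, List.tail_cons]
            cases o <;> cases n <;> rfl
        · simp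
      · exact le_rfl
    · simp only [List.length_cons]; omega

theorem parseP_exec {L N : ℕ} (hN : N ≤ 2 ^ L) (H P : List Bool) (hH : H.length = L) (hL : 0 < L)
    (T : List (ℕ × Bool)) (hT : ∀ x ∈ T, x.1 < N) (u : ℕ) (v : Reg) :
    Ends parseP ⟨v, st (dg (tokCode L T)) (dg H) (dg P) [] [] [] [] (un u) [] [] [], o⟩
      (T.length * (6 * L + 11) + 2 * L + 5)
      (stG L H P [] (u - T.length) 0 (T.foldl addTok [])) o := by
  have key : ∀ (T : List (ℕ × Bool)) (G : List Grp) (u : ℕ) (v : Reg),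
      (∀ x ∈ T, x.1 < N) → (∀ g ∈ G.head?, g.1 < N) → v.a = (dg (tokCode L T)).head? →
      Ends (forDigits (.act [.load fun v => { v with c := digit v.a, eq := true }, popA .u,
          popA .h] ;;
        forDigits (.act [popB .i, .pop .x (fun v o => { v with eq := v.eq && o == v.b }),
          pushB .y, pushA .z, popA .h]) ;;
        mv .z .h ;;
        .ite (fun v => v.eq) (mv .y .x)
          (.act [pushS .b none, pushS .t none] ;; mv2 .y .x .t) ;;
        .act [.push .b (fun v => some v.c), popA .i]))
        ⟨v, st (dg (tokCode L T)).tail (dg H) (dg P) (dg (topDigits L G)) [] [] [] (un u) []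
          (repB G) (repT L G), o⟩
        (T.length * (6 * L + 11) + 1)
        (st [] (dg H) (dg P) (dg (topDigits L (T.foldl addTok G))) [] [] [] (un (u - T.length)) []
          (repB (T.foldl addTok G)) (repT L (T.foldl addTok G))) o := by
    intro T
    induction T with
    | nil =>
      rintro G u ⟨a, b, c, e, l⟩ - - rfl
      exact ⟨_, Exec.to (Exec.loopF rfl) rfl (by omega)⟩
    | cons x T ih =>
      rintro G u ⟨a, b, c, e, l⟩ hT hG rfl
      obtain ⟨j, d⟩ := x
      have hj : j < N := hT (j, d) (by simp)
      have hG' : ∀ g ∈ (addTok G (j, d)).head?, g.1 < N := by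
        rcases G with _ | ⟨⟨i, δ⟩, G⟩
        · simpa [addTok] using hj
        · simp only [addTok]
          split_ifs with h
          · simpa using h ▸ hj
          · simpa using hj
      obtain ⟨vb, hvb⟩ := parseP_inner (dg P) [] (un (u - 1)) [] (repB G) (repT L G) o
        (fixedWidthBits L j) H (topDigits L G) (by simp [length_fixedWidthBits, hH])
        (by simpa [length_fixedWidthBits] using length_topDigits L G) (dg (tokCode L T)) [] []
        ⟨(dg H).head?, b, d, true, l⟩ rfl
      obtain ⟨v', hv'⟩ := ih (addTok G (j, d)) (u - 1)
        ⟨(dg (tokCode L T)).head?, vb, d, decide (topDigits L G = fixedWidthBits L j), l⟩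
        (fun x hx => hT x (by simp [hx])) hG' rfl
      -- Comparing digits is the same as comparing indices. For the first bit there is no previous
      -- index, and the empty word differs from every index because `L` is positive.
      have heq : (∃ δ G', G = (j, δ) :: G') ∨
          (topDigits L G ≠ fixedWidthBits L j ∧ addTok G (j, d) = (j, [d]) :: G) := by
        rcases G with _ | ⟨⟨i, δ⟩, G⟩
        · refine .inr ⟨fun h => ?_, rfl⟩
          have := congrArg List.length h
          simp [topDigits, length_fixedWidthBits] at this
          omega
        · by_cases h : i = j
          · exact .inl ⟨δ, G, by rw [h]⟩
          · refine .inr ⟨fun h' => h (fixedWidthBits_injective ?_ (hj.trans_le hN) h'),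
              by simp [addTok, h]⟩
            exact (hG (i, δ) rfl).trans_le hN
      have hcode : dg (tokCode L ((j, d) :: T)) =
          some d :: (dg (fixedWidthBits L j) ++ dg (tokCode L T)) := by
        simp [tokCode]
      refine ⟨v', ?_⟩
      apply Exec.mono
      · rw [hcode]
        apply Exec.loopT rfl
        · apply Exec.act_seq
          simp only [exec_simps, update_st, st_apply, un_tail]
          apply Exec.seq hvb
          simp only [exec_simps]
          apply Exec.seq
          · exact mv_exec (by decide) _ _ _ H.reverse [] (by simp [st_apply]) rfl
          simp only [exec_simps, update_st, st_apply, Bool.true_and]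
          apply Exec.seq (m := 2 * L + 4) (c' := ⟨⟨none, vb, d,
            decide (topDigits L G = fixedWidthBits L j), l⟩, st (dg (tokCode L T)) (dg H) (dg P)
            (dg (fixedWidthBits L j)) [] [] [] (un (u - 1)) []
            (repB (addTok G (j, d))).tail (repT L (addTok G (j, d))), o⟩)
          · rcases heq with ⟨δ, G, rfl⟩ | ⟨h1, h2⟩
            · simp only [topDigits, decide_true]
              apply Exec.mono
              · apply Exec.iteT rfl
                apply Exec.to
                · exact mv_exec (by decide) _ _ _ (fixedWidthBits L j).reverse []
                    (by simp [st_apply]) rfl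
                · simp only [exec_simps, update_st, st_apply, addTok, if_true, repB, repT]
                · exact le_rfl
              · simp [length_fixedWidthBits]; omega
            · rw [h2, decide_eq_false h1]
              apply Exec.mono
              · apply Exec.iteF rfl
                apply Exec.act_seq
                simp only [exec_simps, update_st, st_apply]
                apply Exec.to
                · exact mv2_exec (by decide) (by decide) (by decide) _ _ _
                    (fixedWidthBits L j).reverse [] (by simp [st_apply]) rfl
                · simp only [exec_simps, update_st, st_apply, repB, repT]
                · exact le_rfl
              · simp [length_fixedWidthBits]; omega
          exact Exec.act rfl
        simp only [exec_simps, update_st, st_apply]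
        have h1 : some d :: (repB (addTok G (j, d))).tail = repB (addTok G (j, d)) := by
          rcases heq with ⟨δ, G, rfl⟩ | ⟨h1, h2⟩
          · simp [addTok, repB]
          · rw [h2]; rfl
        have h2 : topDigits L (addTok G (j, d)) = fixedWidthBits L j := by
          rcases heq with ⟨δ, G, rfl⟩ | ⟨h1, h2⟩
          · simp [addTok, topDigits]
          · rw [h2]; rfl
        rw [h1, List.length_cons, List.foldl_cons, show u - (T.length + 1) = u - 1 - T.length by
          omega, ← h2]
        rw [h2] at hv' ⊢
        exact hv'
      · simp only [length_fixedWidthBits, List.length_reverse, hH, List.length_cons]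
        ring_nf; omega
  obtain ⟨v', hv'⟩ := key T [] u { v with a := (dg (tokCode L T)).head? } hT (by simp) rfl
  refine ⟨{ v' with a := none }, ?_⟩
  unfold parseP
  apply Exec.mono
  · apply Exec.act_seq
    simp only [exec_simps, update_st, st_apply]
    apply Exec.seq hv'
    apply Exec.to
    · exact dropP_exec _ _ _ _ (topDigits L (T.foldl addTok [])) [] (by simp [st_apply]) rfl
    · simp only [exec_simps, update_st, st_apply]
      rfl
    · exact le_rfl
  · have := length_topDigits L (T.foldl addTok [])
    omega

/-- The numbers `k` and `t` are both added to `u`, with one symbol removed after `k`; every bit of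
the leaf then removes another. What remains is the number of unused bits. -/
theorem readP_exec {h k t p : ℕ} (hk : 1 ≤ k) (hp : p ≤ h) (h1 : 1 ≤ h) (T : List (ℕ × Bool))
    (hT : ∀ x ∈ T, x.1 < h) (C : List Bool) (hC : C = tokCode (Nat.size h) T) (v : Reg) :
    Ends readP ⟨v, st (dg h.bits ++ none :: (dg k.bits ++ none :: (dg t.bits ++ none ::
        (dg p.bits ++ none :: dg C)))) [] [] [] [] [] [] [] [] [] [], []⟩
      (100 * ((k + t + T.length + 1) * (Nat.size h + 1)))
      (stG (Nat.size h) (fixedWidthBits (Nat.size h) h) (fixedWidthBits (Nat.size h) p) []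
        (k - 1 + t - T.length) 0 (T.foldl addTok [])) [] := by
  subst hC
  set L := Nat.size h with hL
  have hh : h < 2 ^ L := Nat.lt_size_self h
  have hL0 : 0 < L := Nat.size_pos.2 h1
  have hpL : p.bits.length ≤ L := by
    rw [Nat.size_eq_bits_len]
    exact Nat.size_le_size hp
  -- The input gives `p` without leading zeros; the comparison with `h` is run only because it pads
  -- `p`.
  have hpad : padBits L p.bits = fixedWidthBits L p := by
    obtain ⟨d, hd⟩ := Nat.exists_eq_add_of_le hpL
    rw [padBits_eq L d _ hd.symm, hd, Nat.size_eq_bits_len,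
      fixedWidthBits_add _ _ _ (Nat.lt_size_self p), fixedWidthBits_size]
  have hb : L = h.bits.length := by rw [Nat.size_eq_bits_len]
  have hbound : T.length * (6 * L + 11) + 32 * (k + t) + 60 * (L + 1) + 60 ≤
      100 * ((k + t + T.length + 1) * (L + 1)) := by
    nlinarith [Nat.zero_le (T.length * L), Nat.zero_le ((k + t) * L)]
  have hfw : fixedWidthBits L h = h.bits := fixedWidthBits_size h
  rw [hfw]
  unfold readP
  apply Ends.mono
  · apply Ends.then
    · exact (mv_exec (by decide) _ _ _ h.bits (none :: (dg k.bits ++ none :: (dg t.bits ++ none :: (dg p.bits ++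
      none :: dg (tokCode L T))))) (by simp only [st_apply]) rfl).ends
    intro v
    simp only [exec_simps, update_st, st_apply]
    apply Ends.then
    · exact (mv_exec (by decide) _ _ _ h.bits.reverse [] (by simp [st_apply]) rfl).ends
    intro v
    simp only [exec_simps, update_st, st_apply]
    apply Ends.then
    · exact countP_exec (k := 0) ..
    intro v
    apply Ends.then
    · exact (Exec.act rfl).ends
    intro v
    simp only [exec_simps, update_st, st_apply, un_tail, Nat.zero_add]
    apply Ends.then
    · exact countP_exec ..
    intro v
    apply Ends.then
    · exact (mv_exec (by decide) _ _ _ p.bits (none :: dg (tokCode L T)) (by simp only [st_apply])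
      rfl).ends
    intro v
    simp only [exec_simps, update_st, st_apply]
    apply Ends.then
    · exact (mv_exec (by decide) _ _ _ p.bits.reverse [] (by simp [st_apply]) rfl).ends
    intro v
    simp only [exec_simps, update_st, st_apply]
    apply Ends.then
    · exact (copyH_exec ..).ends
    intro v
    apply Ends.then
    · exact (cmpP_exec (A := h.bits) (B := p.bits) (hB := by rwa [← hb]) ..).ends
    intro v
    apply Ends.then
    · exact (dropP_exec _ _ _ _ h.bits [] (by simp [st_apply]) rfl).ends
    intro v
    simp only [exec_simps, update_st, st_apply]
    rw [← hb, hpad]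
    exact parseP_exec [] hh.le h.bits (fixedWidthBits L p) hb.symm hL0 T hT (k - 1 + t) v
  · simp only [List.length_reverse, ← hb]
    omega

end Reading

/-! ### The sequences of `ℬ^k_{t,h}`, string by string -/

/-- The number of leading bits of a string. -/
def lead : List Bool → ℕ
  | [] => 0
  | _ :: _ => 1

/-- The strings `β_m` that can come next, if `r` strings of `β_m, …, β_1` have to be non-empty and
`s` non-leading bits are left. -/
def Allowed (r s m : ℕ) (β : List Bool) : Prop :=
  if r = 0 then β = [] else β.length ≤ s + 1 ∧ ((r < m ∧ 0 < s) ∨ β.head? = some false)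

/-- The sequences `β_m, …, β_1` of allowed strings. -/
def Gen : ℕ → ℕ → List (List Bool) → Prop
  | r, _, [] => r = 0
  | r, s, β :: ℓ => Allowed r s (ℓ.length + 1) β ∧ Gen (r - lead β) (s - (β.length - 1)) ℓ

theorem numNonempty_cons (β : List Bool) (ℓ : List (List Bool)) :
    numNonempty (β :: ℓ) = lead β + numNonempty ℓ := by
  cases β <;> simp [numNonempty, lead, List.countP_cons, add_comm]

theorem numNonleading_cons (β : List Bool) (ℓ : List (List Bool)) :
    numNonleading (β :: ℓ) = (β.length - 1) + numNonleading ℓ := by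
  simp [numNonleading]

theorem numBits_eq (ℓ : List (List Bool)) : numBits ℓ = numNonempty ℓ + numNonleading ℓ := by
  induction ℓ with
  | nil => rfl
  | cons β ℓ ih =>
    rw [numNonempty_cons, numNonleading_cons, show numBits (β :: ℓ) = β.length + numBits ℓ by
      simp [numBits], ih]
    cases β <;> simp [lead]; omega

theorem numNonempty_le_length (ℓ : List (List Bool)) : numNonempty ℓ ≤ ℓ.length :=
  List.countP_le_length

theorem numNonempty_eq_length {ℓ : List (List Bool)} :
    numNonempty ℓ = ℓ.length ↔ ∀ β ∈ ℓ, β ≠ [] := by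
  simp [numNonempty, List.countP_eq_length]

/-- The global conditions on prefixes and suffixes are unfolded one string at a time. The instance
`j = 0` of each condition is what `Allowed` says about the first string, and the other instances
pass to the rest with the budgets reduced by what the first string uses. -/
theorem gen_iff (r s : ℕ) (ℓ : List (List Bool)) :
    Gen r s ℓ ↔ numNonempty ℓ = r ∧ numNonleading ℓ ≤ s ∧
      (∀ j < ℓ.length, numNonempty (ℓ.take j) < r → numNonleading (ℓ.take j) = s →
        ℓ[j]? = some [false]) ∧
      (∀ j < ℓ.length, (∀ β ∈ ℓ.drop j, β ≠ []) → ∀ β ∈ ℓ.drop j, β.head? = some false) := by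
  induction ℓ generalizing r s with
  | nil => simp [Gen, numNonempty, numNonleading, eq_comm]
  | cons β ℓ ih =>
    rw [Gen, ih, numNonempty_cons, numNonleading_cons]
    have hlen := numNonempty_le_length ℓ
    constructor
    · rintro ⟨hβ, h1, h2, h3, h4⟩
      unfold Allowed at hβ
      have hr : lead β + numNonempty ℓ = r := by
        split_ifs at hβ with h0
        · subst hβ; simp [lead] at *; omega
        · cases β <;> simp [lead] at * <;> omega
      have hs : β.length - 1 ≤ s := by
        split_ifs at hβ with h0
        · subst hβ; simp
        · omega
      refine ⟨hr, by omega, ?_, ?_⟩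
      · rintro (_ | j) hj hn hl
        · simp only [List.take_zero] at hn hl
          have h0 : r ≠ 0 := by omega
          obtain rfl : s = 0 := by simpa [numNonleading] using hl.symm
          rw [if_neg h0] at hβ
          rcases β with _ | ⟨b, _ | ⟨c, β⟩⟩ <;> simp at hβ ⊢
          exact hβ
        · rw [List.take_succ_cons] at hn hl
          rw [numNonempty_cons] at hn
          rw [numNonleading_cons] at hl
          simpa using h3 j (by simpa using hj) (by omega) (by omega)
      · rintro (_ | j) hj hne
        · simp only [List.drop_zero] at hne ⊢
          have hfull : numNonempty ℓ = ℓ.length :=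
            numNonempty_eq_length.2 fun β hβ => hne β (by simp [hβ])
          have hb : β ≠ [] := hne β (by simp)
          have hl1 : lead β = 1 := by cases β <;> simp_all [lead]
          -- All remaining strings are non-empty, so `r` equals their number, and `r < m` is
          -- impossible.
          rw [if_neg (by omega)] at hβ
          have hhd : β.head? = some false := hβ.2.resolve_left (by omega)
          intro γ hγ
          rcases List.mem_cons.1 hγ with rfl | hγ
          · exact hhd
          · have hpos : 0 < ℓ.length := List.length_pos_of_mem hγ
            exact h4 0 hpos (fun β hβ => hne β (by simpa using .inr hβ)) γ (by simpa using hγ)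
        · simpa using h4 j (by simpa using hj) (by simpa using hne)
    · rintro ⟨hr, hs, h3, h4⟩
      have h30 := h3 0 (by simp)
      have h40 := h4 0 (by simp)
      simp only [List.take_zero, List.drop_zero] at h30 h40
      refine ⟨?_, by omega, by omega, fun j hj hn hl => ?_, fun j hj => ?_⟩
      · unfold Allowed
        split_ifs with h0
        · cases β <;> simp [lead] at * ; omega
        · refine ⟨by omega, ?_⟩
          by_cases hs0 : 0 < s
          · by_cases hrm : r < ℓ.length + 1
            · exact .inl ⟨hrm, hs0⟩
            · right
              have hl1 : lead β = 1 := by cases β <;> simp_all [lead]; omega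
              have hb : β ≠ [] := by rintro rfl; simp [lead] at hl1
              have hfull : ∀ β ∈ ℓ, β ≠ [] := numNonempty_eq_length.1 (by omega)
              exact h40 (by simpa using ⟨hb, hfull⟩) β (by simp)
          -- With no non-leading bit left the third condition forces the string `0`.
          · obtain rfl : s = 0 := by omega
            have := h30 (by simp [numNonempty]; omega) (by simp [numNonleading])
            simp at this
            simp [this]
      · have := h3 (j + 1) (by simpa using hj)
        rw [List.take_succ_cons, numNonempty_cons, numNonleading_cons] at this
        simpa using this (by omega) (by omega)
      · simpa using h4 (j + 1) (by simpa using hj)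

theorem isBGenerator_iff {t h k : ℕ} {ℓ : List (List Bool)} :
    IsBGenerator t h k ℓ ↔ ℓ.length = h - 1 ∧ Gen (k - 1) t ℓ := by
  have hset (Q : ℕ → Prop) : (∀ i, 1 ≤ i → i ≤ h - 1 → Q (h - 1 - i)) ↔ ∀ j < h - 1, Q j := by
    refine ⟨fun H j hj => ?_, fun H i h1 h2 => H _ (by omega)⟩
    have := H (h - 1 - j) (by omega) (by omega)
    rwa [show h - 1 - (h - 1 - j) = j by omega] at this
  rw [gen_iff]
  constructor
  · rintro ⟨h1, h2, h3, h4, h5⟩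
    rw [numBits_eq] at h3
    exact ⟨h1, h2, by omega, h1 ▸ (hset _).1 h4, h1 ▸ (hset _).1 h5⟩
  · rintro ⟨h1, h2, h3, h4, h5⟩
    exact ⟨h1, h2, by rw [numBits_eq]; omega, (hset _).2 (h1 ▸ h4), (hset _).2 (h1 ▸ h5)⟩

theorem Gen.le_length {r s : ℕ} {ℓ : List (List Bool)} (h : Gen r s ℓ) : r ≤ ℓ.length := by
  have := ((gen_iff ..).1 h).1
  have := numNonempty_le_length ℓ
  omega

/-! ### Least strings and sequences -/

theorem bitStringLT_irrefl (β : List Bool) : ¬ bitStringLT β β := by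
  induction β with
  | nil => simp [bitStringLT]
  | cons b β ih => simp [bitStringLT, ih]

/-- Strings with first bit `0` form an initial segment of the order. Hence, if the next string
violates a condition on the first bit, so do all greater ones. -/
theorem head_of_bitStringLT {β γ : List Bool} (h : bitStringLT β γ)
    (hγ : γ.head? = some false) : β.head? = some false := by
  cases β <;> cases γ <;> simp_all [bitStringLT]

theorem seqLT_cons {β γ : List Bool} {ℓ ℓ' : List (List Bool)} :
    seqLT (β :: ℓ) (γ :: ℓ') ↔ bitStringLT β γ ∨ β = γ ∧ seqLT ℓ ℓ' := by
  constructor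
  · intro h
    cases h with
    | rel h => exact .inl h
    | cons h => exact .inr ⟨rfl, h⟩
  · rintro (h | ⟨rfl, h⟩)
    · exact .rel h
    · exact .cons h

/-- The least string greater than `β` among those with at most `n` bits. -/
def nextString : ℕ → List Bool → Option (List Bool)
  | 0, _ => none
  | n + 1, [] => some (true :: List.replicate n false)
  | n + 1, b :: β =>
    match nextString n β with
    | some γ => some (b :: γ)
    | none => if b then none else some []

theorem replicate_false_least (n : ℕ) (β : List Bool) (h : β.length ≤ n) :
    β = List.replicate n false ∨ bitStringLT (List.replicate n false) β := by
  induction n generalizing β with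
  | zero => left; simpa using h
  | succ n ih =>
    rcases β with _ | ⟨b, β⟩
    · right; simp [List.replicate_succ, bitStringLT]
    · have := ih β (by simpa using h)
      cases b <;> simp [List.replicate_succ, bitStringLT, this]

theorem nextString_none {n : ℕ} {β : List Bool} (hβ : β.length ≤ n) (h : nextString n β = none)
    (γ : List Bool) (hγ : γ.length ≤ n) : ¬ bitStringLT β γ := by
  induction n generalizing β γ with
  | zero =>
    obtain rfl : β = [] := by simpa using hβ
    obtain rfl : γ = [] := by simpa using hγ
    simp [bitStringLT]
  | succ n ih =>
    rcases β with _ | ⟨b, β⟩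
    · simp [nextString] at h
    · rw [nextString] at h
      split at h
      · simp at h
      · rename_i hn
        cases b <;> simp at h
        rcases γ with _ | ⟨c, γ⟩
        · simp [bitStringLT]
        · simpa [bitStringLT] using fun _ => ih (by simpa using hβ) hn γ (by simpa using hγ)

/-- Strings of at most `n` bits are ordered like the nodes of a binary tree traversed in order: the
next one is the leftmost node of the right subtree if there is room for it, and otherwise the
nearest ancestor from whose left subtree one returns. -/
theorem nextString_some {n : ℕ} {β β' : List Bool} (hβ : β.length ≤ n) (h : nextString n β = some β') :
    β'.length ≤ n ∧ bitStringLT β β' ∧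
      ∀ γ, γ.length ≤ n → bitStringLT β γ → γ = β' ∨ bitStringLT β' γ := by
  induction n generalizing β β' with
  | zero => simp [nextString] at h
  | succ n ih =>
    rcases β with _ | ⟨b, β⟩
    · obtain rfl : true :: List.replicate n false = β' := by simpa [nextString] using h
      refine ⟨by simp, by simp [bitStringLT], ?_⟩
      rintro (_ | ⟨c, γ⟩) hγ hlt
      · simp [bitStringLT] at hlt
      · obtain rfl : c = true := hlt
        simpa [bitStringLT] using replicate_false_least n γ (by simpa using hγ)
    · rw [nextString] at h
      split at h
      · rename_i γ hn
        obtain rfl : b :: γ = β' := by simpa using h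
        obtain ⟨h1, h2, h3⟩ := ih (by simpa using hβ) hn
        refine ⟨by simpa using h1, by simp [bitStringLT, h2], ?_⟩
        rintro (_ | ⟨c, δ⟩) hδ hlt
        · exact .inr hlt
        · simp only [bitStringLT, List.cons.injEq] at hlt ⊢
          rcases hlt with hlt | ⟨rfl, hlt⟩
          · exact .inr (.inl hlt)
          · simpa using h3 δ (by simpa using hδ) hlt
      · rename_i hn
        cases b <;> simp at h
        subst h
        refine ⟨by simp, by simp [bitStringLT], ?_⟩
        rintro (_ | ⟨c, δ⟩) hδ hlt
        · exact .inl rfl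
        · simp only [bitStringLT] at hlt ⊢
          rcases hlt with hlt | ⟨rfl, hlt⟩
          · exact .inr hlt.2
          · exact absurd hlt (nextString_none (by simpa using hβ) hn δ (by simpa using hδ))

/-- The least sequence of length `m` of allowed strings. -/
def leastSeq : ℕ → ℕ → ℕ → List (List Bool)
  | _, _, 0 => []
  | 0, s, m + 1 => [] :: leastSeq 0 s m
  | r + 1, s, m + 1 => List.replicate (s + 1) false :: leastSeq r 0 m

theorem length_leastSeq (r s m : ℕ) : (leastSeq r s m).length = m := by
  induction m generalizing r s with
  | zero => simp [leastSeq]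
  | succ m ih => cases r <;> simp [leastSeq, ih]

theorem gen_leastSeq {r s m : ℕ} (h : r ≤ m) : Gen r s (leastSeq r s m) := by
  induction m generalizing r s with
  | zero => simpa [leastSeq, Gen] using h
  | succ m ih =>
    cases r with
    | zero => exact ⟨by simp [Allowed], by simpa [lead] using ih (by omega)⟩
    | succ r =>
      refine ⟨by simp [Allowed, List.replicate_succ], ?_⟩
      simpa [lead, List.replicate_succ] using ih (by omega)

/-- Making the first string as small as possible uses up all non-leading bits; after that every
non-empty string has to be `0`, and as `0` is below `ε`, these come as early as possible. -/
theorem leastSeq_least {r s : ℕ} {ℓ : List (List Bool)} (h : Gen r s ℓ) :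
    ℓ = leastSeq r s ℓ.length ∨ seqLT (leastSeq r s ℓ.length) ℓ := by
  induction ℓ generalizing r s with
  | nil => simp [leastSeq]
  | cons β ℓ ih =>
    obtain ⟨h1, h2⟩ := h
    have := ih h2
    cases r with
    | zero =>
      obtain rfl : β = [] := by simpa [Allowed] using h1
      simpa [leastSeq, seqLT_cons, lead, bitStringLT_irrefl] using this
    | succ r =>
      simp only [List.length_cons, leastSeq, seqLT_cons, List.cons.injEq]
      rcases replicate_false_least (s + 1) β (by simp [Allowed] at h1; exact h1.1) with rfl | h
      · simpa [lead, List.replicate_succ, bitStringLT_irrefl] using this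
      · exact .inr (.inl h)

/-- The least allowed string greater than `β`. -/
def nextAllowed (r s m : ℕ) (β : List Bool) : Option (List Bool) :=
  if r = 0 then none
  else (nextString (s + 1) β).filter fun γ => (r < m ∧ 0 < s) ∨ γ.head? = some false

theorem nextAllowed_some {r s m : ℕ} {β β' : List Bool} (hβ : Allowed r s m β)
    (h : nextAllowed r s m β = some β') :
    Allowed r s m β' ∧ bitStringLT β β' ∧
      ∀ γ, Allowed r s m γ → bitStringLT β γ → γ = β' ∨ bitStringLT β' γ := by
  unfold nextAllowed at h
  unfold Allowed at hβ
  split_ifs at h hβ with h0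
  simp only [Option.filter_eq_some_iff, decide_eq_true_eq] at h
  obtain ⟨h1, h2, h3⟩ := nextString_some hβ.1 h.1
  unfold Allowed
  simp only [if_neg h0]
  exact ⟨⟨h1, h.2⟩, h2, fun γ hγ => h3 γ hγ.1⟩

theorem nextAllowed_none {r s m : ℕ} {β : List Bool} (hβ : Allowed r s m β)
    (h : nextAllowed r s m β = none) (γ : List Bool) (hγ : Allowed r s m γ) :
    ¬ bitStringLT β γ := by
  unfold nextAllowed at h
  unfold Allowed at hβ hγ
  split_ifs at h hβ hγ with h0
  · rw [hβ, hγ]; exact bitStringLT_irrefl _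
  · intro hlt
    rw [Option.filter_eq_none_iff] at h
    cases hn : nextString (s + 1) β with
    | none => exact nextString_none hβ.1 hn γ hγ.1 hlt
    | some β' =>
      have h1 := h β' hn
      simp only [decide_eq_true_eq, not_or] at h1
      -- If `γ` is the next string, it fails the filter directly; if it is greater and begins with
      -- `0`, the next string begins with `0` too.
      rcases (nextString_some hβ.1 hn).2.2 γ hγ.1 hlt with rfl | hlt'
      · exact hγ.2.elim h1.1 h1.2
      · exact hγ.2.elim h1.1 fun h => h1.2 (head_of_bitStringLT hlt' h)

/-- The least sequence of allowed strings that is greater than `ℓ` within its first `n` strings. -/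
def nextSeq : ℕ → ℕ → ℕ → List (List Bool) → Option (List (List Bool))
  | 0, _, _, _ => none
  | _ + 1, _, _, [] => none
  | n + 1, r, s, β :: ℓ =>
    match nextSeq n (r - lead β) (s - (β.length - 1)) ℓ with
    | some ℓ' => some (β :: ℓ')
    | none => (nextAllowed r s (ℓ.length + 1) β).map fun β' =>
        β' :: leastSeq (r - lead β') (s - (β'.length - 1)) ℓ.length

theorem Allowed.le {r s m : ℕ} {β : List Bool} (h : Allowed r s (m + 1) β) (hr : r ≤ m + 1) :
    r - lead β ≤ m := by
  unfold Allowed at h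
  split_ifs at h with h0
  · omega
  · cases β <;> simp [lead] at * <;> omega

theorem nextSeq_none {n r s : ℕ} {ℓ : List (List Bool)} (hℓ : Gen r s ℓ)
    (h : nextSeq n r s ℓ = none) (ℓ' : List (List Bool)) (hℓ' : Gen r s ℓ')
    (hlen : ℓ'.length = ℓ.length) : ¬ seqLT (ℓ.take n) (ℓ'.take n) := by
  induction ℓ generalizing n r s ℓ' with
  | nil =>
    obtain rfl : ℓ' = [] := by simpa using hlen
    simp [seqLT]
  | cons β ℓ ih =>
    rcases ℓ' with _ | ⟨γ, ℓ'⟩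
    · simp at hlen
    cases n with
    | zero => simp [seqLT]
    | succ n =>
      rw [nextSeq] at h
      split at h
      · simp at h
      · rename_i hn
        simp only [Option.map_eq_none_iff] at h
        simp only [List.length_cons, Nat.add_right_cancel_iff] at hlen
        simp only [List.take_succ_cons, seqLT_cons, not_or, not_and]
        refine ⟨nextAllowed_none hℓ.1 h γ (hlen ▸ hℓ'.1), ?_⟩
        rintro rfl
        exact ih hℓ.2 hn ℓ' hℓ'.2 hlen

/-- A change further down gives a smaller sequence than a change higher up, so the recursion is
tried first. If it fails, `nextSeq_none` excludes all competitors that agree with `ℓ` in the current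
string. -/
theorem nextSeq_some {n r s : ℕ} {ℓ ℓ' : List (List Bool)} (hℓ : Gen r s ℓ)
    (h : nextSeq n r s ℓ = some ℓ') :
    (Gen r s ℓ' ∧ ℓ'.length = ℓ.length ∧ seqLT (ℓ.take n) (ℓ'.take n)) ∧
      ∀ ℓ'', Gen r s ℓ'' → ℓ''.length = ℓ.length → seqLT (ℓ.take n) (ℓ''.take n) →
        ℓ'' = ℓ' ∨ seqLT ℓ' ℓ'' := by
  induction ℓ generalizing n r s ℓ' with
  | nil => cases n <;> simp [nextSeq] at h
  | cons β ℓ ih =>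
    cases n with
    | zero => simp [nextSeq] at h
    | succ n =>
      rw [nextSeq] at h
      split at h
      · rename_i ℓ₁ hn
        obtain rfl : β :: ℓ₁ = ℓ' := by simpa using h
        obtain ⟨⟨h1, h2, h3⟩, h4⟩ := ih hℓ.2 hn
        refine ⟨⟨⟨h2 ▸ hℓ.1, h1⟩, by simp [h2], ?_⟩, ?_⟩
        · exact List.Lex.cons h3
        · rintro (_ | ⟨γ, ℓ''⟩) hg hlen hlt
          · simp at hlen
          simp only [List.length_cons, Nat.add_right_cancel_iff] at hlen
          simp only [List.take_succ_cons, seqLT_cons] at hlt ⊢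
          rcases hlt with hlt | ⟨rfl, hlt⟩
          · exact .inr (.inl hlt)
          · simpa [bitStringLT_irrefl] using h4 ℓ'' hg.2 hlen hlt
      · rename_i hn
        simp only [Option.map_eq_some_iff] at h
        obtain ⟨β', hβ', rfl⟩ := h
        obtain ⟨h1, h2, h3⟩ := nextAllowed_some hℓ.1 hβ'
        have hr : r ≤ ℓ.length + 1 := by simpa using hℓ.le_length
        refine ⟨⟨⟨by simpa [length_leastSeq] using h1, gen_leastSeq (h1.le hr)⟩,
          by simp [length_leastSeq], List.Lex.rel h2⟩, ?_⟩
        rintro (_ | ⟨γ, ℓ''⟩) hg hlen hlt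
        · simp at hlen
        simp only [List.length_cons, Nat.add_right_cancel_iff] at hlen
        simp only [List.take_succ_cons, seqLT_cons, List.cons.injEq] at hlt ⊢
        rcases hlt with hlt | ⟨rfl, hlt⟩
        · rcases h3 γ (hlen ▸ hg.1) hlt with rfl | h
          · simpa [hlen, bitStringLT_irrefl] using leastSeq_least hg.2
          · exact .inr (.inl h)
        · exact absurd hlt (nextSeq_none hℓ.2 hn ℓ'' hg.2 hlen)

theorem treeLeaves_treeB {t h k : ℕ} (hk : k ≤ h) :
    treeLeaves (treeB t h k) = {ℓ | ℓ.length = h - 1 ∧ Gen (k - 1) t ℓ} := by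
  ext ℓ
  simp only [treeLeaves, treeB, generatedTree, Set.mem_ofPred_eq, isBGenerator_iff]
  constructor
  · rintro ⟨h1, h2⟩
    obtain ⟨ℓ', hℓ', τ, rfl⟩ : ∃ ℓ', (ℓ'.length = h - 1 ∧ Gen (k - 1) t ℓ') ∧ ℓ <+: ℓ' := by
      -- The root is a node by definition. To see that it is a leaf only if it is itself a
      -- generating sequence one needs some such sequence, and `leastSeq` provides one because `k ≤
      -- h`.
      rcases h1 with rfl | h1
      · exact ⟨leastSeq (k - 1) t (h - 1), ⟨length_leastSeq .., gen_leastSeq (by omega)⟩,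
          List.nil_prefix⟩
      · exact h1
    rcases τ with _ | ⟨a, τ⟩
    · simpa using hℓ'
    · exact absurd (.inr ⟨_, hℓ', τ, by simp⟩) (h2 a)
  · refine fun hℓ => ⟨.inr ⟨ℓ, hℓ, List.prefix_rfl⟩, ?_⟩
    rintro a (h | ⟨ℓ', hℓ', hp⟩)
    · simp at h
    · have := hp.length_le
      simp at this
      omega

theorem isLevelSuccessor_nextSeq {t h k p : ℕ} (hk : k ≤ h) {ℓ : List (List Bool)}
    (hlen : ℓ.length = h - 1) (hℓ : Gen (k - 1) t ℓ) :
    IsLevelSuccessor (treeB t h k) h p ℓ (nextSeq (h - p) (k - 1) t ℓ) := by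
  cases hn : nextSeq (h - p) (k - 1) t ℓ with
  | none =>
    rw [IsLevelSuccessor, Set.eq_empty_iff_forall_notMem]
    rintro ℓ' ⟨h1, h2⟩
    rw [treeLeaves_treeB hk] at h1
    exact nextSeq_none hℓ hn ℓ' h1.2 (by rw [h1.1, hlen]) h2
  | some ℓ' =>
    obtain ⟨⟨h1, h2, h3⟩, h4⟩ := nextSeq_some hℓ hn
    rw [IsLevelSuccessor]
    simp only [leavesAbove, Set.mem_ofPred_eq, treeLeaves_treeB hk]
    refine ⟨⟨⟨by omega, h1⟩, h3⟩, fun ℓ'' h => h4 ℓ'' h.1.2 (by omega) h.2⟩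

/-! ### The algorithm computes successors -/

/-- The groups of the strings `β_i, β_{i+1}, …`. -/
def groups : ℕ → List (List Bool) → List Grp
  | _, [] => []
  | i, [] :: C => groups (i + 1) C
  | i, (b :: β) :: C => (i, (b :: β).reverse) :: groups (i + 1) C

/-- The group of a string with index `i`. -/
def group (i : ℕ) : List Bool → List Grp
  | [] => []
  | b :: β => [(i, (b :: β).reverse)]

theorem groups_cons (i : ℕ) (β : List Bool) (C : List (List Bool)) :
    groups i (β :: C) = group i β ++ groups (i + 1) C := by
  cases β <;> rfl

theorem lead_of_ne_nil {β : List Bool} (h : β ≠ []) : lead β = 1 := by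
  cases β with
  | nil => exact absurd rfl h
  | cons b β => rfl

theorem group_of_ne_nil (i : ℕ) {β : List Bool} (h : β ≠ []) : group i β = [(i, β.reverse)] := by
  cases β with
  | nil => exact absurd rfl h
  | cons b β => rfl

theorem groups_append (i : ℕ) (C D : List (List Bool)) :
    groups i (C ++ D) = groups i C ++ groups (i + C.length) D := by
  induction C generalizing i with
  | nil => rfl
  | cons β C ih =>
    rw [List.cons_append, groups_cons, groups_cons, ih, List.append_assoc, List.length_cons,
      show i + 1 + C.length = i + (C.length + 1) by omega]

/-- The groups of the sequence `β_m, …, β_1`. -/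
def topGroups (ℓ : List (List Bool)) : List Grp := groups 1 ℓ.reverse

theorem topGroups_cons (β : List Bool) (ℓ : List (List Bool)) :
    topGroups (β :: ℓ) = topGroups ℓ ++ group (ℓ.length + 1) β := by
  simp [topGroups, groups_append, groups_cons, groups, add_comm]

theorem topGroups_leastSeq_zero {r m : ℕ} (hr : r ≤ m) (G : List Grp) :
    topGroups (leastSeq r 0 m) ++ G = singles r (m + 1) G := by
  induction m generalizing r G with
  | zero =>
    obtain rfl : r = 0 := by omega
    rfl
  | succ m ih =>
    cases r with
    | zero =>
      rw [leastSeq, topGroups_cons, group, List.append_nil, ih (by omega)]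
      rfl
    | succ r =>
      rw [leastSeq, topGroups_cons, List.append_assoc, ih (by omega), length_leastSeq]
      rfl

/-- This is the form in which the machine writes the least completion: one padded group right below
the index `m + 1`, then single zeros at consecutive indices. -/
theorem topGroups_leastSeq {r s m : ℕ} (hr : r ≤ m) (G : List Grp) :
    topGroups (leastSeq r s m) ++ G = lower s r (m + 1) G := by
  rcases r with _ | r
  · rw [lower, if_pos rfl]
    exact (congrArg (topGroups · ++ G) (show leastSeq 0 s m = leastSeq 0 0 m by
      clear hr
      induction m with
      | zero => rfl
      | succ m ih => rw [leastSeq, leastSeq, ih])).trans (topGroups_leastSeq_zero hr G)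
  · obtain ⟨m, rfl⟩ : ∃ n, m = n + 1 := ⟨m - 1, by omega⟩
    rw [leastSeq, topGroups_cons, List.append_assoc, topGroups_leastSeq_zero (by omega),
      length_leastSeq, lower, if_neg (by omega), ← List.replicate_succ']
    simp [List.replicate_succ, group, ← List.replicate_succ']

/-- The groups of the least sequence above that first differs from `β_i, β_{i+1}, …` in a string
with an index at least `p`, if `r` strings and `s` non-leading bits are left below `β_i`. -/
def nextGroups (p : ℕ) : ℕ → ℕ → ℕ → List (List Bool) → Option (List Grp)
  | _, _, _, [] => none
  | i, r, s, β :: C =>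
    match if p ≤ i then nextAllowed (r + lead β) (s + (β.length - 1)) i β else none with
    | some β' => some (topGroups (leastSeq (r + lead β - lead β')
        (s + (β.length - 1) - (β'.length - 1)) (i - 1)) ++ (group i β' ++ groups (i + 1) C))
    | none => nextGroups p (i + 1) (r + lead β) (s + (β.length - 1)) C

/-- The strings `β_i, β_{i+1}, …` are allowed, if `r` strings and `s` non-leading bits are left
below `β_i`. -/
def AllAllowed : ℕ → ℕ → ℕ → List (List Bool) → Prop
  | _, _, _, [] => True
  | i, r, s, β :: C => Allowed (r + lead β) (s + (β.length - 1)) i β ∧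
      AllAllowed (i + 1) (r + lead β) (s + (β.length - 1)) C

/-- Read upwards, the budgets of a string are those left below it plus what the string itself uses.
-/
theorem allAllowed_of_gen {r s i : ℕ} {C ℓ : List (List Bool)}
    (h : Gen (r + numNonempty C) (s + numNonleading C) (C.reverse ++ ℓ)) (hi : ℓ.length + 1 = i) :
    AllAllowed i r s C ∧ Gen r s ℓ := by
  induction C generalizing r s i ℓ with
  | nil => exact ⟨trivial, h⟩
  | cons β C ih =>
    rw [numNonempty_cons, numNonleading_cons, ← add_assoc, ← add_assoc, List.reverse_cons,
      List.append_assoc] at h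
    obtain ⟨h1, h2, h3⟩ := ih (i := i + 1) h (by simp [hi])
    subst hi
    exact ⟨⟨h2, h1⟩, by simpa using h3⟩

theorem nextSeq_append {n r s : ℕ} {C ℓ ℓ' : List (List Bool)} (h : nextSeq n r s ℓ = some ℓ') :
    nextSeq (n + C.length) (r + numNonempty C) (s + numNonleading C) (C.reverse ++ ℓ) =
      some (C.reverse ++ ℓ') := by
  induction C generalizing n r s ℓ ℓ' with
  | nil => exact h
  | cons β C ih =>
    rw [numNonempty_cons, numNonleading_cons, ← add_assoc, ← add_assoc, List.reverse_cons,
      List.append_assoc, List.append_assoc, List.length_cons, add_comm C.length, ← add_assoc]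
    apply ih
    simp [nextSeq, h]

/-- Turns the recursion from the top into a search from the bottom. The hypothesis `hℓ` says that
nothing below the index `i` can be increased at a level at least `p`; it is void for `i ≤ p`, where
the truncated difference is zero. -/
theorem topGroups_nextSeq {h p i r s : ℕ} {C ℓ : List (List Bool)} (hi : ℓ.length + 1 = i)
    (hC : i + C.length = h) (hℓ : nextSeq (h - p - C.length) r s ℓ = none) :
    (nextSeq (h - p) (r + numNonempty C) (s + numNonleading C) (C.reverse ++ ℓ)).map topGroups =
      nextGroups p i r s C := by
  induction C generalizing i r s ℓ with
  | nil =>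
    simp only [List.length_nil, Nat.sub_zero] at hℓ
    simp [numNonempty, numNonleading, hℓ, nextGroups]
  | cons β C ih =>
    rw [numNonempty_cons, numNonleading_cons, ← add_assoc, ← add_assoc, List.reverse_cons,
      List.append_assoc, List.cons_append, List.nil_append, nextGroups]
    simp only [List.length_cons] at hC hℓ
    by_cases hp : p ≤ i
    · rw [if_pos hp]
      have hn : h - p - C.length = (h - p - (C.length + 1)) + 1 := by omega
      have hβ : nextSeq (h - p - C.length) (r + lead β) (s + (β.length - 1)) (β :: ℓ) =
          (nextAllowed (r + lead β) (s + (β.length - 1)) i β).map fun β' =>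
            β' :: leastSeq (r + lead β - lead β') (s + (β.length - 1) - (β'.length - 1))
              ℓ.length := by
        rw [hn, nextSeq]
        simp only [Nat.add_sub_cancel, hℓ, hi]
      cases hβ' : nextAllowed (r + lead β) (s + (β.length - 1)) i β with
      | none =>
        rw [hβ', Option.map_none] at hβ
        exact ih (by simp [hi]) (by omega) hβ
      | some β' =>
        rw [hβ', Option.map_some] at hβ
        have := nextSeq_append (C := C) hβ
        rw [show h - p - C.length + C.length = h - p by omega] at this
        rw [this]
        simp [topGroups, groups_append, groups_cons, length_leastSeq, ← hi, add_comm]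
    · rw [if_neg hp]
      refine ih (by simp [hi]) (by omega) ?_
      rw [show h - p - C.length = 0 by omega]
      rfl

/-! ### The effect of taking successors on the bits in use -/

theorem nextString_append (n : ℕ) (β : List Bool) (h : β.length ≤ n) :
    nextString (n + 1) β = some (β ++ true :: List.replicate (n - β.length) false) := by
  induction β generalizing n with
  | nil => simp [nextString]
  | cons b β ih =>
    obtain ⟨n, rfl⟩ : ∃ m, n = m + 1 := ⟨n - 1, by simp at h; omega⟩
    rw [nextString, ih n (by simpa using h)]
    simp

theorem afterTrues_append (δ : List Bool) (b : Bool) :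
    afterTrues (δ ++ [b]) = if afterTrues δ = [] then afterTrues [b] else afterTrues δ ++ [b] := by
  induction δ with
  | nil => rfl
  | cons d δ ih =>
    cases d
    · simp [afterTrues]
    · exact ih

theorem afterTrues_suffix (δ : List Bool) : afterTrues δ <:+ δ := by
  induction δ with
  | nil => exact List.suffix_rfl
  | cons d δ ih =>
    cases d
    · exact List.suffix_rfl
    · exact ih.trans (List.suffix_cons ..)

/-- Without a spare bit the next string is found by deleting the trailing `1`s and the `0` before
them; it does not exist if all bits are `1`. -/
theorem nextString_length (β : List Bool) :
    nextString β.length β = match afterTrues β.reverse with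
      | [] => none
      | _ :: γ => some γ.reverse := by
  induction β with
  | nil => rfl
  | cons b β ih =>
    rw [List.length_cons, nextString, ih, List.reverse_cons, afterTrues_append]
    cases h : afterTrues β.reverse with
    | nil => cases b <;> simp [afterTrues]
    | cons d γ => simp

theorem dropLow_groups_of_le {p i : ℕ} (h : p ≤ i) (C : List (List Bool)) (u r : ℕ) :
    dropLow p (groups i C) u r = (groups i C, u, r) := by
  induction C generalizing i with
  | nil => rfl
  | cons β C ih =>
    rcases β with _ | ⟨b, β⟩
    · exact ih (by omega)
    · simp [groups, dropLow, h]

theorem insertOne_groups {p i : ℕ} (h : p < i) (C : List (List Bool)) (u r : ℕ) :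
    insertOne p (groups i C) u r =
      singles (r - 1) p ((p, List.replicate u false ++ [true]) :: groups i C) := by
  induction C generalizing i with
  | nil => rfl
  | cons β C ih =>
    rcases β with _ | ⟨b, β⟩
    · exact ih (by omega)
    · simp [groups, insertOne, h.ne']

theorem nextGroups_cons_of_none {p i r s : ℕ} {β : List Bool} {C : List (List Bool)}
    (h : p ≤ i → nextAllowed (r + lead β) (s + (β.length - 1)) i β = none) :
    nextGroups p i r s (β :: C) = nextGroups p (i + 1) (r + lead β) (s + (β.length - 1)) C := by
  rw [nextGroups]
  split_ifs with hp
  · rw [h hp]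
  · rfl

theorem nextGroups_congr {p q i r s : ℕ} (hp : p ≤ i) (hq : q ≤ i) (C : List (List Bool)) :
    nextGroups p i r s C = nextGroups q i r s C := by
  induction C generalizing i r s with
  | nil => rfl
  | cons β C ih =>
    rw [nextGroups, nextGroups, if_pos hp, if_pos hq, ih (by omega) (by omega)]

/-- With a spare bit the next string always exists and is allowed: a non-empty string keeps its
first bit, and where `ε` is allowed with `r > 0`, any first bit is. -/
theorem nextAllowed_append {r s m : ℕ} {β : List Bool} (h : Allowed r s m β) (hr : 0 < r)
    (hβ : β.length ≤ s) :
    nextAllowed r s m β = some (β ++ true :: List.replicate (s - β.length) false) := by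
  unfold Allowed at h
  unfold nextAllowed
  rw [if_neg hr.ne'] at h ⊢
  rw [nextString_append s β hβ, Option.filter_some_pos]
  simp only [decide_eq_true_eq]
  rcases β with _ | ⟨b, β⟩
  · exact .inl (by simpa using h.2)
  · simpa using h.2

theorem nextGroups_raise_here {h i r s : ℕ} {β : List Bool} {C : List (List Bool)}
    (hβ : Allowed (r + lead β) (s + (β.length - 1)) i β) (hs : 0 < s) (hr : 0 < r + lead β)
    (hri : r < i) (hih : i ≠ h) :
    nextGroups i i r s (β :: C) = checked h i (groups i (β :: C)) s r := by
  obtain ⟨i, rfl⟩ : ∃ j, i = j + 1 := ⟨i - 1, by omega⟩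
  have := nextAllowed_append hβ hr (by omega)
  rw [nextGroups, if_pos le_rfl, this, checked, if_neg hih.symm, raiseAt,
    dropLow_groups_of_le le_rfl]
  simp only [Nat.add_sub_cancel, Option.some.injEq]
  rcases β with _ | ⟨b, β⟩
  · simp only [lead, List.length_nil, List.nil_append, List.length_cons, List.length_replicate,
      Nat.add_zero, Nat.sub_zero, Nat.zero_sub, Nat.add_sub_cancel, Nat.sub_self, groups, group]
    rw [topGroups_leastSeq_zero (by omega), insertOne_groups (by omega)]
    simp
  · simp only [lead, List.length_cons, List.cons_append, group, groups]
    rw [insertOne, if_pos rfl, Nat.add_sub_cancel]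
    simp only [List.length_append, List.length_cons, List.length_replicate]
    -- The raised string takes all non-leading bits, so only single zeros follow below.
    rw [show s + (β.length + 1 - 1) - (β.length + (s + (β.length + 1 - 1) - (β.length + 1) + 1) +
      1 - 1) = 0 by omega, topGroups_leastSeq_zero (by omega),
      show s + (β.length + 1 - 1) - (β.length + 1) = s - 1 by omega]
    simp

/-- The levels below `p` are passed without a choice, and their strings only add to the budgets, as
`dropLow` does. At `p` the string can be raised because a non-leading bit and a non-empty string are
available; if `p = h`, there is no string. -/
theorem nextGroups_raise {h p i r s : ℕ} {C : List (List Bool)} (hC : AllAllowed i r s C)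
    (hs : 0 < s) (hr : 0 < r) (hri : r < i) (hip : i ≤ p) (hph : p ≤ h) (hlen : i + C.length = h) :
    nextGroups p i r s C = checked h p (groups i C) s r := by
  induction C generalizing i r s with
  | nil =>
    obtain rfl : h = p := by simp at hlen; omega
    simp [nextGroups, checked]
  | cons β C ih =>
    simp only [List.length_cons] at hlen
    rcases hip.eq_or_lt with rfl | hip
    · exact nextGroups_raise_here hC.1 hs (by omega) hri (by omega)
    · rw [nextGroups_cons_of_none (by omega), ih hC.2 (by omega) (by omega)
        (by cases β <;> simp [lead] <;> omega) hip (by omega)]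
      rcases β with _ | ⟨b, β⟩
      · rfl
      · simp [checked, raiseAt, groups, dropLow, hip, lead]

theorem nextGroups_raise_above {h p i r s : ℕ} {C : List (List Bool)} (hC : AllAllowed i r s C)
    (hs : 0 < s) (hr : 0 < r) (hri : r < i) (hpi : p ≤ i) (hlen : i + C.length = h) :
    nextGroups p i r s C = checked h i (groups i C) s r := by
  rw [nextGroups_congr hpi le_rfl]
  exact nextGroups_raise hC hs hr hri le_rfl (by omega) hlen

/-- No bit is free at the index `i`, so `nextString_length` applies, and its cases are those of
`strip`. If no shorter string is possible, the freed bits make the very next index raisable; `hβ`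
guarantees that one of them is non-leading. -/
theorem nextGroups_strip {h p i r : ℕ} {b : Bool} {β : List Bool} {C : List (List Bool)}
    (hC : AllAllowed i r 0 ((b :: β) :: C)) (hβ : β ≠ []) (hri : r < i) (hpi : p ≤ i)
    (hlen : i + (C.length + 1) = h) :
    nextGroups p i r 0 ((b :: β) :: C) = strip h i (b :: β).reverse (groups (i + 1) C) r := by
  have hpos : 0 < β.length := List.length_pos_of_ne_nil hβ
  obtain ⟨hall, hrest⟩ := hC
  simp only [lead, List.length_cons, Nat.zero_add, Nat.add_sub_cancel] at hall hrest
  have hnone : nextAllowed (r + 1) β.length i (b :: β) = none →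
      nextGroups p i r 0 ((b :: β) :: C) = checked h (i + 1) (groups (i + 1) C) β.length (r + 1) := by
    intro h0
    rw [nextGroups_cons_of_none (by simpa [lead] using fun _ => h0)]
    simp only [lead, List.length_cons, Nat.zero_add, Nat.add_sub_cancel]
    exact nextGroups_raise_above hrest hpos (by omega) (by omega) (by omega) (by omega)
  have hsome (β' : List Bool) (h0 : nextAllowed (r + 1) β.length i (b :: β) = some β')
      (hl : r + 1 - lead β' ≤ i - 1) :
      nextGroups p i r 0 ((b :: β) :: C) = some (lower (β.length - (β'.length - 1))
        (r + 1 - lead β') i (group i β' ++ groups (i + 1) C)) := by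
    rw [nextGroups, if_pos hpi, lead_of_ne_nil (List.cons_ne_nil b β)]
    simp only [List.length_cons, Nat.zero_add, Nat.add_sub_cancel, h0]
    rw [topGroups_leastSeq hl, show i - 1 + 1 = i by omega]
  have hnext := nextString_length (b :: β)
  have hlen' := trues_add_length_afterTrues (b :: β).reverse
  have hna : nextAllowed (r + 1) β.length i (b :: β) = (nextString (b :: β).length (b :: β)).filter
      fun γ => (r + 1 < i ∧ 0 < β.length) ∨ γ.head? = some false := if_neg (by omega)
  rw [hnext] at hna
  rw [strip]
  simp only [List.length_reverse, List.length_cons] at hlen'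
  rcases haft : afterTrues (b :: β).reverse with _ | ⟨d, _ | ⟨e, γ⟩⟩ <;>
    simp only [haft, List.length_nil, List.length_cons] at hlen' hna ⊢
  · rw [hnone (by simpa using hna), show trues (b :: β).reverse - 1 = β.length by omega]
  · rw [show trues (b :: β).reverse = β.length by omega]
    -- The next string is `ε`. It is allowed only if all `r + 1` strings fit into the `i - 1` places
    -- below.
    split_ifs with hi
    · exact hnone (by rw [hna, List.reverse_nil, Option.filter_some_neg (by simp [hi])])
    · rw [hsome [] (hna.trans (Option.filter_some_pos
        (by simp [hpos, show r + 1 < i by omega]))) (by simp [lead]; omega)]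
      simp [lead, group]
  · have hne : (e :: γ).reverse ≠ [] := by simp
    -- The shortened string is a non-empty prefix, so it has the same first bit and inherits
    -- admissibility.
    have hhd : (e :: γ).reverse.head? = some b := by
      obtain ⟨τ, hτ⟩ := afterTrues_suffix (b :: β).reverse
      have hβ : b :: β = (e :: γ).reverse ++ d :: τ.reverse := by
        rw [← (b :: β).reverse_reverse, ← hτ, haft]
        simp
      rw [← List.head?_append_of_ne_nil _ hne (l₂ := d :: τ.reverse), ← hβ, List.head?_cons]
    rw [hsome _ (hna.trans (Option.filter_some_pos ?_)) (by rw [lead_of_ne_nil hne]; omega),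
      lead_of_ne_nil hne, group_of_ne_nil i hne, List.reverse_reverse, List.length_reverse,
      List.length_cons, show β.length - (γ.length + 1 - 1) = trues (b :: β).reverse + 1 by omega]
    · rfl
    · simp only [Allowed, Nat.add_one_ne_zero, if_false] at hall
      rw [hhd]
      simpa using hall.2

/-- The lowest strings are `ε`, and no non-empty string is left for them, so they cannot change. The
first non-empty string can be raised if its level is allowed; if not, it supplies the leading bit
for raising at `p`. -/
theorem nextGroups_of_pos {h p i u : ℕ} {C : List (List Bool)} (hC : AllAllowed i 0 u C)
    (hu : 0 < u) (hi : 0 < i) (hph : p ≤ h) (hlen : i + C.length = h) :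
    nextGroups p i 0 u C = succTop h p u 0 (groups i C) := by
  induction C generalizing i with
  | nil => rfl
  | cons β C ih =>
    simp only [List.length_cons] at hlen
    rcases β with _ | ⟨b, β⟩
    · rw [nextGroups_cons_of_none (by simp [nextAllowed, lead])]
      exact ih hC.2 (by omega) (by omega)
    · rw [groups, succTop, succGroups]
      split_ifs with hip
      · rw [nextGroups_cons_of_none (by omega)]
        rw [nextGroups_raise hC.2 (by omega) (by simp [lead]) (by simp [lead]; omega) hip hph
          (by omega)]
        simp [checked, raiseAt, dropLow, hip, lead]
      · omega
      · rw [nextGroups_congr (by omega) le_rfl]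
        exact nextGroups_raise_here hC.1 hu (by simp [lead]) hi (by omega)

/-- With no non-leading bit left, an empty string has nothing to place, and a single bit must be
`0`, whose next string `ε` is not allowed. So the first string that matters has at least two bits.
-/
theorem nextGroups_zero {h p i r : ℕ} {C : List (List Bool)} (hC : AllAllowed i r 0 C)
    (hri : r < i) (hph : p ≤ h) (hlen : i + C.length = h) :
    nextGroups p i r 0 C =
      succTop h p 0 (dropSingles (groups i C) r).2 (dropSingles (groups i C) r).1 := by
  induction C generalizing i r with
  | nil => rfl
  | cons β C ih =>
    simp only [List.length_cons] at hlen
    rcases β with _ | ⟨b, _ | ⟨c, β⟩⟩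
    · have h0 : r = 0 := by simpa [Allowed, lead] using hC.1
      rw [nextGroups_cons_of_none (by simp [nextAllowed, lead, h0])]
      exact ih hC.2 (by simp [lead]; omega) (by omega)
    · have hb : b = false := by simpa [Allowed, lead] using hC.1
      rw [nextGroups_cons_of_none (by simp [nextAllowed, lead, hb, nextString])]
      simp only [groups, dropSingles]
      exact ih hC.2 (by simp [lead]; omega) (by omega)
    · have hd : dropSingles (groups i ((b :: c :: β) :: C)) r =
          ((i, (b :: c :: β).reverse) :: groups (i + 1) C, r) := by
        simp [groups, dropSingles]
      rw [hd, succTop, succGroups]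
      split_ifs with hip
      · rw [nextGroups_cons_of_none (by omega)]
        rw [nextGroups_raise hC.2 (by simp) (by simp [lead]) (by simp [lead]; omega) hip hph
          (by omega)]
        simp [checked, raiseAt, dropLow, hip, lead]
      · exact nextGroups_strip hC (by simp) hri (by omega) hlen
      · contradiction

theorem topGroups_nextSeq_eq_algo {t h k p : ℕ} (h1 : 1 ≤ h) (hph : p ≤ h)
    {ℓ : List (List Bool)} (hlen : ℓ.length = h - 1) (hℓ : Gen (k - 1) t ℓ) :
    (nextSeq (h - p) (k - 1) t ℓ).map topGroups = algo h p (k - 1 + t - numBits ℓ) (topGroups ℓ) := by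
  obtain ⟨hr, hs, -⟩ := (gen_iff ..).1 hℓ
  have hrev1 : numNonempty ℓ.reverse = k - 1 := by
    rw [← hr]; simp [numNonempty]
  have hrev2 : numNonleading ℓ.reverse = numNonleading ℓ := by
    simp [numNonleading, List.sum_reverse]
  -- Exactly `k - 1` leading bits are in use, so all unused bits are non-leading.
  rw [numBits_eq, hr, Nat.add_sub_add_left]
  obtain ⟨u, rfl⟩ : ∃ u, t = u + numNonleading ℓ := ⟨_, (Nat.sub_add_cancel hs).symm⟩
  have hall := (allAllowed_of_gen (r := 0) (s := u) (C := ℓ.reverse) (ℓ := []) (i := 1)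
    (by simpa [hrev1, hrev2] using hℓ) rfl).1
  have key := topGroups_nextSeq (h := h) (p := p) (i := 1) (r := 0) (s := u) (C := ℓ.reverse)
    (ℓ := []) rfl (by simp; omega) (by cases h - p - ℓ.reverse.length <;> rfl)
  rw [hrev1, hrev2, List.append_nil, List.reverse_reverse, Nat.zero_add] at key
  rw [key, Nat.add_sub_cancel, algo, topGroups]
  split_ifs with hu
  · subst hu
    exact nextGroups_zero hall (by omega) hph (by simp; omega)
  · exact nextGroups_of_pos hall (by omega) (by omega) hph (by simp; omega)

/-! ### The representation of sequences -/

/-- The bits of a sequence with their indices. -/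
def bitsWithIndex : List (List Bool) → List (ℕ × Bool)
  | [] => []
  | β :: ℓ => β.map (Prod.mk (ℓ.length + 1)) ++ bitsWithIndex ℓ

theorem leafCode_eq {h : ℕ} {ℓ : List (List Bool)} (hℓ : ℓ.length = h - 1) :
    leafCode h ℓ = tokCode (Nat.size h) (bitsWithIndex ℓ) := by
  have key : ∀ (ℓ : List (List Bool)) (j : ℕ), h - 1 = ℓ.length + j →
      ((ℓ.zipIdx j).flatMap fun x => x.1.flatMap fun b =>
        b :: fixedWidthBits (Nat.size h) (h - 1 - x.2)) =
      tokCode (Nat.size h) (bitsWithIndex ℓ) := by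
    intro ℓ
    induction ℓ with
    | nil => intro j _; rfl
    | cons β ℓ ih =>
      intro j hj
      simp only [List.length_cons] at hj
      rw [List.zipIdx_cons, List.flatMap_cons, ih (j + 1) (by omega), bitsWithIndex]
      simp [tokCode, List.flatMap_map, show h - 1 - j = ℓ.length + 1 by omega]
  exact key ℓ 0 (by omega)

theorem length_bitsWithIndex (ℓ : List (List Bool)) : (bitsWithIndex ℓ).length = numBits ℓ := by
  induction ℓ with
  | nil => rfl
  | cons β ℓ ih => simp [bitsWithIndex, ih, numBits]

theorem bitsWithIndex_le {ℓ : List (List Bool)} {x : ℕ × Bool} (hx : x ∈ bitsWithIndex ℓ) :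
    x.1 ≤ ℓ.length := by
  induction ℓ with
  | nil => simp [bitsWithIndex] at hx
  | cons β ℓ ih =>
    rw [bitsWithIndex, List.mem_append] at hx
    rcases hx with hx | hx
    · obtain ⟨b, -, rfl⟩ := List.mem_map.1 hx
      simp
    · have := ih hx
      simp; omega

theorem length_tokCode (L : ℕ) (T : List (ℕ × Bool)) :
    (tokCode L T).length = T.length * (L + 1) := by
  induction T with
  | nil => simp [tokCode]
  | cons x T ih =>
    rw [tokCode, List.flatMap_cons, List.length_append, ← tokCode, ih]
    simp [length_fixedWidthBits]
    ring

theorem tokCode_injective {L N : ℕ} (hN : N ≤ 2 ^ L) {T T' : List (ℕ × Bool)}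
    (hT : ∀ x ∈ T, x.1 < N) (hT' : ∀ x ∈ T', x.1 < N) (h : tokCode L T = tokCode L T') :
    T = T' := by
  induction T generalizing T' with
  | nil =>
    cases T' with
    | nil => rfl
    | cons x T' => simp [tokCode] at h
  | cons x T ih =>
    cases T' with
    | nil => simp [tokCode] at h
    | cons y T' =>
      obtain ⟨i, b⟩ := x
      obtain ⟨j, c⟩ := y
      simp only [tokCode, List.flatMap_cons, List.cons_append, List.cons.injEq] at h
      obtain ⟨rfl, h⟩ := h
      obtain ⟨h1, h2⟩ := List.append_inj h (by simp [length_fixedWidthBits])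
      have hi : i < N := hT (i, b) (by simp)
      have hj : j < N := hT' (j, b) (by simp)
      rw [fixedWidthBits_injective (hi.trans_le hN) (hj.trans_le hN) h1,
        ih (fun x hx => hT x (by simp [hx])) (fun x hx => hT' x (by simp [hx])) h2]

theorem bitsWithIndex_injective {ℓ ℓ' : List (List Bool)} (hlen : ℓ.length = ℓ'.length)
    (h : bitsWithIndex ℓ = bitsWithIndex ℓ') : ℓ = ℓ' := by
  induction ℓ generalizing ℓ' with
  | nil => exact (List.length_eq_zero_iff.1 hlen.symm).symm
  | cons β ℓ ih =>
    cases ℓ' with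
    | nil => simp at hlen
    | cons γ ℓ' =>
      simp only [List.length_cons, Nat.add_right_cancel_iff] at hlen
      -- The first string can be recovered as the bits carrying the greatest index, since all others
      -- carry smaller ones.
      have key (ℓ₁ : List (List Bool)) (δ : List Bool) :
          ((bitsWithIndex (δ :: ℓ₁)).filter fun x => x.1 = ℓ₁.length + 1).map Prod.snd = δ := by
        have h1 : (bitsWithIndex ℓ₁).filter (fun x => x.1 = ℓ₁.length + 1) = [] := by
          rw [List.filter_eq_nil_iff]
          intro x hx
          have := bitsWithIndex_le hx
          simp; omega
        rw [bitsWithIndex, List.filter_append, h1, List.append_nil, List.filter_eq_self.2]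
        · simp [Function.comp_def]
        · intro x hx
          obtain ⟨b, -, rfl⟩ := List.mem_map.1 hx
          simp
      have hβ : β = γ := by rw [← key ℓ β, ← key ℓ' γ, h, hlen]
      subst hβ
      rw [bitsWithIndex, bitsWithIndex, hlen, List.append_cancel_left_eq] at h
      rw [ih hlen h]

theorem leafCode_injOn {h : ℕ} (h1 : 1 ≤ h) : Set.InjOn (leafCode h) {ℓ | ℓ.length = h - 1} := by
  intro ℓ hℓ ℓ' hℓ' heq
  simp only [Set.mem_ofPred_eq] at hℓ hℓ'
  rw [leafCode_eq hℓ, leafCode_eq hℓ'] at heq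
  refine bitsWithIndex_injective (hℓ.trans hℓ'.symm)
    (tokCode_injective (Nat.lt_size_self h).le (fun x hx => ?_) (fun x hx => ?_) heq)
  · have := bitsWithIndex_le hx; omega
  · have := bitsWithIndex_le hx; omega

/-! ### Groups as they are read and written -/

theorem foldl_addTok (i : ℕ) (β : List Bool) (G : List Grp) (hG : ∀ g ∈ G.head?, i < g.1) :
    (β.map (Prod.mk i)).foldl addTok G = group i β ++ G := by
  have key : ∀ (β δ : List Bool),
      (β.map (Prod.mk i)).foldl addTok ((i, δ) :: G) = (i, β.reverse ++ δ) :: G := by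
    intro β
    induction β with
    | nil => intro δ; rfl
    | cons b β ih => intro δ; simp [addTok, ih]
  cases β with
  | nil => rfl
  | cons b β =>
    have : addTok G (i, b) = (i, [b]) :: G := by
      rcases G with _ | ⟨⟨j, δ⟩, G⟩
      · rfl
      · simp [addTok, (hG (j, δ) rfl).ne']
    rw [List.map_cons, List.foldl_cons, this, key]
    simp [group]

/-- Bits arrive with non-increasing indices, so comparing with the index of the top group alone is
enough to assemble the groups. -/
theorem foldl_addTok_bitsWithIndex (ℓ : List (List Bool)) (G : List Grp)
    (hG : ∀ g ∈ G.head?, ℓ.length < g.1) :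
    (bitsWithIndex ℓ).foldl addTok G = topGroups ℓ ++ G := by
  induction ℓ generalizing G with
  | nil => rfl
  | cons β ℓ ih =>
    rw [bitsWithIndex, List.foldl_append, foldl_addTok _ _ _ (by simpa using hG), ih,
      topGroups_cons, List.append_assoc]
    intro g hg
    cases β with
    | nil => exact (Nat.lt_succ_self _).trans (hG g hg)
    | cons b β =>
      obtain rfl : (ℓ.length + 1, (b :: β).reverse) = g := by simpa [group] using hg
      exact Nat.lt_succ_self _

theorem outBits_eq (L i : ℕ) (δ o : List Bool) :
    outBits L i δ o = tokCode L (δ.reverse.map (Prod.mk i)) ++ o := by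
  induction δ generalizing o with
  | nil => rfl
  | cons b δ ih => simp [outBits, ih, tokCode]

theorem outG_append (L : ℕ) (G G' : List Grp) (o : List Bool) :
    outG L (G ++ G') o = outG L G' (outG L G o) := by
  induction G generalizing o with
  | nil => rfl
  | cons g G ih => exact ih _

theorem outG_topGroups (L : ℕ) (ℓ : List (List Bool)) :
    outG L (topGroups ℓ) [] = tokCode L (bitsWithIndex ℓ) := by
  induction ℓ with
  | nil => rfl
  | cons β ℓ ih =>
    rw [topGroups_cons, outG_append, ih, bitsWithIndex]
    cases β with
    | nil => rfl
    | cons b β => rw [group, outG, outG, outBits_eq, List.reverse_reverse]; simp [tokCode]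

theorem successorOutput_eq {h : ℕ} (o : Option (List (List Bool)))
    (ho : ∀ ℓ ∈ o, ℓ.length = h - 1) :
    successorOutput h o = resultOut (Nat.size h) (o.map topGroups) := by
  cases o with
  | none => rfl
  | some ℓ =>
    rw [Option.map_some, resultOut, outG_topGroups, ← leafCode_eq (ho ℓ rfl), successorOutput]

theorem groupsWF_groups {N i r : ℕ} (C : List (List Bool)) (hr : r < i) (hN : i + C.length ≤ N) :
    GroupsWF N r (groups i C) := by
  induction C generalizing i r with
  | nil => trivial
  | cons β C ih =>
    simp only [List.length_cons] at hN
    cases β with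
    | nil => exact ih (by omega) (by omega)
    | cons b β => exact ⟨hr, by omega, by simp, ih (by omega) (by omega)⟩

theorem gsize_append (G G' : List Grp) : gsize (G ++ G') = gsize G + gsize G' := by
  induction G with
  | nil => simp [gsize]
  | cons g G ih => simp [gsize, ih]; omega

theorem gsize_topGroups_le (ℓ : List (List Bool)) : gsize (topGroups ℓ) ≤ 2 * numBits ℓ := by
  induction ℓ with
  | nil => simp [topGroups, groups, gsize]
  | cons β ℓ ih =>
    have : gsize (group (ℓ.length + 1) β) ≤ 2 * β.length := by
      cases β <;> simp [group, gsize]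
    rw [topGroups_cons, gsize_append, show numBits (β :: ℓ) = β.length + numBits ℓ by
      simp [numBits]]
    omega

theorem Gen.numBits_le {r s : ℕ} {ℓ : List (List Bool)} (h : Gen r s ℓ) : numBits ℓ ≤ r + s := by
  obtain ⟨h1, h2, -⟩ := (gen_iff ..).1 h
  rw [numBits_eq]
  omega

/-! ### The size of the stacks -/

section Growth

variable {K σ : Type}

/-- A bound for the number of operations in a block of a program. -/
def Prog.width : Prog K σ → ℕ
  | .act l => l.length
  | .seq p q => p.width + q.width
  | .ite _ p q => p.width + q.width
  | .loop _ p => p.width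

variable [DecidableEq K]

theorem length_stk_exec (c : PState K σ) (a : Op K σ) (k : K) :
    ((a.exec c).stk k).length ≤ (c.stk k).length + 1 := by
  cases a with
  | push k' f => by_cases h : k = k' <;> simp [Op.exec, Function.update_apply, h]
  | pop k' f => by_cases h : k = k' <;> simp [Op.exec, Function.update_apply, h]; omega
  | load f => simp [Op.exec]
  | emit f => simp [Op.exec]

theorem length_stk_foldl (l : List (Op K σ)) (c : PState K σ) (k : K) :
    ((l.foldl Op.exec c).stk k).length ≤ (c.stk k).length + l.length := by
  induction l generalizing c with
  | nil => simp
  | cons a l ih =>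
    have h1 := ih (a.exec c)
    have h2 := length_stk_exec c a k
    simp only [List.foldl_cons, List.length_cons]
    omega

/-- A block pushes at most as many symbols as it has operations, and each block is charged one step.
This bounds the cost of clearing the stacks without tracking their final contents. -/
theorem Prog.Run.length_stk_le {p : Prog K σ} {c c' : PState K σ} {n : ℕ} (h : p.Run c n c') (k : K)
    {w : ℕ} (hw : p.width ≤ w) : (c'.stk k).length ≤ (c.stk k).length + w * n := by
  induction h with
  | act l c =>
    have := length_stk_foldl l c k
    simp only [Prog.width] at hw
    omega
  | seq _ _ ih₁ ih₂ =>
    simp only [Prog.width] at hw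
    have := ih₁ (by omega)
    have := ih₂ (by omega)
    rw [mul_add]; omega
  | iteT _ _ ih =>
    simp only [Prog.width] at hw
    have := ih (by omega)
    rw [mul_add]; omega
  | iteF _ _ ih =>
    simp only [Prog.width] at hw
    have := ih (by omega)
    rw [mul_add]; omega
  | loopF => omega
  | loopT _ _ _ ih₁ ih₂ =>
    have := ih₁ hw
    have := ih₂ hw
    rw [mul_add, mul_add]; omega

theorem Exec.length_stk_le {p : Prog K σ} {c c' : PState K σ} {n : ℕ} (h : Exec p c n c') (k : K) :
    (c'.stk k).length ≤ (c.stk k).length + p.width * n := by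
  obtain ⟨m, hm, hr⟩ := h
  have := hr.length_stk_le k le_rfl
  have := Nat.mul_le_mul_left p.width hm
  omega

end Growth

/-! ### The running time -/

/-- A number `h` has at most `log h + 1` digits, and the two extra units are absorbed by the maximum
with `1`, which also covers `h = 1`. -/
theorem size_le_logb (h : ℕ) :
    (Nat.size h : ℝ) + 1 ≤ 3 * max 1 (Real.logb 2 (h : ℝ)) := by
  have hs : Nat.size h ≤ Nat.log 2 h + 1 := Nat.size_le.2 (Nat.lt_pow_succ_log_self one_lt_two h)
  have hl := Real.natLog_le_logb h 2
  have h2 : (Nat.size h : ℝ) ≤ Nat.log 2 h + 1 := by exact_mod_cast hs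
  have := le_max_left 1 (Real.logb 2 (h : ℝ))
  have := le_max_right 1 (Real.logb 2 (h : ℝ))
  norm_num at hl
  linarith

theorem mul_size_le_logBound (h k t : ℕ) :
    (((k + t) * (Nat.size h + 1) : ℕ) : ℝ) ≤ 3 * logBound h k t := by
  have := size_le_logb h
  rw [logBound]
  push_cast
  nlinarith [(Nat.cast_nonneg k : (0 : ℝ) ≤ k), (Nat.cast_nonneg t : (0 : ℝ) ≤ t)]

theorem length_leafCode_le {h k t : ℕ} {ℓ : List (List Bool)} (hlen : ℓ.length = h - 1)
    (hℓ : Gen (k - 1) t ℓ) : (leafCode h ℓ).length ≤ (k + t) * (Nat.size h + 1) := by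
  rw [leafCode_eq hlen, length_tokCode, length_bitsWithIndex]
  have := hℓ.numBits_le
  exact Nat.mul_le_mul_right _ (by omega)

theorem length_successorInput_le {h k t p : ℕ} (hk : 1 ≤ k) (hkh : k ≤ h) (hph : p ≤ h)
    {ℓ : List (List Bool)} (hlen : ℓ.length = h - 1) (hℓ : Gen (k - 1) t ℓ) :
    (successorInput h k t p ℓ).length ≤ 9 * ((k + t) * (Nat.size h + 1)) := by
  have h1 := length_leafCode_le hlen hℓ
  have h2 := Nat.size_le_size hkh
  have h3 := Nat.size_le_size hph
  -- The length of `t` has to be charged to `t` itself, not to `log h`.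
  have h4 : Nat.size t ≤ t := Nat.size_le.2 Nat.lt_two_pow_self
  have h5 : k + t + Nat.size h ≤ (k + t) * (Nat.size h + 1) := by
    nlinarith [Nat.zero_le (t * Nat.size h), Nat.mul_le_mul_right (Nat.size h) hk]
  simp only [successorInput, List.length_append, List.length_cons, List.length_map,
    Nat.size_eq_bits_len]
  omega

/-- The constant factor of the running time, if `w` is the width of the program. -/
def timeConstant (w : ℕ) : ℕ := 1300 + 22 * (9 + w * 1250)

/-- Reading and the main part take at most `1250 * N` steps; clearing costs `22` per symbol of the
bound for the stacks, plus `23`. The difference between `1300` and `1250` absorbs this constant and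
leaves one step for halting, hence the `- 1`. -/
theorem successorP_exec {h k t p : ℕ} (hk : 1 ≤ k) (hkh : k ≤ h) (hph : p ≤ h)
    {ℓ : List (List Bool)} (hlen : ℓ.length = h - 1) (hℓ : Gen (k - 1) t ℓ) :
    Exec successorP
      ⟨Reg.init, Function.update (fun _ => []) .i (successorInput h k t p ℓ), []⟩
      (timeConstant (readP ;; bodyP).width * ((k + t) * (Nat.size h + 1)) - 1)
      ⟨Reg.init, fun _ => [], successorOutput h (nextSeq (h - p) (k - 1) t ℓ)⟩ := by
  have hh : 1 ≤ h := hk.trans hkh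
  have hlt := Nat.lt_size_self h
  have hbits := hℓ.numBits_le
  have hinit : Function.update (fun _ => []) Stk.i (successorInput h k t p ℓ) =
      st (dg h.bits ++ none :: (dg k.bits ++ none :: (dg t.bits ++ none ::
        (dg p.bits ++ none :: dg (leafCode h ℓ))))) [] [] [] [] [] [] [] [] [] [] := by
    funext s; cases s <;> rfl
  have hread := readP_exec (t := t) hk hph hh (bitsWithIndex ℓ)
    (fun x hx => by have := bitsWithIndex_le hx; omega) (leafCode h ℓ) (leafCode_eq hlen) Reg.init
  rw [foldl_addTok_bitsWithIndex ℓ [] (by simp), List.append_nil, length_bitsWithIndex,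
    ← hinit] at hread
  obtain ⟨v₁, hread⟩ := hread
  obtain ⟨S, v₂, hbody⟩ := bodyP_exec (Nat.size_pos.2 hh) hlt (hph.trans_lt hlt)
    (k - 1 + t - numBits ℓ) (topGroups ℓ)
    (groupsWF_groups ℓ.reverse one_pos (by simp; omega)) v₁
  rw [← topGroups_nextSeq_eq_algo hh hph hlen hℓ, ← successorOutput_eq _ fun ℓ' h' => by
    rw [(nextSeq_some hℓ h').1.2.1, hlen]] at hbody
  have hrun := hread.seq hbody
  set N := (k + t) * (Nat.size h + 1) with hN
  have htime : 100 * ((k + t + numBits ℓ + 1) * (Nat.size h + 1)) +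
      350 * ((gsize (topGroups ℓ) + (k - 1 + t - numBits ℓ) + 1) * (Nat.size h + 1)) ≤
      -- From `100 * 2 + 350 * 3`: a leaf has at most `k - 1 + t` bits, and `gsize` is at most twice
      -- their number.
      1250 * N := by
    have hg := gsize_topGroups_le ℓ
    have h1 : (k + t + numBits ℓ + 1) * (Nat.size h + 1) ≤ 2 * N := by
      rw [hN, ← mul_assoc]; exact Nat.mul_le_mul_right _ (by omega)
    have h2 : (gsize (topGroups ℓ) + (k - 1 + t - numBits ℓ) + 1) * (Nat.size h + 1) ≤ 3 * N := by
      rw [hN, ← mul_assoc]; exact Nat.mul_le_mul_right _ (by omega)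
    omega
  have hrun := hrun.mono htime
  have hsize (s : Stk) : (S s).length ≤ 9 * N + (readP ;; bodyP).width * (1250 * N) := by
    have h1 := hrun.length_stk_le s
    have h2 := length_successorInput_le hk hkh hph hlen hℓ
    refine h1.trans (Nat.add_le_add_right ?_ _)
    cases s <;> first | exact h2 | exact Nat.zero_le _
  have hclean := cleanupP_exec v₂ S (successorOutput h (nextSeq (h - p) (k - 1) t ℓ)) _ hsize
  have hNpos : 1 ≤ N := Nat.mul_pos (by omega) (by omega)
  refine (hread.seq (hbody.seq hclean)).mono ?_
  generalize (readP ;; bodyP).width = w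
  have hC : timeConstant w * N = 1300 * N + 22 * (9 * N + w * (1250 * N)) := by
    rw [timeConstant]; ring
  omega

theorem mainTheorem8 :
    (∃ C : ℝ, ∀ t h k : ℕ, 1 ≤ k → k ≤ h →
      Set.InjOn (leafCode h) (treeLeaves (treeB t h k)) ∧
      ∀ ℓ ∈ treeLeaves (treeB t h k), ((leafCode h ℓ).length : ℝ) ≤ C * logBound h k t) ∧
    (∃ (M : Turing.TM2ComputableAux (Option Bool) Bool) (C : ℝ),
      ∀ t h k p : ℕ, 1 ≤ k → k ≤ h → 1 ≤ p → p ≤ h →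
        ∀ ℓ ∈ treeLeaves (treeB t h k),
          ∃ o : Option (List (List Bool)), IsLevelSuccessor (treeB t h k) h p ℓ o ∧
            ∃ m : ℕ, (m : ℝ) ≤ C * logBound h k t ∧
              OutputsWithin M (successorInput h k t p ℓ) (successorOutput h o) m) := by
  constructor
  · refine ⟨3, fun t h k hk hkh => ?_⟩
    rw [treeLeaves_treeB hkh]
    refine ⟨(leafCode_injOn (hk.trans hkh)).mono fun ℓ hℓ => hℓ.1, fun ℓ hℓ => ?_⟩
    exact (Nat.cast_le.2 (length_leafCode_le hℓ.1 hℓ.2)).trans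
      (mul_size_le_logBound h k t)
  · refine ⟨successorP.toTM2 .i Reg.init, timeConstant (readP ;; bodyP).width * 3, fun t h k p hk hkh _ hph ℓ hℓ => ?_⟩
    rw [treeLeaves_treeB hkh] at hℓ
    refine ⟨nextSeq (h - p) (k - 1) t ℓ, isLevelSuccessor_nextSeq hkh hℓ.1 hℓ.2, _, ?_,
      (successorP_exec hk hkh hph hℓ.1 hℓ.2).outputsWithin⟩
    have h1 := mul_size_le_logBound h k t
    generalize (readP ;; bodyP).width = w
    set N := (k + t) * (Nat.size h + 1) with hN
    have hpos : 1 ≤ timeConstant w * N :=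
      Nat.mul_pos (by rw [timeConstant]; omega) (Nat.mul_pos (by omega) (by omega))
    rw [Nat.sub_add_cancel hpos, Nat.cast_mul, mul_assoc]
    exact mul_le_mul_of_nonneg_left h1 (Nat.cast_nonneg _)
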